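/- Let $\Bbbk$ be a field, $H$ a Hopf algebra over $\Bbbk$, and let $R$ be a Hopf algebra in the category ${}^H_H\mathcal{YD}$ of left-left Yetter–Drinfeld modules over $H$, with action $h\cdot r$ and coaction $r\mapsto r_{(-1)}\otimes r_{(0)}$. For a Yetter–Drinfeld module $X$ and a left $H$-module $V$ put $c_{X,V}(x\otimes v)=x_{(-1)}v\otimes x_{(0)}$. Let $\mathscr H=R\#H$ be the bosonization, i.e. the (classical) Hopf algebra on $R\otimes H$ with $$(r\otimes h)(r'\otimes h')=r(h_{(1)}\cdot r')\otimes h_{(2)}h',\qquad \Delta(r\otimes h)=(r_{(1)}\otimes r_{(2)(-1)}h_{(1)})\otimes(r_{(2)(0)}\otimes h_{(2)}).$$ * $Z(R)$ is the set of two-cocycles $\pi:R\otimes R\to\Bbbk$ in the category of left $H$-modules: $\pi$ is $H$-linear; $\pi$ is convolution invertible with $H$-linear inverse, with respect to $\Delta_{R\otimes R}(r\otimes s)=(r_{(1)}\otimes r_{(2)(-1)}\cdot s_{(1)})\otimes(r_{(2)(0)}\otimes s_{(2)})$; $\pi(1\otimes1)=1$; and, for all $r,s,t\in R$, $\pi(r_{(1)}\otimes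 r_{(2)(-1)}\cdot s_{(1)})\,\pi(r_{(2)(0)}s_{(2)}\otimes t)=\pi(s_{(1)}\otimes s_{(2)(-1)}\cdot t_{(1)})\,\pi(r\otimes s_{(2)(0)}t_{(2)})$. * $\mathrm C(R)$ is the set of isomorphism classes of pairs $(\mathscr E,\gamma)$, where $\mathscr E$ is an $R$-cleft object in the category of left $H$-modules and $\gamma$ a section. That is: $\mathscr E$ is an $H$-module algebra and a right $R$-comodule with $H$-linear coaction $e\mapsto e_{(0)}\otimes e_{(1)}$ that is an algebra morphism for the multiplication $(e\otimes r)(e'\otimes r')=e(r_{(-1)}\cdot e')\otimes r_{(0)}r'$ on $\mathscr E\otimes R$; the unit $\Bbbk\to\mathscr E$ is the equalizer of the coaction and $e\mapsto e\otimes1$; and $\gamma:R\to\mathscr E$ is an $H$-linear morphism of right $R$-comodules with $\gamma(1)=1$ that is convolution invertible with $H$-linear inverse. Isomorphisms are $H$-linear comodule algebra isomorphisms compatible with the sections. * $\mathrm C(\mathscr H)$ is the set of isomorphism classes of pairs $(E,\gamma)$, where $E$ is a (classical) right $\mathscr H$-cleft object, i.e. a right $\mathscr H$-comodule algebra for which the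 unit $\Bbbk\to E$ is the equalizer of the coaction and $e\mapsto e\otimes 1$, and $\gamma:\mathscr H\to E$ is a convolution invertible morphism of right comodules with $\gamma(1)=1$. $\mathrm C'(\mathscr H)$ is the set of those $[(E,\gamma)]\in\mathrm C(\mathscr H)$ with $$\gamma\big((1\otimes h)(r\otimes h')(1\otimes h'')\big)=\gamma(1\otimes h)\,\gamma(r\otimes h')\,\gamma(1\otimes h'')\qquad(r\in R,\ h,h',h''\in H).$$ * For $[(\mathscr E,\gamma)]\in \mathrm C(R)$, $\mathscr E\#H$ is the smash product algebra on $\mathscr E\otimes H$, $(e\otimes h)(e'\otimes h')=e(h_{(1)}\cdot e')\otimes h_{(2)}h'$, with $\mathscr H$-coaction $e\otimes h\mapsto(e_{(0)}\otimes e_{(1)(-1)}h_{(1)})\otimes(e_{(1)(0)}\otimes h_{(2)})$. * For $\pi\in Z(R)$ let $\Phi(\pi)(r\otimes h,\,r'\otimes h')=\pi(r\otimes h\cdot r')\,\varepsilon(h')$. For a form $\sigma:\mathscr H\otimes\mathscr H\to\Bbbk$, $\Bbbk\#_\sigma\mathscr H$ is the space $\mathscr H$ with multiplication $x\otimes y\mapsto\sigma(x_{(1)}\otimes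 y_{(1)})\,x_{(2)}y_{(2)}$, unit $1$ and coaction $\Delta_{\mathscr H}$. Then $$\mathrm C'(\mathscr H)=\{[(\mathscr E\#H,\ \gamma\otimes\mathrm{id})]\mid[(\mathscr E,\gamma)]\in\mathrm C(R)\}=\{[(\Bbbk\#_{\Phi(\pi)}\mathscr H,\ \mathrm{id}_{\mathscr H})]\mid\pi\in Z(R)\}.$$ (In particular, the pairs on the right-hand sides are cleft objects with sections.) -/

import Mathlib

open scoped TensorProduct

universe v u

namespace BraidedCleft

noncomputable section

section Basic

variable (k : Type v) (H : Type u) [Field k] [Ring H] [HopfAlgebra k H]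

/-- The action `h ⊗ m ↦ h • m` of `H` on a left `H`-module, as a linear map. -/
def act (M : Type u) [AddCommGroup M] [Module k M] [Module H M] [IsScalarTower k H M] :
    H ⊗[k] M →ₗ[k] M :=
  TensorProduct.lift (Algebra.lsmul k k M : H →ₐ[k] Module.End k M).toLinearMap

/-- The diagonal action `h ⊗ (m ⊗ n) ↦ h₁ • m ⊗ h₂ • n` on the tensor product of two left
`H`-modules. -/
def diagAct (M N : Type u) [AddCommGroup M] [Module k M] [Module H M] [IsScalarTower k H M]
    [AddCommGroup N] [Module k N] [Module H N] [IsScalarTower k H N] :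
    H ⊗[k] (M ⊗[k] N) →ₗ[k] M ⊗[k] N :=
  TensorProduct.map (act k H M) (act k H N) ∘ₗ
    (TensorProduct.tensorTensorTensorComm k H H M N).toLinearMap ∘ₗ
      (Coalgebra.comul (R := k) (A := H)).rTensor (M ⊗[k] N)

variable {k H}

/-- For a map `δ : V → H ⊗ V`, `v ↦ v₍₋₁₎ ⊗ v₍₀₎`, and a left `H`-module `W`, the map
`c : V ⊗ W → W ⊗ V`, `v ⊗ w ↦ v₍₋₁₎ • w ⊗ v₍₀₎`. -/
def leftBraid {V : Type u} [AddCommGroup V] [Module k V] (δ : V →ₗ[k] H ⊗[k] V)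
    (W : Type u) [AddCommGroup W] [Module k W] [Module H W] [IsScalarTower k H W] :
    V ⊗[k] W →ₗ[k] W ⊗[k] V :=
  (act k H W).rTensor V ∘ₗ (TensorProduct.rightComm k H V W).toLinearMap ∘ₗ δ.rTensor W

/-- The map `id ⊗ c ⊗ id`, that is
`(a ⊗ v) ⊗ (w ⊗ b) ↦ (a ⊗ v₍₋₁₎ • w) ⊗ (v₍₀₎ ⊗ b)`. -/
def midBraid {V : Type u} [AddCommGroup V] [Module k V] (δ : V →ₗ[k] H ⊗[k] V)
    (A W B : Type u) [AddCommGroup A] [Module k A] [AddCommGroup B] [Module k B]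
    [AddCommGroup W] [Module k W] [Module H W] [IsScalarTower k H W] :
    (A ⊗[k] V) ⊗[k] (W ⊗[k] B) →ₗ[k] (A ⊗[k] W) ⊗[k] (V ⊗[k] B) :=
  (TensorProduct.assoc k (A ⊗[k] W) V B).toLinearMap ∘ₗ
    ((TensorProduct.assoc k A W V).symm.toLinearMap ∘ₗ (leftBraid δ W).lTensor A ∘ₗ
      (TensorProduct.assoc k A V W).toLinearMap).rTensor B ∘ₗ
    (TensorProduct.assoc k (A ⊗[k] V) W B).symm.toLinearMap

/-- The convolution product `f * g = μ (f ⊗ g) Δ` with respect to a multiplication `μ` and a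
comultiplication `Δ`. -/
def conv {C B : Type*} [AddCommGroup C] [Module k C] [AddCommGroup B] [Module k B]
    (μ : B ⊗[k] B →ₗ[k] B) (Δ : C →ₗ[k] C ⊗[k] C) (f g : C →ₗ[k] B) : C →ₗ[k] B :=
  μ ∘ₗ TensorProduct.map f g ∘ₗ Δ

@[simp]
theorem act_tmul {M : Type u} [AddCommGroup M] [Module k M] [Module H M] [IsScalarTower k H M]
    (h : H) (m : M) : act k H M (h ⊗ₜ m) = h • m := rfl

theorem midBraid_sum {V : Type u} [AddCommGroup V] [Module k V] (δ : V →ₗ[k] H ⊗[k] V)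
    (A W B : Type u) [AddCommGroup A] [Module k A] [AddCommGroup B] [Module k B]
    [AddCommGroup W] [Module k W] [Module H W] [IsScalarTower k H W]
    (a : A) (v : V) (w : W) (b : B) {ι : Type*} (s : Finset ι) (x : ι → H) (y : ι → V)
    (hs : δ v = ∑ i ∈ s, x i ⊗ₜ[k] y i) :
    midBraid δ A W B ((a ⊗ₜ v) ⊗ₜ (w ⊗ₜ b)) = ∑ i ∈ s, (a ⊗ₜ (x i • w)) ⊗ₜ (y i ⊗ₜ b) := by
  simp [midBraid, leftBraid, hs, TensorProduct.sum_tmul, TensorProduct.tmul_sum]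

theorem midBraid_map {E F : Type u} [AddCommGroup E] [Module k E] [AddCommGroup F] [Module k F]
    {R : Type u} [AddCommGroup R] [Module k R]
    (f : E →ₗ[k] F) (δ : R →ₗ[k] H ⊗[k] R) (t : E ⊗[k] R) (u : H ⊗[k] H) :
    midBraid δ F H H (f.rTensor R t ⊗ₜ u) =
      (f.rTensor H).rTensor (R ⊗[k] H) (midBraid δ E H H (t ⊗ₜ u)) := by
  induction t using TensorProduct.induction_on with
  | zero => simp
  | add x y hx hy => simp only [TensorProduct.add_tmul, map_add, hx, hy]
  | tmul x y =>
  induction u using TensorProduct.induction_on with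
  | zero => simp
  | add x y hx hy => simp only [TensorProduct.tmul_add, map_add, hx, hy]
  | tmul a b =>
  obtain ⟨s, hs⟩ := TensorProduct.exists_finset (δ y)
  rw [LinearMap.rTensor_tmul, midBraid_sum δ F H H _ y a b s _ _ hs,
    midBraid_sum δ E H H _ y a b s _ _ hs]
  simp

end Basic

variable (k : Type v) (H : Type u) [Field k] [Ring H] [HopfAlgebra k H]

/-- A left `H`-module algebra: an algebra whose unit and multiplication are `H`-linear. -/
class HModuleAlgebra (E : Type u) [Ring E] [Algebra k E] [Module H E] [IsScalarTower k H E] :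
    Prop where
  smul_one : ∀ h : H, h • (1 : E) = Coalgebra.counit (R := k) h • (1 : E)
  smul_mul : ∀ (h : H) (x y : E),
    h • (x * y) = LinearMap.mul' k E (diagAct k H E E (h ⊗ₜ (x ⊗ₜ y)))

/-- A left-left Yetter-Drinfeld module over `H`: a left `H`-module with a left `H`-coaction
`v ↦ v₍₋₁₎ ⊗ v₍₀₎` such that `h₁ v₍₋₁₎ ⊗ h₂ v₍₀₎ = (h₁ v)₍₋₁₎ h₂ ⊗ (h₁ v)₍₀₎`. -/
class YetterDrinfeld (V : Type u) [AddCommGroup V] [Module k V] [Module H V]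
    [IsScalarTower k H V] where
  coact : V →ₗ[k] H ⊗[k] V
  coact_coassoc : (TensorProduct.assoc k H H V).toLinearMap ∘ₗ
    (Coalgebra.comul (R := k) (A := H)).rTensor V ∘ₗ coact = coact.lTensor H ∘ₗ coact
  counit_coact : (Coalgebra.counit (R := k) (A := H)).rTensor V ∘ₗ coact =
    TensorProduct.mk k k V 1
  compat : diagAct k H H V ∘ₗ coact.lTensor H =
    (LinearMap.mul' k H).rTensor V ∘ₗ (TensorProduct.rightComm k H V H).toLinearMap ∘ₗ
      (coact ∘ₗ act k H V).rTensor H ∘ₗ (TensorProduct.rightComm k H H V).toLinearMap ∘ₗ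
        (Coalgebra.comul (R := k) (A := H)).rTensor V

/-- A Hopf algebra in the category of left-left Yetter-Drinfeld modules over `H`. -/
class YDHopfAlgebra (R : Type u) [Ring R] [Algebra k R] [Coalgebra k R] [Module H R]
    [IsScalarTower k H R] extends HModuleAlgebra k H R, YetterDrinfeld k H R where
  /-- unit and multiplication are `H`-colinear -/
  coact_one : coact 1 = 1 ⊗ₜ[k] 1
  coact_mul : ∀ x y : R, coact (x * y) = coact x * coact y
  /-- counit and comultiplication are `H`-linear -/
  counit_smul : ∀ (h : H) (x : R), Coalgebra.counit (R := k) (h • x) =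
    Coalgebra.counit (R := k) h * Coalgebra.counit (R := k) x
  comul_smul : ∀ (h : H) (x : R), Coalgebra.comul (R := k) (h • x) =
    diagAct k H R R (h ⊗ₜ Coalgebra.comul (R := k) x)
  /-- counit and comultiplication are `H`-colinear, for the codiagonal coaction
  `x ⊗ y ↦ x₍₋₁₎ y₍₋₁₎ ⊗ (x₍₀₎ ⊗ y₍₀₎)` -/
  counit_colinear : (Coalgebra.counit (R := k) (A := R)).lTensor H ∘ₗ coact =
    (TensorProduct.mk k H k 1) ∘ₗ Coalgebra.counit (R := k) (A := R)
  comul_colinear : (Coalgebra.comul (R := k) (A := R)).lTensor H ∘ₗ coact =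
    (LinearMap.mul' k H).rTensor (R ⊗[k] R) ∘ₗ
      (TensorProduct.tensorTensorTensorComm k H R H R).toLinearMap ∘ₗ
        TensorProduct.map coact coact ∘ₗ Coalgebra.comul (R := k) (A := R)
  /-- counit and comultiplication are multiplicative and unital, for the braided algebra structure
  `(x ⊗ y)(x' ⊗ y') = x (y₍₋₁₎ x') ⊗ y₍₀₎ y'` on `R ⊗ R` -/
  counit_one : Coalgebra.counit (R := k) (1 : R) = 1
  counit_mul : ∀ x y : R, Coalgebra.counit (R := k) (x * y) =
    Coalgebra.counit (R := k) x * Coalgebra.counit (R := k) y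
  comul_one : Coalgebra.comul (R := k) (1 : R) = 1 ⊗ₜ[k] 1
  comul_mul : ∀ x y : R, Coalgebra.comul (R := k) (x * y) =
    TensorProduct.map (LinearMap.mul' k R) (LinearMap.mul' k R)
      (midBraid coact R R R (Coalgebra.comul (R := k) x ⊗ₜ Coalgebra.comul (R := k) y))
  /-- the identity is convolution invertible by a morphism of Yetter-Drinfeld modules -/
  exists_antipode : ∃ S : R →ₗ[k] R, (∀ (h : H) (x : R), S (h • x) = h • S x) ∧
    coact ∘ₗ S = S.lTensor H ∘ₗ coact ∧
    conv (LinearMap.mul' k R) Coalgebra.comul S LinearMap.id =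
      Algebra.linearMap k R ∘ₗ Coalgebra.counit ∧
    conv (LinearMap.mul' k R) Coalgebra.comul LinearMap.id S =
      Algebra.linearMap k R ∘ₗ Coalgebra.counit

/-- The underlying space `E ⊗ H` of the smash product `E # H`. -/
def Smash (E : Type u) [AddCommGroup E] [Module k E] : Type u := E ⊗[k] H

namespace Smash

variable {k H}
variable (E : Type u) [AddCommGroup E] [Module k E]

instance : AddCommGroup (Smash k H E) := inferInstanceAs (AddCommGroup (E ⊗[k] H))
instance : Module k (Smash k H E) := inferInstanceAs (Module k (E ⊗[k] H))

/-- The identification of `E # H` with `E ⊗ H`. -/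
def toTensor : Smash k H E ≃ₗ[k] E ⊗[k] H := LinearEquiv.refl k _

end Smash

section SmashRing

variable {k H}
variable {E : Type u} [Ring E] [Algebra k E] [Module H E] [IsScalarTower k H E]

variable (k H E) in
/-- The multiplication `(e ⊗ h)(e' ⊗ h') = e (h₁ • e') ⊗ h₂ h'` of the smash product. -/
def smashMul : (E ⊗[k] H) ⊗[k] (E ⊗[k] H) →ₗ[k] E ⊗[k] H :=
  TensorProduct.map (LinearMap.mul' k E) (LinearMap.mul' k H) ∘ₗ
    midBraid (Coalgebra.comul (R := k) (A := H)) E E H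

def smashAux (e f : E) (z : H) : H ⊗[k] H →ₗ[k] E ⊗[k] H :=
  TensorProduct.map (LinearMap.mulLeft k e ∘ₗ (act k H E) ∘ₗ (TensorProduct.mk k H E).flip f)
    (LinearMap.mulRight k z)

@[simp]
theorem smashAux_tmul (e f : E) (z a b : H) :
    smashAux (k := k) e f z (a ⊗ₜ b) = (e * (a • f)) ⊗ₜ (b * z) := rfl

theorem smashMul_tmul (e f : E) (h z : H) :
    smashMul k H E ((e ⊗ₜ h) ⊗ₜ (f ⊗ₜ z)) = smashAux e f z (Coalgebra.comul (R := k) h) := by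
  have := midBraid_sum (Coalgebra.comul (R := k) (A := H)) E E H e h f z _ _ _
    (Coalgebra.Repr.arbitrary k h).eq.symm
  rw [smashMul, LinearMap.comp_apply, this, ← (Coalgebra.Repr.arbitrary k h).eq]
  simp

theorem smul_mul_aux [HModuleAlgebra k H E] (e f : E) (a : H) :
    a • (e * f) = LinearMap.mul' k E (TensorProduct.map ((act k H E) ∘ₗ
      (TensorProduct.mk k H E).flip e) ((act k H E) ∘ₗ (TensorProduct.mk k H E).flip f)
        (Coalgebra.comul (R := k) a)) := by
  rw [HModuleAlgebra.smul_mul (k := k)]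
  simp only [diagAct, LinearMap.comp_apply, LinearMap.rTensor_tmul]
  generalize Coalgebra.comul (R := k) a = u
  induction u using TensorProduct.induction_on with
  | zero => simp
  | tmul x y => simp
  | add x y hx hy => simp only [TensorProduct.add_tmul, map_add, hx, hy]

theorem smashMul_one [HModuleAlgebra k H E] (x : E ⊗[k] H) :
    smashMul k H E (x ⊗ₜ (1 ⊗ₜ 1)) = x := by
  induction x using TensorProduct.induction_on with
  | zero => simp
  | add x y hx hy => simp only [TensorProduct.add_tmul, map_add, hx, hy]
  | tmul e h =>
    rw [smashMul_tmul]
    have key : smashAux e (1 : E) (1 : H) =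
        TensorProduct.map (LinearMap.mulLeft k e ∘ₗ Algebra.linearMap k E) LinearMap.id ∘ₗ
          (Coalgebra.counit (R := k) (A := H)).rTensor H := by
      ext a b
      simp [HModuleAlgebra.smul_one (k := k), Algebra.algebraMap_eq_smul_one]
    rw [key, LinearMap.comp_apply, Coalgebra.rTensor_counit_comul]
    simp

theorem one_smashMul (x : E ⊗[k] H) :
    smashMul k H E ((1 ⊗ₜ 1) ⊗ₜ x) = x := by
  induction x using TensorProduct.induction_on with
  | zero => simp
  | add x y hx hy => simp only [TensorProduct.tmul_add, map_add, hx, hy]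
  | tmul e h =>
    rw [smashMul_tmul]
    simp [Algebra.TensorProduct.one_def]

theorem smashMul_assoc [HModuleAlgebra k H E] (x y z : E ⊗[k] H) :
    smashMul k H E (smashMul k H E (x ⊗ₜ y) ⊗ₜ z) =
      smashMul k H E (x ⊗ₜ smashMul k H E (y ⊗ₜ z)) := by
  induction x using TensorProduct.induction_on with
  | zero => simp
  | add x y hx hy => simp only [TensorProduct.add_tmul, map_add, hx, hy]
  | tmul e h =>
  induction y using TensorProduct.induction_on with
  | zero => simp
  | add x y hx hy => simp only [TensorProduct.add_tmul, TensorProduct.tmul_add, map_add, hx, hy]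
  | tmul f h' =>
  induction z using TensorProduct.induction_on with
  | zero => simp
  | add x y hx hy => simp only [TensorProduct.tmul_add, map_add, hx, hy]
  | tmul g h'' =>
  let r := Coalgebra.Repr.arbitrary k h
  let r1 := fun i => Coalgebra.Repr.arbitrary k (r.left i)
  let r2 := fun i => Coalgebra.Repr.arbitrary k (r.right i)
  let q := Coalgebra.Repr.arbitrary k h'
  have key := Coalgebra.sum_tmul_tmul_eq r r1 r2
  rw [smashMul_tmul, smashMul_tmul, ← r.eq, ← q.eq]
  simp only [map_sum, smashAux_tmul, TensorProduct.sum_tmul, TensorProduct.tmul_sum,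
    smashMul_tmul, Bialgebra.comul_mul]
  simp only [← r.eq, map_sum, smashAux_tmul, smul_mul_aux (k := k), ← q.eq]
  simp only [← (r1 _).eq, ← (r2 _).eq, map_sum, smashAux_tmul, Finset.sum_mul, Finset.mul_sum,
    Algebra.TensorProduct.tmul_mul_tmul, TensorProduct.map_tmul, LinearMap.comp_apply,
    LinearMap.flip_apply, TensorProduct.mk_apply, act_tmul, LinearMap.mul'_apply,
    TensorProduct.sum_tmul]
  rw [Finset.sum_comm]
  refine Finset.sum_congr rfl fun l _ => ?_
  have := congrArg (TensorProduct.map (LinearMap.mulLeft k e ∘ₗ LinearMap.mul' k E ∘ₗ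
    TensorProduct.map (act k H E ∘ₗ (TensorProduct.mk k H E).flip f)
      (act k H E ∘ₗ (TensorProduct.mk k H E).flip (q.left l • g)))
    (LinearMap.mulRight k (q.right l * h'')) ∘ₗ (TensorProduct.assoc k H H H).symm.toLinearMap) key
  simpa [mul_assoc, mul_smul] using this.symm

end SmashRing

namespace Smash

variable {k H}
variable {E : Type u} [Ring E] [Algebra k E] [Module H E] [IsScalarTower k H E]
  [HModuleAlgebra k H E]

/-- The algebra structure `(e ⊗ h)(e' ⊗ h') = e (h₁ • e') ⊗ h₂ h'` of `E # H`. -/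
instance : Ring (Smash k H E) where
  mul x y := (toTensor E).symm (smashMul k H E (toTensor E x ⊗ₜ toTensor E y))
  one := (toTensor E).symm (1 ⊗ₜ 1)
  mul_assoc x y z := smashMul_assoc (toTensor E x) (toTensor E y) (toTensor E z)
  one_mul x := one_smashMul (toTensor E x)
  mul_one x := smashMul_one (toTensor E x)
  left_distrib x y z := by
    change smashMul k H E (toTensor E x ⊗ₜ (toTensor E y + toTensor E z)) = _
    rw [TensorProduct.tmul_add, map_add]
    rfl
  right_distrib x y z := by
    change smashMul k H E ((toTensor E x + toTensor E y) ⊗ₜ toTensor E z) = _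
    rw [TensorProduct.add_tmul, map_add]
    rfl
  zero_mul x := by
    change smashMul k H E (0 ⊗ₜ toTensor E x) = _
    rw [TensorProduct.zero_tmul, map_zero]
    rfl
  mul_zero x := by
    change smashMul k H E (toTensor E x ⊗ₜ 0) = _
    rw [TensorProduct.tmul_zero, map_zero]
    rfl

instance : Algebra k (Smash k H E) :=
  Algebra.ofModule
    (fun c x y => by
      change smashMul k H E ((c • toTensor E x) ⊗ₜ toTensor E y) = _
      rw [← TensorProduct.smul_tmul', map_smul]
      rfl)
    (fun c x y => by
      change smashMul k H E (toTensor E x ⊗ₜ (c • toTensor E y)) = _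
      rw [TensorProduct.tmul_smul, map_smul]
      rfl)

theorem mul_def (x y : Smash k H E) :
    x * y = (toTensor E).symm (smashMul k H E (toTensor E x ⊗ₜ toTensor E y)) := rfl

theorem one_def : (1 : Smash k H E) = (toTensor E).symm (1 ⊗ₜ 1) := rfl

end Smash

section SmashCoalgebra

variable {k H}
variable {R : Type u} [Ring R] [Algebra k R] [Coalgebra k R] [Module H R] [IsScalarTower k H R]
  [YDHopfAlgebra k H R]

/-- For a map `ρ : E → E ⊗ R`, `e ↦ e₍₀₎ ⊗ e₍₁₎`, the map
`e ⊗ h ↦ (e₍₀₎ ⊗ e₍₁₎₍₋₁₎ h₁) ⊗ (e₍₁₎₍₀₎ ⊗ h₂)`. -/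
def smashCoact {E : Type u} [AddCommGroup E] [Module k E] (ρ : E →ₗ[k] E ⊗[k] R) :
    E ⊗[k] H →ₗ[k] (E ⊗[k] H) ⊗[k] (R ⊗[k] H) :=
  midBraid (YetterDrinfeld.coact (k := k) (H := H) (V := R)) E H H ∘ₗ
    TensorProduct.map ρ (Coalgebra.comul (R := k) (A := H))

variable (k H R) in
/-- The comultiplication `r ⊗ h ↦ (r₁ ⊗ r₂₍₋₁₎ h₁) ⊗ (r₂₍₀₎ ⊗ h₂)` of `R # H`. -/
def smashComul : R ⊗[k] H →ₗ[k] (R ⊗[k] H) ⊗[k] (R ⊗[k] H) :=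
  smashCoact (Coalgebra.comul (R := k) (A := R))

variable (k H R) in
/-- The counit `ε ⊗ ε` of `R # H`. -/
def smashCounit : R ⊗[k] H →ₗ[k] k :=
  LinearMap.mul' k k ∘ₗ TensorProduct.map (Coalgebra.counit (R := k) (A := R))
    (Coalgebra.counit (R := k) (A := H))

theorem coact_coassoc' (v : R) :
    TensorProduct.assoc k H H R ((Coalgebra.comul (R := k) (A := H)).rTensor R
      (YetterDrinfeld.coact (k := k) (H := H) v)) =
    (YetterDrinfeld.coact (k := k) (H := H) (V := R)).lTensor H
      (YetterDrinfeld.coact (k := k) (H := H) v) :=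
  LinearMap.congr_fun (YetterDrinfeld.coact_coassoc (k := k) (H := H) (V := R)) v

theorem comul_colinear' (v : R) :
    (Coalgebra.comul (R := k) (A := R)).lTensor H (YetterDrinfeld.coact (k := k) (H := H) v) =
    (LinearMap.mul' k H).rTensor (R ⊗[k] R)
      (TensorProduct.tensorTensorTensorComm k H R H R
        (TensorProduct.map (YetterDrinfeld.coact (k := k) (H := H) (V := R))
          (YetterDrinfeld.coact (k := k) (H := H) (V := R))
            (Coalgebra.comul (R := k) (A := R) v))) :=
  LinearMap.congr_fun (YDHopfAlgebra.comul_colinear (k := k) (H := H) (R := R)) v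

theorem counit_colinear' (v : R) :
    (Coalgebra.counit (R := k) (A := R)).lTensor H (YetterDrinfeld.coact (k := k) (H := H) v) =
    1 ⊗ₜ Coalgebra.counit (R := k) v :=
  LinearMap.congr_fun (YDHopfAlgebra.counit_colinear (k := k) (H := H) (R := R)) v

theorem counit_coact' (v : R) :
    (Coalgebra.counit (R := k) (A := H)).rTensor R (YetterDrinfeld.coact (k := k) (H := H) v) =
    1 ⊗ₜ v :=
  LinearMap.congr_fun (YetterDrinfeld.counit_coact (k := k) (H := H) (V := R)) v

set_option synthInstance.maxHeartbeats 400000 in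
set_option maxHeartbeats 4000000 in
theorem smashComul_coassoc_aux {T : Type u} [Ring T] [Algebra k T]
    (Λ : (R ⊗[k] H) ⊗[k] ((R ⊗[k] H) ⊗[k] (R ⊗[k] H)) →ₗ[k] T)
    (jA : R →ₗ[k] T) (jB : H ⊗[k] R →ₗ[k] T) (jC : H ⊗[k] (H ⊗[k] R) →ₗ[k] T)
    (jM : H ⊗[k] (H ⊗[k] H) →ₗ[k] T)
    (hΛ : ∀ (x y z : R) (q p1 p2 a b c : H),
      Λ ((x ⊗ₜ (q * (p1 * a))) ⊗ₜ ((y ⊗ₜ (p2 * b)) ⊗ₜ (z ⊗ₜ c))) =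
        jA x * (jB (q ⊗ₜ y) * jC (p1 ⊗ₜ (p2 ⊗ₜ z))) * jM (a ⊗ₜ (b ⊗ₜ c)))
    (r : R) (h : H) :
    Λ (TensorProduct.assoc k (R ⊗[k] H) (R ⊗[k] H) (R ⊗[k] H)
      ((smashComul k H R).rTensor (R ⊗[k] H) (smashComul k H R (r ⊗ₜ h)))) =
    Λ ((smashComul k H R).lTensor (R ⊗[k] H) (smashComul k H R (r ⊗ₜ h))) := by
  let δ := YetterDrinfeld.coact (k := k) (H := H) (V := R)
  let Q : R ⊗[k] (R ⊗[k] R) →ₗ[k] T := LinearMap.mul' k T ∘ₗ TensorProduct.map jA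
    (LinearMap.mul' k T ∘ₗ TensorProduct.map (jB ∘ₗ δ) (jC ∘ₗ δ.lTensor H ∘ₗ δ))
  let P : (R ⊗[k] (R ⊗[k] R)) ⊗[k] (H ⊗[k] (H ⊗[k] H)) →ₗ[k] T :=
    LinearMap.mul' k T ∘ₗ TensorProduct.map Q jM
  have hδ : ∀ v, YetterDrinfeld.coact (k := k) (H := H) v = δ v := fun _ => rfl
  have hL : ∀ (t : R ⊗[k] R) (u : H ⊗[k] H),
      Λ (TensorProduct.assoc k _ _ _ ((smashComul k H R).rTensor _
        (midBraid δ R H H (t ⊗ₜ u)))) =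
      P (TensorProduct.assoc k _ _ _ ((Coalgebra.comul (R := k) (A := R)).rTensor R t) ⊗ₜ
        TensorProduct.assoc k _ _ _ ((Coalgebra.comul (R := k) (A := H)).rTensor H u)) := by
    intro t u
    induction t using TensorProduct.induction_on with
    | zero => simp
    | add x y hx hy => simp only [TensorProduct.add_tmul, map_add, hx, hy]
    | tmul x' z =>
    induction u using TensorProduct.induction_on with
    | zero => simp
    | add x y hx hy => simp only [TensorProduct.tmul_add, map_add, hx, hy]
    | tmul a' c =>
    obtain ⟨s, hs⟩ := TensorProduct.exists_finset (δ z)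
    rw [midBraid_sum δ R H H x' z a' c s _ _ hs]
    have hz : ∀ x y : R, Q (x ⊗ₜ (y ⊗ₜ z)) = ∑ p ∈ s, jA x * (jB (δ y) * jC
        (TensorProduct.assoc k H H R (Coalgebra.comul (R := k) p.1 ⊗ₜ p.2))) := by
      intro x y
      have := coact_coassoc' (k := k) (H := H) z
      simp only [Q, LinearMap.comp_apply, TensorProduct.map_tmul, LinearMap.mul'_apply]
      rw [show δ.lTensor H (δ z) = _ from this.symm, hδ, hs]
      simp only [map_sum, LinearMap.rTensor_tmul, Finset.mul_sum]
    simp only [map_sum, LinearMap.rTensor_tmul, smashComul, smashCoact, LinearMap.comp_apply,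
      TensorProduct.map_tmul, smul_eq_mul, Bialgebra.comul_mul]
    generalize Coalgebra.comul (R := k) x' = t
    generalize Coalgebra.comul (R := k) a' = u
    induction t using TensorProduct.induction_on with
    | zero => simp
    | add x y hx hy =>
      simp only [TensorProduct.add_tmul, map_add, hx, hy, Finset.sum_add_distrib]
    | tmul x y =>
    induction u using TensorProduct.induction_on with
    | zero => simp
    | add x y hx hy =>
      simp only [TensorProduct.add_tmul, TensorProduct.tmul_add, map_add, mul_add, hx, hy,
        Finset.sum_add_distrib]
    | tmul a b =>
    simp only [P, TensorProduct.assoc_tmul, LinearMap.comp_apply, TensorProduct.map_tmul,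
      LinearMap.mul'_apply, hz, Finset.sum_mul]
    refine Finset.sum_congr rfl fun p _ => ?_
    generalize Coalgebra.comul (R := k) p.1 = w
    induction w using TensorProduct.induction_on with
    | zero => simp
    | add x y hx hy =>
      simp only [TensorProduct.add_tmul, TensorProduct.tmul_add, map_add, mul_add, add_mul, hx, hy]
    | tmul p1 p2 =>
    obtain ⟨s', hs'⟩ := TensorProduct.exists_finset (δ y)
    rw [Algebra.TensorProduct.tmul_mul_tmul, midBraid_sum _ R H H x y _ _ s' _ _ hs', hs']
    simp only [TensorProduct.sum_tmul, map_sum, TensorProduct.assoc_tmul, smul_eq_mul, hΛ,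
      Finset.sum_mul, Finset.mul_sum]
  have hR : ∀ (t : R ⊗[k] R) (u : H ⊗[k] H), Λ ((smashComul k H R).lTensor _
        (midBraid δ R H H (t ⊗ₜ u))) =
      P ((Coalgebra.comul (R := k) (A := R)).lTensor R t ⊗ₜ
        (Coalgebra.comul (R := k) (A := H)).lTensor H u) := by
    intro t u
    induction t using TensorProduct.induction_on with
    | zero => simp
    | add x y hx hy => simp only [TensorProduct.add_tmul, map_add, hx, hy]
    | tmul x w =>
    induction u using TensorProduct.induction_on with
    | zero => simp
    | add x y hx hy => simp only [TensorProduct.tmul_add, map_add, hx, hy]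
    | tmul a c' =>
    let f : H ⊗[k] (R ⊗[k] R) →ₗ[k] (R ⊗[k] H) ⊗[k] ((R ⊗[k] H) ⊗[k] (R ⊗[k] H)) :=
      TensorProduct.map (TensorProduct.mk k R H x ∘ₗ LinearMap.mulRight k a)
      (midBraid δ R H H ∘ₗ (TensorProduct.mk k _ _).flip (Coalgebra.comul (R := k) c'))
    obtain ⟨s, hs⟩ := TensorProduct.exists_finset (δ w)
    have h1 : (smashComul k H R).lTensor _ (midBraid δ R H H ((x ⊗ₜ w) ⊗ₜ (a ⊗ₜ c'))) =
        f ((Coalgebra.comul (R := k) (A := R)).lTensor H (δ w)) := by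
      rw [midBraid_sum δ R H H x w a c' s _ _ hs, hs]
      simp only [map_sum, LinearMap.lTensor_tmul, smashComul, smashCoact, LinearMap.comp_apply,
        TensorProduct.map_tmul, smul_eq_mul, f, LinearMap.flip_apply, TensorProduct.mk_apply,
        LinearMap.mulRight_apply, δ]
    rw [h1, show (Coalgebra.comul (R := k) (A := R)).lTensor H (δ w) = _ from comul_colinear' w]
    simp only [LinearMap.lTensor_tmul, f]
    generalize Coalgebra.comul (R := k) w = t
    generalize Coalgebra.comul (R := k) c' = u
    induction t using TensorProduct.induction_on with
    | zero => simp
    | add x y hx hy => simp only [TensorProduct.add_tmul, TensorProduct.tmul_add, map_add, hx, hy]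
    | tmul y z =>
    induction u using TensorProduct.induction_on with
    | zero => simp
    | add x y hx hy =>
      simp only [map_add, LinearMap.comp_add, TensorProduct.map_add_right, LinearMap.add_apply,
        hx, hy, TensorProduct.tmul_add]
    | tmul b c =>
    obtain ⟨s, hs⟩ := TensorProduct.exists_finset (δ y)
    obtain ⟨s', hs'⟩ := TensorProduct.exists_finset (δ z)
    simp only [TensorProduct.map_tmul, P, Q, LinearMap.comp_apply, hδ, hs, hs',
      TensorProduct.sum_tmul, TensorProduct.tmul_sum, map_sum, LinearMap.mul'_apply,
      TensorProduct.tensorTensorTensorComm_tmul, LinearMap.rTensor_tmul, LinearMap.lTensor_tmul,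
      LinearMap.flip_apply, TensorProduct.mk_apply, LinearMap.mulRight_apply]
    refine Finset.sum_congr rfl fun p' _ => Finset.sum_congr rfl fun p _ => ?_
    obtain ⟨s'', hs''⟩ := TensorProduct.exists_finset (δ p'.2)
    rw [midBraid_sum δ R H H p.2 p'.2 b c s'' _ _ hs'', hs'']
    simp only [TensorProduct.tmul_sum, map_sum, smul_eq_mul, mul_assoc, hΛ,
      Finset.sum_mul, Finset.mul_sum]
  have h1 := hL (Coalgebra.comul r) (Coalgebra.comul h)
  have h2 := hR (Coalgebra.comul r) (Coalgebra.comul h)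
  rw [Coalgebra.coassoc_apply, Coalgebra.coassoc_apply, ← h2] at h1
  exact h1

theorem smashComul_coassoc :
    (TensorProduct.assoc k (R ⊗[k] H) (R ⊗[k] H) (R ⊗[k] H)).toLinearMap ∘ₗ
      (smashComul k H R).rTensor (R ⊗[k] H) ∘ₗ smashComul k H R =
    (smashComul k H R).lTensor (R ⊗[k] H) ∘ₗ smashComul k H R := by
  refine TensorProduct.ext' fun r h => ?_
  refine smashComul_coassoc_aux (T := (R ⊗[k] H) ⊗[k] ((R ⊗[k] H) ⊗[k] (R ⊗[k] H))) LinearMap.id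
    ((TensorProduct.mk k _ _).flip 1 ∘ₗ (TensorProduct.mk k R H).flip 1)
    (TensorProduct.map (TensorProduct.mk k R H 1)
      ((TensorProduct.mk k _ _).flip 1 ∘ₗ (TensorProduct.mk k R H).flip 1))
    (TensorProduct.map (TensorProduct.mk k R H 1)
      (TensorProduct.map (TensorProduct.mk k R H 1) ((TensorProduct.mk k R H).flip 1)))
    (TensorProduct.map (TensorProduct.mk k R H 1)
      (TensorProduct.map (TensorProduct.mk k R H 1) (TensorProduct.mk k R H 1))) ?_ r h
  intro x y z q p1 p2 a b c
  simp [Algebra.TensorProduct.one_def, mul_assoc]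

set_option synthInstance.maxHeartbeats 400000 in
set_option maxHeartbeats 1000000 in
theorem smashCounit_rTensor :
    (smashCounit k H R).rTensor (R ⊗[k] H) ∘ₗ smashComul k H R = TensorProduct.mk k k _ 1 := by
  refine TensorProduct.ext' fun r h => ?_
  have key : ∀ (t : R ⊗[k] R) (u : H ⊗[k] H), (smashCounit k H R).rTensor (R ⊗[k] H)
      (midBraid (YetterDrinfeld.coact (k := k) (H := H) (V := R)) R H H (t ⊗ₜ u)) =
      TensorProduct.map (LinearMap.mul' k k) LinearMap.id
        (TensorProduct.tensorTensorTensorComm k k R k H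
        ((Coalgebra.counit (R := k) (A := R)).rTensor R t ⊗ₜ
          (Coalgebra.counit (R := k) (A := H)).rTensor H u)) := by
    intro t u
    induction t using TensorProduct.induction_on with
    | zero => simp
    | add x y hx hy => simp only [TensorProduct.add_tmul, map_add, hx, hy]
    | tmul x y =>
    induction u using TensorProduct.induction_on with
    | zero => simp
    | add x y hx hy => simp only [TensorProduct.tmul_add, map_add, hx, hy]
    | tmul a b =>
    obtain ⟨s, hs⟩ := TensorProduct.exists_finset (YetterDrinfeld.coact (k := k) (H := H) y)
    have h1 := counit_coact' (k := k) (H := H) y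
    rw [hs] at h1
    rw [midBraid_sum _ R H H x y a b s _ _ hs]
    have h2 := congrArg (TensorProduct.map (LinearMap.mulLeft k (Coalgebra.counit (R := k) x) ∘ₗ
      LinearMap.mulRight k (Coalgebra.counit (R := k) a)) ((TensorProduct.mk k R H).flip b)) h1
    simpa [smashCounit] using h2
  change (smashCounit k H R).rTensor (R ⊗[k] H)
    (midBraid (YetterDrinfeld.coact (k := k) (H := H) (V := R)) R H H _) = _
  rw [TensorProduct.map_tmul, key, Coalgebra.rTensor_counit_comul, Coalgebra.rTensor_counit_comul]
  simp

set_option synthInstance.maxHeartbeats 400000 in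
set_option maxHeartbeats 1000000 in
theorem smashCounit_lTensor :
    (smashCounit k H R).lTensor (R ⊗[k] H) ∘ₗ smashComul k H R =
      (TensorProduct.mk k _ k).flip 1 := by
  refine TensorProduct.ext' fun r h => ?_
  have key : ∀ (t : R ⊗[k] R) (u : H ⊗[k] H), (smashCounit k H R).lTensor (R ⊗[k] H)
      (midBraid (YetterDrinfeld.coact (k := k) (H := H) (V := R)) R H H (t ⊗ₜ u)) =
      TensorProduct.map LinearMap.id (LinearMap.mul' k k)
        (TensorProduct.tensorTensorTensorComm k R k H k
        ((Coalgebra.counit (R := k) (A := R)).lTensor R t ⊗ₜ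
          (Coalgebra.counit (R := k) (A := H)).lTensor H u)) := by
    intro t u
    induction t using TensorProduct.induction_on with
    | zero => simp
    | add x y hx hy => simp only [TensorProduct.add_tmul, map_add, hx, hy]
    | tmul x y =>
    induction u using TensorProduct.induction_on with
    | zero => simp
    | add x y hx hy => simp only [TensorProduct.tmul_add, map_add, hx, hy]
    | tmul a b =>
    obtain ⟨s, hs⟩ := TensorProduct.exists_finset (YetterDrinfeld.coact (k := k) (H := H) y)
    have h1 := counit_colinear' (k := k) (H := H) y
    rw [hs] at h1
    rw [midBraid_sum _ R H H x y a b s _ _ hs]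
    have h2 := congrArg (TensorProduct.map (TensorProduct.mk k R H x ∘ₗ LinearMap.mulRight k a)
      (LinearMap.mulRight k (Coalgebra.counit (R := k) b))) h1
    simpa [smashCounit] using h2
  change (smashCounit k H R).lTensor (R ⊗[k] H)
    (midBraid (YetterDrinfeld.coact (k := k) (H := H) (V := R)) R H H _) = _
  rw [TensorProduct.map_tmul, key, Coalgebra.lTensor_counit_comul, Coalgebra.lTensor_counit_comul]
  simp

/-- The coalgebra structure of `R # H`, with comultiplication
`r ⊗ h ↦ (r₁ ⊗ r₂₍₋₁₎ h₁) ⊗ (r₂₍₀₎ ⊗ h₂)` and counit `ε ⊗ ε`. -/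
instance Smash.instCoalgebra : Coalgebra k (Smash k H R) where
  comul := smashComul k H R
  counit := smashCounit k H R
  coassoc := smashComul_coassoc
  rTensor_counit_comp_comul := smashCounit_rTensor
  lTensor_counit_comp_comul := smashCounit_lTensor

end SmashCoalgebra

/-- The element `e ⊗ h` of the smash product `E # H`. -/
def Smash.mk {E : Type u} [AddCommGroup E] [Module k E] (e : E) (h : H) : Smash k H E :=
  (Smash.toTensor E).symm (e ⊗ₜ h)

section Classical

variable (A : Type u) [Ring A] [Algebra k A] [Coalgebra k A]

/-- The data of a pair `(B, γ)`: a vector space `B` with a multiplication, a unit, a map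
`B → B ⊗ A` and a linear map `γ : A → B`. No laws are imposed here; see `IsCleftObjectPair`. -/
structure PrePair where
  carrier : Type u
  [addCommGroup : AddCommGroup carrier]
  [module : Module k carrier]
  mul : carrier ⊗[k] carrier →ₗ[k] carrier
  one : carrier
  coact : carrier →ₗ[k] carrier ⊗[k] A
  sect : A →ₗ[k] carrier

attribute [instance] PrePair.addCommGroup PrePair.module

variable {k A}

/-- `(B, γ)` is an `A`-cleft object with a (normalized) section: `B` is a right `A`-comodule
algebra with trivial coinvariants, and `γ : A → B` is a convolution invertible morphism of right
`A`-comodules with `γ 1 = 1`. -/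
structure IsCleftObjectPair (P : PrePair k A) : Prop where
  /-- `B` is an associative unital algebra -/
  mul_assoc : ∀ x y z, P.mul (P.mul (x ⊗ₜ y) ⊗ₜ z) = P.mul (x ⊗ₜ P.mul (y ⊗ₜ z))
  one_mul : ∀ x, P.mul (P.one ⊗ₜ x) = x
  mul_one : ∀ x, P.mul (x ⊗ₜ P.one) = x
  /-- `B` is a right `A`-comodule -/
  coact_coassoc : (TensorProduct.assoc k P.carrier A A).toLinearMap ∘ₗ
    P.coact.rTensor A ∘ₗ P.coact =
      (Coalgebra.comul (R := k) (A := A)).lTensor P.carrier ∘ₗ P.coact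
  coact_counit : (Coalgebra.counit (R := k) (A := A)).lTensor P.carrier ∘ₗ P.coact =
    (TensorProduct.mk k P.carrier k).flip 1
  /-- the coaction is an algebra morphism `B → B ⊗ A` -/
  coact_one : P.coact P.one = P.one ⊗ₜ[k] 1
  coact_mul : ∀ x y, P.coact (P.mul (x ⊗ₜ y)) =
    TensorProduct.map P.mul (LinearMap.mul' k A)
      (TensorProduct.tensorTensorTensorComm k P.carrier A P.carrier A
        (P.coact x ⊗ₜ P.coact y))
  /-- the unit `k → B` is the equalizer of the coaction and `x ↦ x ⊗ 1` -/
  one_ne_zero : P.one ≠ 0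
  coinvariants : ∀ x, P.coact x = x ⊗ₜ[k] 1 → ∃ c : k, x = c • P.one
  /-- `γ` is a normalized morphism of comodules -/
  sect_one : P.sect 1 = P.one
  sect_colinear : P.coact ∘ₗ P.sect = P.sect.rTensor A ∘ₗ Coalgebra.comul
  /-- `γ` is convolution invertible -/
  sect_invertible : ∃ g : A →ₗ[k] P.carrier,
    conv P.mul Coalgebra.comul P.sect g =
      LinearMap.toSpanSingleton k P.carrier P.one ∘ₗ Coalgebra.counit ∧
    conv P.mul Coalgebra.comul g P.sect =
      LinearMap.toSpanSingleton k P.carrier P.one ∘ₗ Coalgebra.counit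

/-- Isomorphism of pairs `(B, γ) ≅ (B', γ')`: a linear isomorphism respecting multiplications,
units, coactions and sections. -/
def PrePair.IsIso (P Q : PrePair k A) : Prop :=
  ∃ f : P.carrier ≃ₗ[k] Q.carrier,
    (∀ x y, f (P.mul (x ⊗ₜ y)) = Q.mul (f x ⊗ₜ f y)) ∧ f P.one = Q.one ∧
    (∀ x, Q.coact (f x) = f.toLinearMap.rTensor A (P.coact x)) ∧ ∀ a, f (P.sect a) = Q.sect a

instance PrePair.setoid : Setoid (PrePair k A) where
  r := PrePair.IsIso
  iseqv :=
    { refl := fun P => ⟨LinearEquiv.refl k _, fun _ _ => rfl, rfl, fun x => by simp, fun _ => rfl⟩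
      symm := by
        rintro P Q ⟨f, h1, h2, h3, h4⟩
        refine ⟨f.symm, fun x y => ?_, ?_, fun x => ?_, fun a => ?_⟩
        · rw [LinearEquiv.symm_apply_eq, h1]; simp
        · rw [LinearEquiv.symm_apply_eq, h2]
        · have := h3 (f.symm x)
          rw [LinearEquiv.apply_symm_apply] at this
          rw [this, ← LinearMap.comp_apply, ← LinearMap.rTensor_comp]
          simp
        · rw [LinearEquiv.symm_apply_eq, h4]
      trans := by
        rintro P Q S ⟨f, h1, h2, h3, h4⟩ ⟨g, g1, g2, g3, g4⟩
        refine ⟨f.trans g, fun x y => by simp [h1, g1], by simp [h2, g2], fun x => ?_,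
          fun a => by simp [h4, g4]⟩
        rw [LinearEquiv.trans_apply, g3, h3, ← LinearMap.comp_apply, ← LinearMap.rTensor_comp]
        rfl }

variable (k A) in
/-- Isomorphism classes `[(B, γ)]`. -/
abbrev PairClass := Quotient (PrePair.setoid (k := k) (A := A))

variable (k A) in
/-- `C(A)`: the set of isomorphism classes of `A`-cleft objects with a section. -/
def cleftClasses : Set (PairClass k A) :=
  {x | ∃ P : PrePair k A, IsCleftObjectPair P ∧ x = ⟦P⟧}

/-- The pair `(k #_σ A, id)`: the space `A` with multiplication
`x ⊗ y ↦ σ(x₁ ⊗ y₁) x₂ y₂`, unit `1`, coaction `Δ` and section `id`. -/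
def crossedPair (σ : A ⊗[k] A →ₗ[k] k) : PrePair k A where
  carrier := A
  mul := (TensorProduct.lid k A).toLinearMap ∘ₗ TensorProduct.map σ (LinearMap.mul' k A) ∘ₗ
    Coalgebra.comul (R := k) (A := A ⊗[k] A)
  one := 1
  coact := Coalgebra.comul
  sect := LinearMap.id

end Classical

section Braided

variable (R : Type u) [Ring R] [Algebra k R] [Coalgebra k R] [Module H R] [IsScalarTower k H R]
  [YDHopfAlgebra k H R]

/-- The comultiplication `r ⊗ s ↦ (r₁ ⊗ r₂₍₋₁₎ s₁) ⊗ (r₂₍₀₎ ⊗ s₂)` of `R ⊗ R`. -/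
def braidedComul : R ⊗[k] R →ₗ[k] (R ⊗[k] R) ⊗[k] (R ⊗[k] R) :=
  midBraid (YetterDrinfeld.coact (k := k) (H := H) (V := R)) R R R ∘ₗ
    TensorProduct.map Coalgebra.comul Coalgebra.comul

variable {R} in
/-- For `π : R ⊗ R → k`, the map `π̂ = (π ⊗ μ) Δ_{R ⊗ R} : R ⊗ R → k ⊗ R = R`,
`r ⊗ s ↦ π(r₁ ⊗ r₂₍₋₁₎ s₁) r₂₍₀₎ s₂`. -/
def hat (π : R ⊗[k] R →ₗ[k] k) : R ⊗[k] R →ₗ[k] R :=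
  (TensorProduct.lid k R).toLinearMap ∘ₗ TensorProduct.map π (LinearMap.mul' k R) ∘ₗ
    braidedComul k H R

variable {R} in
/-- Two-cocycles `π : R ⊗ R → k` in the category of left `H`-modules, where `k` is the trivial
module and the trivial measuring. -/
structure IsTwoCocycle (π : R ⊗[k] R →ₗ[k] k) : Prop where
  /-- `π` is `H`-linear -/
  linear : ∀ (h : H) (x : R ⊗[k] R),
    π (diagAct k H R R (h ⊗ₜ x)) = Coalgebra.counit (R := k) h * π x
  /-- `π` is convolution invertible in the category of `H`-modules -/
  invertible : ∃ π' : R ⊗[k] R →ₗ[k] k,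
    (∀ (h : H) (x : R ⊗[k] R),
      π' (diagAct k H R R (h ⊗ₜ x)) = Coalgebra.counit (R := k) h * π' x) ∧
    conv (LinearMap.mul' k k) (braidedComul k H R) π π' =
      LinearMap.mul' k k ∘ₗ TensorProduct.map Coalgebra.counit Coalgebra.counit ∧
    conv (LinearMap.mul' k k) (braidedComul k H R) π' π =
      LinearMap.mul' k k ∘ₗ TensorProduct.map Coalgebra.counit Coalgebra.counit
  /-- `π(r₁ ⊗ r₂₍₋₁₎ s₁) π(r₂₍₀₎ s₂ ⊗ t) = π(s₁ ⊗ s₂₍₋₁₎ t₁) π(r ⊗ s₂₍₀₎ t₂)` -/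
  cocycle : π ∘ₗ (hat k H π).rTensor R =
    π ∘ₗ (hat k H π).lTensor R ∘ₗ (TensorProduct.assoc k R R R).toLinearMap
  normalized : π (1 ⊗ₜ 1) = 1

/-- A pair `(𝓔, γ)` of an `R`-cleft object `𝓔` in the category of left `H`-modules and a
(normalized) section `γ : R → 𝓔`. -/
structure CleftPair where
  carrier : Type u
  [ring : Ring carrier]
  [algebra : Algebra k carrier]
  [hmodule : Module H carrier]
  [tower : IsScalarTower k H carrier]
  [moduleAlgebra : HModuleAlgebra k H carrier]
  /-- the right `R`-coaction, a morphism of `H`-modules -/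
  coact : carrier →ₗ[k] carrier ⊗[k] R
  coact_linear : ∀ (h : H) (x : carrier), coact (h • x) = diagAct k H carrier R (h ⊗ₜ coact x)
  coact_coassoc : (TensorProduct.assoc k carrier R R).toLinearMap ∘ₗ coact.rTensor R ∘ₗ coact =
    (Coalgebra.comul (R := k) (A := R)).lTensor carrier ∘ₗ coact
  coact_counit : (Coalgebra.counit (R := k) (A := R)).lTensor carrier ∘ₗ coact =
    (TensorProduct.mk k carrier k).flip 1
  /-- the coaction is an algebra morphism, where `𝓔 ⊗ R` has the multiplication
  `(x ⊗ r)(y ⊗ s) = x (r₍₋₁₎ • y) ⊗ r₍₀₎ s` -/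
  coact_one : coact 1 = 1 ⊗ₜ[k] 1
  coact_mul : ∀ x y : carrier, coact (x * y) =
    TensorProduct.map (LinearMap.mul' k carrier) (LinearMap.mul' k R)
      (midBraid (YetterDrinfeld.coact (k := k) (H := H) (V := R)) carrier carrier R
        (coact x ⊗ₜ coact y))
  /-- the unit `k → 𝓔` is the equalizer of the coaction and `x ↦ x ⊗ 1` -/
  one_ne_zero : (1 : carrier) ≠ 0
  coinvariants : ∀ x : carrier, coact x = x ⊗ₜ[k] 1 → ∃ c : k, x = c • (1 : carrier)
  /-- the section, a normalized morphism of comodules in the category of `H`-modules -/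
  sect : R →ₗ[k] carrier
  sect_linear : ∀ (h : H) (r : R), sect (h • r) = h • sect r
  sect_one : sect 1 = 1
  sect_colinear : coact ∘ₗ sect = sect.rTensor R ∘ₗ Coalgebra.comul
  /-- the section is convolution invertible in the category of `H`-modules -/
  sect_invertible : ∃ g : R →ₗ[k] carrier, (∀ (h : H) (r : R), g (h • r) = h • g r) ∧
    conv (LinearMap.mul' k carrier) Coalgebra.comul sect g =
      Algebra.linearMap k carrier ∘ₗ Coalgebra.counit ∧
    conv (LinearMap.mul' k carrier) Coalgebra.comul g sect =
      Algebra.linearMap k carrier ∘ₗ Coalgebra.counit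

attribute [instance] CleftPair.ring CleftPair.algebra CleftPair.hmodule CleftPair.tower
  CleftPair.moduleAlgebra

variable {k H R}

/-- The pair `(𝓔 # H, γ ⊗ id)` over `R # H`, with coaction
`e ⊗ h ↦ (e₍₀₎ ⊗ e₍₁₎₍₋₁₎ h₁) ⊗ (e₍₁₎₍₀₎ ⊗ h₂)`. -/
def CleftPair.smash (P : CleftPair k H R) : PrePair k (Smash k H R) where
  carrier := Smash k H P.carrier
  mul := LinearMap.mul' k (Smash k H P.carrier)
  one := 1
  coact := TensorProduct.map (Smash.toTensor P.carrier).symm.toLinearMap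
    (Smash.toTensor R).symm.toLinearMap ∘ₗ smashCoact P.coact ∘ₗ
      (Smash.toTensor P.carrier).toLinearMap
  sect := (Smash.toTensor P.carrier).symm.toLinearMap ∘ₗ P.sect.rTensor H ∘ₗ
    (Smash.toTensor R).toLinearMap

/-- Isomorphism of pairs `(𝓔, γ) ≅ (𝓔', γ')` in the category of left `H`-modules. -/
def CleftPair.IsIso (P Q : CleftPair k H R) : Prop :=
  ∃ f : P.carrier ≃ₐ[k] Q.carrier, (∀ (h : H) x, f (h • x) = h • f x) ∧
    (∀ x, Q.coact (f x) = f.toLinearMap.rTensor R (P.coact x)) ∧ ∀ r, f (P.sect r) = Q.sect r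

instance CleftPair.setoid : Setoid (CleftPair k H R) where
  r := CleftPair.IsIso
  iseqv :=
    { refl := fun P => ⟨AlgEquiv.refl, fun _ _ => rfl, fun x => by
          rw [show (AlgEquiv.refl : P.carrier ≃ₐ[k] P.carrier).toLinearMap = LinearMap.id from rfl]
          simp, fun _ => rfl⟩
      symm := by
        rintro P Q ⟨f, h1, h3, h4⟩
        refine ⟨f.symm, fun h x => ?_, fun x => ?_, fun a => ?_⟩
        · rw [AlgEquiv.symm_apply_eq, h1]; simp
        · have := h3 (f.symm x)
          rw [AlgEquiv.apply_symm_apply] at this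
          rw [this, ← LinearMap.comp_apply, ← LinearMap.rTensor_comp,
            show f.symm.toLinearMap ∘ₗ f.toLinearMap = LinearMap.id by ext; simp]
          simp
        · rw [AlgEquiv.symm_apply_eq, h4]
      trans := by
        rintro P Q S ⟨f, h1, h3, h4⟩ ⟨g, g1, g3, g4⟩
        refine ⟨f.trans g, fun x y => by simp [h1, g1], fun x => ?_,
          fun a => by simp [h4, g4]⟩
        rw [AlgEquiv.trans_apply, g3, h3, ← LinearMap.comp_apply, ← LinearMap.rTensor_comp]
        rfl }

theorem smashAux_map {E F : Type u} [Ring E] [Algebra k E] [Module H E] [IsScalarTower k H E]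
    [Ring F] [Algebra k F] [Module H F] [IsScalarTower k H F] (f : E ≃ₐ[k] F)
    (hf : ∀ (h : H) x, f (h • x) = h • f x) (e e' : E) (z : H) (u : H ⊗[k] H) :
    f.toLinearMap.rTensor H (smashAux e e' z u) = smashAux (f e) (f e') z u := by
  induction u using TensorProduct.induction_on with
  | zero => simp
  | add x y hx hy => simp only [map_add, hx, hy]
  | tmul a b => simp [hf]

theorem smashMul_map {E F : Type u} [Ring E] [Algebra k E] [Module H E] [IsScalarTower k H E]
    [Ring F] [Algebra k F] [Module H F] [IsScalarTower k H F] (f : E ≃ₐ[k] F)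
    (hf : ∀ (h : H) x, f (h • x) = h • f x) (x y : E ⊗[k] H) :
    f.toLinearMap.rTensor H (smashMul k H E (x ⊗ₜ y)) =
      smashMul k H F (f.toLinearMap.rTensor H x ⊗ₜ f.toLinearMap.rTensor H y) := by
  induction x using TensorProduct.induction_on with
  | zero => simp
  | add x y hx hy => simp only [TensorProduct.add_tmul, map_add, hx, hy]
  | tmul e h =>
  induction y using TensorProduct.induction_on with
  | zero => simp
  | add x y hx hy => simp only [TensorProduct.tmul_add, map_add, hx, hy]
  | tmul e' h' =>
  simp [smashMul_tmul, smashAux_map f hf]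

theorem smashCoact_map {E F : Type u} [AddCommGroup E] [Module k E] [AddCommGroup F] [Module k F]
    (f : E →ₗ[k] F) (ρ : E →ₗ[k] E ⊗[k] R) (ρ' : F →ₗ[k] F ⊗[k] R)
    (hf : ∀ x, ρ' (f x) = f.rTensor R (ρ x)) (x : E ⊗[k] H) :
    smashCoact ρ' (f.rTensor H x) = (f.rTensor H).rTensor (R ⊗[k] H) (smashCoact ρ x) := by
  induction x using TensorProduct.induction_on with
  | zero => simp
  | add x y hx hy => simp only [map_add, hx, hy]
  | tmul e h => simp [smashCoact, hf, midBraid_map]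

theorem CleftPair.smash_isIso {P Q : CleftPair k H R} (h : P.IsIso Q) :
    P.smash.IsIso Q.smash := by
  obtain ⟨f, h1, h2, h3⟩ := h
  refine ⟨TensorProduct.congr f.toLinearEquiv (LinearEquiv.refl k H), ?_, ?_, ?_, ?_⟩
  · intro x y
    exact smashMul_map f h1 x y
  · change f.toLinearMap.rTensor H (1 ⊗ₜ 1) = 1 ⊗ₜ 1
    simp
  · intro x
    have := smashCoact_map (k := k) (H := H) f.toLinearMap P.coact Q.coact h2 x
    change TensorProduct.map LinearMap.id LinearMap.id (smashCoact Q.coact _) =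
      LinearMap.rTensor (R ⊗[k] H) (f.toLinearMap.rTensor H)
        (TensorProduct.map LinearMap.id LinearMap.id (smashCoact P.coact x))
    rw [TensorProduct.map_id, TensorProduct.map_id]
    exact this
  · intro a
    have : f.toLinearMap.rTensor H ∘ₗ P.sect.rTensor H = Q.sect.rTensor H := by
      rw [← LinearMap.rTensor_comp]
      congr 1
      ext r
      exact h3 r
    exact LinearMap.congr_fun this a

/-- For `π : R ⊗ R → k`, the form `Φ(π)` on `R # H`,
`Φ(π)((r ⊗ h) ⊗ (r' ⊗ h')) = π(r ⊗ h • r') ε(h')`. -/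
def Phi (π : R ⊗[k] R →ₗ[k] k) : Smash k H R ⊗[k] Smash k H R →ₗ[k] k :=
  π ∘ₗ ((TensorProduct.rid k R).toLinearMap ∘ₗ
      TensorProduct.map (act k H R) (Coalgebra.counit (R := k) (A := H)) ∘ₗ
        (TensorProduct.assoc k H R H).symm.toLinearMap).lTensor R ∘ₗ
    (TensorProduct.assoc k R H (R ⊗[k] H)).toLinearMap ∘ₗ
      TensorProduct.map (Smash.toTensor R).toLinearMap (Smash.toTensor R).toLinearMap

theorem Phi_apply (π : R ⊗[k] R →ₗ[k] k) (r r' : R) (h h' : H) :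
    Phi π (Smash.mk k H r h ⊗ₜ Smash.mk k H r' h') =
      π (r ⊗ₜ (h • r')) * Coalgebra.counit (R := k) h' := by
  simp [Phi, Smash.mk, mul_comm]

variable (k H R)

/-- `C(R)`: the isomorphism classes of `R`-cleft objects with a section, in the category of left
`H`-modules. -/
abbrev BraidedCleftClass := Quotient (CleftPair.setoid (k := k) (H := H) (R := R))

/-- The map `[(𝓔, γ)] ↦ [(𝓔 # H, γ ⊗ id)]` on isomorphism classes. -/
def Psi : BraidedCleftClass k H R → PairClass k (Smash k H R) :=
  Quotient.map CleftPair.smash fun _ _ h => CleftPair.smash_isIso h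

/-- `C'(R # H)`: the classes `[(E, γ)]` in `C(R # H)` such that
`γ((1 ⊗ h)(r ⊗ h')(1 ⊗ h'')) = γ(1 ⊗ h) γ(r ⊗ h') γ(1 ⊗ h'')`. -/
def CPrime : Set (PairClass k (Smash k H R)) :=
  {x ∈ cleftClasses k (Smash k H R) | ∃ P : PrePair k (Smash k H R), x = ⟦P⟧ ∧
    ∀ (r : R) (h h' h'' : H),
      P.sect (Smash.mk k H 1 h * Smash.mk k H r h' * Smash.mk k H 1 h'') =
        P.mul (P.mul (P.sect (Smash.mk k H 1 h) ⊗ₜ P.sect (Smash.mk k H r h')) ⊗ₜ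
          P.sect (Smash.mk k H 1 h''))}

end Braided

end

end BraidedCleft

open BraidedCleft

/-! The three sets coincide because of a cycle of inclusions: every class in C' is a twisted product
by some Φ(π), every such twisted product is a smash product, and every smash product is in C'.

From C' to π. Let (E, γ) be a cleft object over a bialgebra A and g the convolution inverse of γ.
The element x₀ g(x₁) is coinvariant, hence a scalar, and this makes γ bijective (`sect_bijective`).
Transported along γ, the product of E becomes a colinear product M on A, so M(x ⊗ y) = σ(x₁ ⊗ y₁)
x₂y₂ with σ = ε ∘ M (`IsCleftObjectPair.exists_crossed`). For A = R # H the condition defining C'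
says that M is the product of R # H as soon as one factor lies in H. Associativity of M then forces
σ(xh ⊗ y) = σ(x ⊗ hy), σ(x ⊗ yh) = ε(h)σ(x ⊗ y) and σ(hx ⊗ y) = ε(h)σ(x ⊗ y). The first two rules
say that σ factors through `balance`, so that σ = Φ(π) with π its restriction to R ⊗ R; the third
says that π is H-linear; the cocycle identity is ε applied to associativity on R
(`exists_isTwoCocycle`).

Invertibility of π is handled through the translations x ↦ f(x₁)x₂, which are bijective exactly when
f is convolution invertible. The canonical maps x ⊗ y ↦ x y₁ ⊗ y₂ of the twisted and of the ordinary
product are bijective and differ by translation by Φ(π), which induces translation by π on R ⊗ R.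

From π to a smash product. The space R with product `hat k H π`, coaction Δ and section id is a
cleft object among H-modules (`IsTwoCocycle.cleftPair`). Its product is the restriction to R of the
product twisted by Φ(π), whose associativity reduces to the cocycle identity of π once all factors
from H have been moved out. The unit laws follow from π(1 ⊗ 1) = 1, the cocycle identity and
invertibility. The section of the smash product is itself the isomorphism from the twisted product
(`IsTwoCocycle.crossedPair_isIso`).

From a smash product to C'. The coaction of R # H on E # H is an algebra map; this is a computation
with the images of E, R and H in a common algebra, where the braiding appears as the price of
commuting H past E (`IsCovariant`, `imTensor_mul`, `imComul_mul_imTensor`). Coassociativity and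
counitality then need only be checked on E and on H. The inverse of γ ⊗ id is r ⊗ h ↦ S(r₍₋₁₎h)
g(r₍₀₎), and γ ⊗ id is H-bilinear because γ is H-linear (`CleftPair.isCleft_smash`,
`Psi_mem_CPrime`). -/

namespace BraidedCleft

/-! ### Sweedler calculus: products f(x₀) g(x₁) with values in an algebra. -/

section Sweedler

variable {k : Type*} [Field k] {X Y Z A B C T T' : Type*}
  [AddCommMonoid X] [Module k X] [AddCommMonoid Y] [Module k Y] [AddCommMonoid Z] [Module k Z]
  [AddCommMonoid A] [Module k A] [AddCommMonoid B] [Module k B] [AddCommMonoid C] [Module k C]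
  [Semiring T] [Algebra k T] [Semiring T'] [Algebra k T']

/-- For `D : X → A ⊗ B`, `x ↦ x₍₀₎ ⊗ x₍₁₎`, the map `x ↦ f(x₍₀₎) g(x₍₁₎)`. -/
noncomputable def sweedler (D : X →ₗ[k] A ⊗[k] B) (f : A →ₗ[k] T) (g : B →ₗ[k] T) : X →ₗ[k] T :=
  LinearMap.mul' k T ∘ₗ TensorProduct.map f g ∘ₗ D

theorem sweedler_sum {ι : Type*} (D : X →ₗ[k] A ⊗[k] B) (f : A →ₗ[k] T) (g : B →ₗ[k] T) (x : X)
    (s : Finset ι) (a : ι → A) (b : ι → B) (h : D x = ∑ i ∈ s, a i ⊗ₜ b i) :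
    sweedler D f g x = ∑ i ∈ s, f (a i) * g (b i) := by
  simp [sweedler, h]

theorem sweedler_assoc {D₁ : X →ₗ[k] Y ⊗[k] C} {D₂ : Y →ₗ[k] A ⊗[k] B} {D₃ : X →ₗ[k] A ⊗[k] Z}
    {D₄ : Z →ₗ[k] B ⊗[k] C}
    (h : (TensorProduct.assoc k A B C).toLinearMap ∘ₗ D₂.rTensor C ∘ₗ D₁ = D₄.lTensor A ∘ₗ D₃)
    (f : A →ₗ[k] T) (g : B →ₗ[k] T) (l : C →ₗ[k] T) :
    sweedler D₁ (sweedler D₂ f g) l = sweedler D₃ f (sweedler D₄ g l) := by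
  ext x
  have h1 := LinearMap.congr_fun h x
  simp only [LinearMap.comp_apply] at h1
  have h2 : ∀ t : Y ⊗[k] C, LinearMap.mul' k T (TensorProduct.map (sweedler D₂ f g) l t) =
      LinearMap.mul' k T (TensorProduct.map f (LinearMap.mul' k T ∘ₗ TensorProduct.map g l)
        (TensorProduct.assoc k A B C (D₂.rTensor C t))) := by
    intro t
    induction t using TensorProduct.induction_on with
    | zero => simp
    | add x y hx hy => simp only [map_add, hx, hy]
    | tmul y c =>
      simp only [TensorProduct.map_tmul, LinearMap.rTensor_tmul, sweedler, LinearMap.comp_apply]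
      generalize D₂ y = u
      induction u using TensorProduct.induction_on with
      | zero => simp
      | add x y hx hy => simp_all only [map_add, TensorProduct.add_tmul, LinearMap.mul'_apply]
      | tmul a b => simp [mul_assoc]
  simp only [sweedler, LinearMap.comp_apply] at h2 ⊢
  rw [h2, show TensorProduct.assoc k A B C (D₂.rTensor C (D₁ x)) = _ from h1]
  generalize D₃ x = t
  induction t using TensorProduct.induction_on with
  | zero => simp
  | add x y hx hy => simp only [map_add, hx, hy]
  | tmul a z => simp

theorem comp_sweedler (P : T →ₐ[k] T') (D : X →ₗ[k] A ⊗[k] B) (f : A →ₗ[k] T) (g : B →ₗ[k] T) :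
    P.toLinearMap ∘ₗ sweedler D f g =
      sweedler D (P.toLinearMap ∘ₗ f) (P.toLinearMap ∘ₗ g) := by
  ext x
  simp only [sweedler, LinearMap.comp_apply]
  generalize D x = t
  induction t using TensorProduct.induction_on with
  | zero => simp
  | add x y hx hy => simp only [map_add, hx, hy]
  | tmul a z => simp

theorem sweedler_mul (D : X →ₗ[k] A ⊗[k] B) (f : A →ₗ[k] T) (g : B →ₗ[k] T) (c : T) :
    LinearMap.mulRight k c ∘ₗ sweedler D f g = sweedler D f (LinearMap.mulRight k c ∘ₗ g) := by
  ext x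
  simp only [sweedler, LinearMap.comp_apply]
  generalize D x = t
  induction t using TensorProduct.induction_on with
  | zero => simp
  | add x y hx hy => simp only [map_add, hx, hy]
  | tmul a z => simp [mul_assoc]

theorem sweedler_counit_left {D : X →ₗ[k] A ⊗[k] X} {e : A →ₗ[k] k}
    (h : e.rTensor X ∘ₗ D = TensorProduct.mk k k X 1) (g : X →ₗ[k] T) :
    sweedler D (Algebra.linearMap k T ∘ₗ e) g = g := by
  ext x
  have h1 := congrArg (LinearMap.mul' k T ∘ₗ TensorProduct.map (Algebra.linearMap k T) g)
    (LinearMap.congr_fun h x)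
  simp only [LinearMap.comp_apply, TensorProduct.mk_apply, TensorProduct.map_tmul,
    LinearMap.mul'_apply, Algebra.linearMap_apply, map_one, one_mul] at h1
  rw [← h1]
  simp only [sweedler, LinearMap.comp_apply]
  generalize D x = t
  induction t using TensorProduct.induction_on with
  | zero => simp
  | add x y hx hy => simp only [map_add, hx, hy]
  | tmul a z => simp

theorem sweedler_counit_right {D : X →ₗ[k] X ⊗[k] B} {e : B →ₗ[k] k}
    (h : e.lTensor X ∘ₗ D = (TensorProduct.mk k X k).flip 1) (g : X →ₗ[k] T) :
    sweedler D g (Algebra.linearMap k T ∘ₗ e) = g := by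
  ext x
  have h1 := congrArg (LinearMap.mul' k T ∘ₗ TensorProduct.map g (Algebra.linearMap k T))
    (LinearMap.congr_fun h x)
  simp only [LinearMap.comp_apply, TensorProduct.mk_apply, TensorProduct.map_tmul,
    LinearMap.mul'_apply, Algebra.linearMap_apply, map_one, mul_one, LinearMap.flip_apply] at h1
  rw [← h1]
  simp only [sweedler, LinearMap.comp_apply]
  generalize D x = t
  induction t using TensorProduct.induction_on with
  | zero => simp
  | add x y hx hy => simp only [map_add, hx, hy]
  | tmul a z => simp

/-- A coaction with values in a tensor product of algebras is itself a Sweedler product, so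
`sweedler_assoc` can be applied to it. -/
theorem sweedler_include (D : X →ₗ[k] T ⊗[k] T') :
    sweedler D (Algebra.TensorProduct.includeLeft (R := k) (S := k) (A := T) (B := T')).toLinearMap
      (Algebra.TensorProduct.includeRight (R := k) (A := T) (B := T')).toLinearMap = D := by
  ext x
  simp only [sweedler, LinearMap.comp_apply]
  generalize D x = t
  induction t using TensorProduct.induction_on with
  | zero => simp
  | add x y hx hy => simp only [map_add, hx, hy]
  | tmul a z => simp

end Sweedler

/-! ### The smash product E # H, generated by its subalgebras E and H. -/

namespace Smash

variable {k : Type v} {H : Type u} [Field k] [Ring H] [HopfAlgebra k H]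
  {E : Type u} [Ring E] [Algebra k E] [Module H E] [IsScalarTower k H E] [HModuleAlgebra k H E]

theorem mk_mul_mk (e f : E) (h z : H) : mk k H e h * mk k H f z =
    (toTensor E).symm (smashAux e f z (Coalgebra.comul (R := k) h)) :=
  congrArg (toTensor E).symm (smashMul_tmul e f h z)

variable (k H E) in
/-- The inclusion `e ↦ e ⊗ 1` of `E` into `E # H`. -/
noncomputable def inl : E →ₐ[k] Smash k H E :=
  AlgHom.ofLinearMap ((toTensor E).symm.toLinearMap ∘ₗ (TensorProduct.mk k E H).flip 1) rfl
    fun e f => by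
      change mk k H (e * f) 1 = mk k H e 1 * mk k H f 1
      rw [mk_mul_mk, Bialgebra.comul_one, Algebra.TensorProduct.one_def, smashAux_tmul, one_smul,
        one_mul]
      rfl

variable (k H E) in
/-- The inclusion `h ↦ 1 ⊗ h` of `H` into `E # H`. -/
noncomputable def inr : H →ₐ[k] Smash k H E :=
  AlgHom.ofLinearMap ((toTensor E).symm.toLinearMap ∘ₗ TensorProduct.mk k E H 1) rfl
    fun e f => by
      change mk k H 1 (e * f) = mk k H 1 e * mk k H 1 f
      rw [mk_mul_mk]
      have key : smashAux (1 : E) (1 : E) f =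
          TensorProduct.map (Algebra.linearMap k E) (LinearMap.mulRight k f) ∘ₗ
          (Coalgebra.counit (R := k) (A := H)).rTensor H := by
        ext a b
        simp [HModuleAlgebra.smul_one (k := k), Algebra.algebraMap_eq_smul_one]
      rw [key, LinearMap.comp_apply, Coalgebra.rTensor_counit_comul]
      simp
      rfl

theorem inl_apply (e : E) : inl k H E e = mk k H e 1 := rfl
theorem inr_apply (h : H) : inr k H E h = mk k H 1 h := rfl

theorem inl_mul_inr (e : E) (h : H) : inl k H E e * inr k H E h = mk k H e h := by
  rw [inl_apply, inr_apply, mk_mul_mk, Bialgebra.comul_one, Algebra.TensorProduct.one_def,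
    smashAux_tmul, one_smul, one_mul, mul_one]
  rfl

theorem hom_ext {M : Type*} [AddCommMonoid M] [Module k M] {f g : Smash k H E →ₗ[k] M}
    (h : ∀ e z, f (inl k H E e * inr k H E z) = g (inl k H E e * inr k H E z)) : f = g := by
  have : f ∘ₗ (toTensor E).symm.toLinearMap = g ∘ₗ (toTensor E).symm.toLinearMap :=
    TensorProduct.ext' fun e z => by
      have := h e z
      rwa [inl_mul_inr] at this
  ext x
  exact LinearMap.congr_fun this x

theorem induction {p : Smash k H E → Prop} (x : Smash k H E) (zero : p 0)
    (add : ∀ x y, p x → p y → p (x + y)) (mul : ∀ e z, p (inl k H E e * inr k H E z)) : p x := by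
  refine TensorProduct.induction_on (motive := fun x => p ((toTensor E).symm x)) (toTensor E x)
    zero (fun e h => ?_) fun x y hx hy => add _ _ hx hy
  have := mul e h
  rwa [inl_mul_inr] at this

/-- `(1 ⊗ h)(e ⊗ 1) = h₁ • e ⊗ h₂`. -/
theorem inr_mul_inl (h : H) (e : E) : inr k H E h * inl k H E e =
    sweedler Coalgebra.comul
      ((inl k H E).toLinearMap ∘ₗ act k H E ∘ₗ (TensorProduct.mk k H E).flip e)
      (inr k H E).toLinearMap h := by
  rw [inl_apply, inr_apply, mk_mul_mk, sweedler, LinearMap.comp_apply, LinearMap.comp_apply]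
  generalize Coalgebra.comul (R := k) h = t
  induction t using TensorProduct.induction_on with
  | zero => simp
  | add x y hx hy => simp only [map_add, hx, hy]
  | tmul a z => simp [inl_mul_inr, mk]

end Smash

end BraidedCleft

/-! ### Covariant pairs: Yetter–Drinfeld identities read in an arbitrary algebra. -/

namespace BraidedCleft

noncomputable section

set_option linter.unusedSectionVars false

section

variable {k : Type v} {H : Type u} [Field k] [Ring H] [HopfAlgebra k H]

variable (k H) in
/-- The orbit map `h ↦ h • m`. -/
def orbit {M : Type u} [AddCommGroup M] [Module k M] [Module H M] [IsScalarTower k H M] (m : M) :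
    H →ₗ[k] M :=
  act k H M ∘ₗ (TensorProduct.mk k H M).flip m

section
variable {M N : Type u} [AddCommGroup M] [Module k M] [Module H M] [IsScalarTower k H M]
  [AddCommGroup N] [Module k N] [Module H N] [IsScalarTower k H N]

@[simp]
theorem orbit_apply (m : M) (h : H) : orbit k H m h = h • m := rfl

theorem diagAct_comul (h : H) (m : M) (n : N) :
    diagAct k H M N (h ⊗ₜ (m ⊗ₜ n)) =
      TensorProduct.map (orbit k H m) (orbit k H n) (Coalgebra.comul (R := k) h) := by
  simp only [diagAct, LinearMap.comp_apply, LinearMap.rTensor_tmul]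
  generalize Coalgebra.comul (R := k) h = u
  induction u using TensorProduct.induction_on with
  | zero => simp
  | tmul x y => simp
  | add x y hx hy => simp only [TensorProduct.add_tmul, map_add, hx, hy]

theorem mul_map_diagAct {T : Type*} [Semiring T] [Algebra k T] (f : M →ₗ[k] T) (g : N →ₗ[k] T)
    (h : H) (m : M) (n : N) :
    LinearMap.mul' k T (TensorProduct.map f g (diagAct k H M N (h ⊗ₜ (m ⊗ₜ n)))) =
      sweedler Coalgebra.comul (f ∘ₗ orbit k H m) (g ∘ₗ orbit k H n) h := by
  rw [diagAct_comul, sweedler, TensorProduct.map_comp]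
  rfl

theorem sweedler_comul_assoc {C : Type*} [AddCommGroup C] [Module k C] [Coalgebra k C] {T : Type*}
    [Semiring T] [Algebra k T] (f g l : C →ₗ[k] T) :
    sweedler Coalgebra.comul (sweedler Coalgebra.comul f g) l =
      sweedler Coalgebra.comul f (sweedler Coalgebra.comul g l) :=
  sweedler_assoc Coalgebra.coassoc f g l

end

variable {R : Type u} [Ring R] [Algebra k R] [Coalgebra k R] [Module H R] [IsScalarTower k H R]
  [YDHopfAlgebra k H R]
  {E : Type u} [Ring E] [Algebra k E] [Module H E] [IsScalarTower k H E]
  {T : Type u} [Semiring T] [Algebra k T] {T' : Type u} [Semiring T'] [Algebra k T']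

variable (k H R) in
/-- The coaction `r ↦ r₍₋₁₎ ⊗ r₍₀₎`. -/
abbrev ydCoact : R →ₗ[k] H ⊗[k] R := YetterDrinfeld.coact (k := k) (H := H) (V := R)

/-- Algebra maps `i : E → T` and `j : H → T` form a covariant pair if
`i(h₁ • e) j(h₂) = j(h) i(e)`. -/
def IsCovariant (i : E →ₐ[k] T) (j : H →ₐ[k] T) : Prop :=
  ∀ e, sweedler Coalgebra.comul (i.toLinearMap ∘ₗ orbit k H e) j.toLinearMap =
    LinearMap.mulRight k (i e) ∘ₗ j.toLinearMap

theorem IsCovariant.comp {i : E →ₐ[k] T} {j : H →ₐ[k] T} (h : IsCovariant i j) (P : T →ₐ[k] T') :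
    IsCovariant (P.comp i) (P.comp j) := by
  intro e
  have h1 := congrArg (P.toLinearMap ∘ₗ ·) (h e)
  simp only [comp_sweedler] at h1
  refine Eq.trans h1 ?_
  ext x
  simp

/-- `r ↦ j(r₍₋₁₎) i(r₍₀₎)`. -/
def imCoactR (j : H →ₐ[k] T) (i : R →ₐ[k] T) : R →ₗ[k] T :=
  sweedler (ydCoact k H R) j.toLinearMap i.toLinearMap

/-- `e ⊗ r ↦ i₁(e) j₁(r₍₋₁₎) i₂(r₍₀₎)`. -/
def imTensor (i₁ : E →ₐ[k] T) (j₁ : H →ₐ[k] T) (i₂ : R →ₐ[k] T) : E ⊗[k] R →ₗ[k] T :=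
  LinearMap.mul' k T ∘ₗ TensorProduct.map i₁.toLinearMap (imCoactR j₁ i₂)

/-- `h ↦ j₁(h₁) j₂(h₂)`. -/
def imComul (j₁ j₂ : H →ₐ[k] T) : H →ₗ[k] T :=
  sweedler Coalgebra.comul j₁.toLinearMap j₂.toLinearMap

variable {i₁ : E →ₐ[k] T} {j₁ j₂ : H →ₐ[k] T} {i₂ : R →ₐ[k] T}

theorem imTensor_tmul (e : E) (r : R) :
    imTensor i₁ j₁ i₂ (e ⊗ₜ r) = i₁ e * imCoactR j₁ i₂ r := rfl

theorem imTensor_comp (ρ : E →ₗ[k] E ⊗[k] R) :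
    imTensor i₁ j₁ i₂ ∘ₗ ρ = sweedler ρ i₁.toLinearMap (imCoactR j₁ i₂) := rfl

theorem lift_eq_mul_map {A B : Type*} [Ring A] [Algebra k A] [Ring B] [Algebra k B]
    (f : A →ₐ[k] T) (g : B →ₐ[k] T) (hc : ∀ x y, Commute (f x) (g y)) (t : A ⊗[k] B) :
    Algebra.TensorProduct.lift f g hc t =
      LinearMap.mul' k T (TensorProduct.map f.toLinearMap g.toLinearMap t) := by
  induction t using TensorProduct.induction_on with
  | zero => simp
  | tmul x y => simp
  | add x y hx hy => simp only [map_add, hx, hy]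

/-- Commuting images make `j₁` and `i₂` into one algebra map on H ⊗ R, and the coaction of R is
multiplicative for the unbraided product of H ⊗ R. -/
theorem imCoactR_mul (hc : ∀ x y, Commute (j₁ x) (i₂ y)) (r s : R) :
    imCoactR j₁ i₂ (r * s) = imCoactR j₁ i₂ r * imCoactR j₁ i₂ s := by
  have hF : ∀ r, imCoactR j₁ i₂ r = Algebra.TensorProduct.lift j₁ i₂ hc (ydCoact k H R r) :=
    fun r => (lift_eq_mul_map _ _ hc _).symm
  rw [hF, hF, hF, ← map_mul, ydCoact, YDHopfAlgebra.coact_mul]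

theorem imComul_mul (hc : ∀ x y, Commute (j₁ x) (j₂ y)) (h z : H) :
    imComul j₁ j₂ (h * z) = imComul j₁ j₂ h * imComul j₁ j₂ z := by
  have hF : ∀ r, imComul j₁ j₂ r =
    Algebra.TensorProduct.lift j₁ j₂ hc (Coalgebra.comul (R := k) r) :=
      fun r => (lift_eq_mul_map _ _ hc _).symm
  rw [hF, hF, hF, ← map_mul, Bialgebra.comul_mul]

theorem imCoactR_one : imCoactR j₁ i₂ 1 = 1 := by
  rw [imCoactR, sweedler, LinearMap.comp_apply, LinearMap.comp_apply, ydCoact,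
    YDHopfAlgebra.coact_one]
  simp

theorem imComul_one : imComul j₁ j₂ 1 = 1 := by
  rw [imComul, sweedler, LinearMap.comp_apply, LinearMap.comp_apply, Bialgebra.comul_one]
  simp [Algebra.TensorProduct.one_def]

/-- This is where the braiding comes from: covariance moves i₁(e) to the left past j₁(r₍₋₁₎),
letting part of r₍₋₁₎ act on e, and i₁(e) commutes with i₂(r₍₀₎). -/
theorem imCoactR_mul_apply (hi : IsCovariant i₁ j₁) (hc : ∀ x y, Commute (i₁ x) (i₂ y))
    (r : R) (e : E) :
    imCoactR j₁ i₂ r * i₁ e =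
      sweedler (ydCoact k H R) (i₁.toLinearMap ∘ₗ orbit k H e) (imCoactR j₁ i₂) r := by
  have h1 := sweedler_assoc (YetterDrinfeld.coact_coassoc (k := k) (H := H) (V := R))
    (i₁.toLinearMap ∘ₗ orbit k H e) j₁.toLinearMap i₂.toLinearMap
  rw [imCoactR, ← h1, hi e]
  simp only [sweedler, LinearMap.comp_apply]
  generalize ydCoact k H R r = t
  induction t using TensorProduct.induction_on with
  | zero => simp
  | tmul x y => simp [mul_assoc, (hc e y).eq]
  | add x y hx hy => simp only [map_add, add_mul, hx, hy]

/-- By the previous exchange rule, the braided product of E ⊗ R becomes the ordinary product of the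
target algebra. -/
theorem imTensor_mul (hi : IsCovariant i₁ j₁) (hc : ∀ x y, Commute (i₁ x) (i₂ y))
    (hc' : ∀ x y, Commute (j₁ x) (i₂ y)) (t u : E ⊗[k] R) :
    imTensor i₁ j₁ i₂ (TensorProduct.map (LinearMap.mul' k E) (LinearMap.mul' k R)
      (midBraid (ydCoact k H R) E E R (t ⊗ₜ u))) = imTensor i₁ j₁ i₂ t * imTensor i₁ j₁ i₂ u := by
  induction t using TensorProduct.induction_on with
  | zero => simp
  | add x y hx hy => simp only [TensorProduct.add_tmul, map_add, hx, hy, add_mul]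
  | tmul e r =>
  induction u using TensorProduct.induction_on with
  | zero => simp
  | add x y hx hy => simp only [TensorProduct.tmul_add, map_add, hx, hy, mul_add]
  | tmul f s =>
  obtain ⟨w, hw⟩ := TensorProduct.exists_finset (ydCoact k H R r)
  have h1 := imCoactR_mul_apply hi hc r f
  rw [sweedler_sum _ _ _ _ _ _ _ hw] at h1
  rw [midBraid_sum _ _ _ _ e r f s w _ _ hw]
  simp only [map_sum, TensorProduct.map_tmul, LinearMap.comp_apply, LinearMap.mul'_apply,
    imCoactR_mul hc', AlgHom.toLinearMap_apply, map_mul, orbit_apply, imTensor_tmul] at h1 ⊢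
  simp only [mul_assoc, ← Finset.mul_sum]
  rw [← mul_assoc (imCoactR j₁ i₂ r), h1]
  simp only [Finset.sum_mul, mul_assoc]

/-- The image of the Yetter-Drinfeld condition. -/
theorem diagAct_ydCoact (hc : ∀ x y, Commute (j₁ x) (i₂ y)) (h : H) (r : R) :
    LinearMap.mul' k T (TensorProduct.map j₁.toLinearMap i₂.toLinearMap
      (diagAct k H H R (h ⊗ₜ ydCoact k H R r))) =
    sweedler Coalgebra.comul (imCoactR j₁ i₂ ∘ₗ orbit k H r) j₁.toLinearMap h := by
  have h1 := LinearMap.congr_fun (YetterDrinfeld.compat (k := k) (H := H) (V := R)) (h ⊗ₜ r)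
  rw [LinearMap.comp_apply, LinearMap.lTensor_tmul] at h1
  rw [h1]
  simp only [sweedler, LinearMap.comp_apply, LinearMap.rTensor_tmul]
  generalize Coalgebra.comul (R := k) h = t
  induction t using TensorProduct.induction_on with
  | zero => simp
  | add x y hx hy => simp only [TensorProduct.add_tmul, map_add, hx, hy]
  | tmul a b =>
    simp only [LinearEquiv.coe_coe, TensorProduct.rightComm_tmul, LinearMap.rTensor_tmul,
      LinearMap.comp_apply, act_tmul, TensorProduct.map_tmul, orbit_apply, imCoactR, sweedler]
    generalize YetterDrinfeld.coact (k := k) (H := H) (a • r) = w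
    induction w using TensorProduct.induction_on with
    | zero => simp
    | add x y hx hy => simp_all only [TensorProduct.add_tmul, map_add, LinearMap.mul'_apply]
    | tmul x y => simp [mul_assoc, (hc b y).eq]

theorem imComul_mul_imCoactR (hi : IsCovariant i₂ j₂) (hc : ∀ x y, Commute (j₁ x) (i₂ y))
    (hc' : ∀ x y, Commute (j₁ x) (j₂ y)) (h : H) (r : R) :
    imComul j₁ j₂ h * imCoactR j₁ i₂ r =
      sweedler Coalgebra.comul (imCoactR j₁ i₂ ∘ₗ orbit k H r) (imComul j₁ j₂) h := by
  rw [imComul, ← sweedler_comul_assoc]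
  -- The identity is proved with an arbitrary tensor t in place of the coaction of r, which allows a
  -- reduction to pure tensors; the Yetter–Drinfeld condition enters only when t is specialised.
  have h1 : ∀ t : H ⊗[k] R, sweedler Coalgebra.comul (LinearMap.mul' k T ∘ₗ
      TensorProduct.map j₁.toLinearMap i₂.toLinearMap ∘ₗ diagAct k H H R ∘ₗ
      (TensorProduct.mk k H (H ⊗[k] R)).flip t) j₂.toLinearMap h =
      imComul j₁ j₂ h *
        (LinearMap.mul' k T (TensorProduct.map j₁.toLinearMap i₂.toLinearMap t)) := by
    intro t
    induction t using TensorProduct.induction_on with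
    | zero => simp [sweedler]
    | add x y hx hy =>
      simp only [map_add, mul_add, ← hx, ← hy, sweedler, LinearMap.comp_add,
        TensorProduct.map_add_left, LinearMap.add_comp, LinearMap.add_apply]
    | tmul x y =>
      have h2 : (LinearMap.mul' k T ∘ₗ
        TensorProduct.map j₁.toLinearMap i₂.toLinearMap ∘ₗ diagAct k H H R ∘ₗ
        (TensorProduct.mk k H (H ⊗[k] R)).flip (x ⊗ₜ y)) =
        sweedler Coalgebra.comul (j₁.toLinearMap ∘ₗ orbit k H x)
          (i₂.toLinearMap ∘ₗ orbit k H y) := by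
        ext h
        exact mul_map_diagAct _ _ h x y
      rw [h2, sweedler_comul_assoc, hi y]
      simp only [imComul, sweedler, LinearMap.comp_apply]
      generalize Coalgebra.comul (R := k) h = t
      induction t using TensorProduct.induction_on with
      | zero => simp
      | add x y hx hy => simp only [map_add, hx, hy, add_mul]
      | tmul a b =>
        simp only [TensorProduct.map_tmul, LinearMap.mul'_apply, LinearMap.comp_apply, orbit_apply,
          AlgHom.toLinearMap_apply, LinearMap.mulRight_apply, smul_eq_mul, map_mul, mul_assoc]
        congr 1
        rw [← mul_assoc, ← mul_assoc, (hc' _ _).eq]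
  have h4 := h1 (ydCoact k H R r)
  rw [imComul] at h4
  refine Eq.trans rfl (h4.symm.trans ?_)
  congr 2
  ext h
  exact diagAct_ydCoact hc h r

/-- The image of the smash relation (1 ⊗ h)(e ⊗ 1) = h₁ • e ⊗ h₂ under the coaction, with Δ(h) on
one side and a general tensor in place of ρ(e) on the other. -/
theorem imComul_mul_imTensor (hi : IsCovariant i₁ j₁) (hi' : IsCovariant i₂ j₂)
    (hc : ∀ x y, Commute (j₁ x) (i₂ y)) (hc' : ∀ x y, Commute (j₁ x) (j₂ y))
    (hc'' : ∀ x y, Commute (i₁ x) (j₂ y)) (h : H) (t : E ⊗[k] R) :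
    imComul j₁ j₂ h * imTensor i₁ j₁ i₂ t = sweedler Coalgebra.comul
      (imTensor i₁ j₁ i₂ ∘ₗ diagAct k H E R ∘ₗ (TensorProduct.mk k H (E ⊗[k] R)).flip t)
      (imComul j₁ j₂) h := by
  induction t using TensorProduct.induction_on with
  | zero => simp [sweedler]
  | add x y hx hy =>
    simp only [map_add, mul_add, hx, hy, sweedler, LinearMap.comp_add,
      TensorProduct.map_add_left, LinearMap.add_comp, LinearMap.add_apply]
  | tmul e r =>
    have h1 : imTensor i₁ j₁ i₂ ∘ₗ diagAct k H E R ∘ₗ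
        (TensorProduct.mk k H (E ⊗[k] R)).flip (e ⊗ₜ r) =
        sweedler Coalgebra.comul (i₁.toLinearMap ∘ₗ orbit k H e)
          (imCoactR j₁ i₂ ∘ₗ orbit k H r) := by
      ext h
      exact mul_map_diagAct _ _ h e r
    have h2 : sweedler Coalgebra.comul (imCoactR j₁ i₂ ∘ₗ orbit k H r) (imComul j₁ j₂) =
        LinearMap.mulRight k (imCoactR j₁ i₂ r) ∘ₗ imComul j₁ j₂ := by
      ext h
      exact (imComul_mul_imCoactR hi' hc hc' h r).symm
    have h3 : LinearMap.mulRight k (i₁ e) ∘ₗ imComul j₁ j₂ =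
        sweedler Coalgebra.comul (i₁.toLinearMap ∘ₗ orbit k H e) (imComul j₁ j₂) := by
      rw [imComul, ← sweedler_comul_assoc, hi e]
      ext h
      simp only [sweedler, LinearMap.comp_apply]
      generalize Coalgebra.comul (R := k) h = t
      induction t using TensorProduct.induction_on with
      | zero => simp
      | add x y hx hy => simp only [map_add, hx, hy]
      | tmul a b => simp [mul_assoc, (hc'' e b).eq]
    rw [h1, sweedler_comul_assoc, h2, ← sweedler_mul, ← h3]
    simp [imTensor, mul_assoc]

theorem comp_imCoactR (F : T →ₐ[k] T') :
    F.toLinearMap ∘ₗ imCoactR j₁ i₂ = imCoactR (F.comp j₁) (F.comp i₂) :=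
  comp_sweedler F _ _ _

theorem comp_imTensor (F : T →ₐ[k] T') :
    F.toLinearMap ∘ₗ imTensor i₁ j₁ i₂ = imTensor (F.comp i₁) (F.comp j₁) (F.comp i₂) := by
  rw [imTensor, imTensor, ← comp_imCoactR]
  ext e r
  simp

theorem comp_imComul (F : T →ₐ[k] T') :
    F.toLinearMap ∘ₗ imComul j₁ j₂ = imComul (F.comp j₁) (F.comp j₂) :=
  comp_sweedler F _ _ _

theorem isCovariant_smash [HModuleAlgebra k H E] :
    IsCovariant (Smash.inl k H E) (Smash.inr k H E) := by
  intro e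
  ext h
  exact (Smash.inr_mul_inl h e).symm

end
end
end BraidedCleft

/-! ### The coaction of R # H on E # H is multiplicative; R # H is a bialgebra. -/

namespace BraidedCleft

noncomputable section

set_option linter.unusedSectionVars false

section

variable {k : Type v} {H : Type u} [Field k] [Ring H] [HopfAlgebra k H]

variable {R : Type u} [Ring R] [Algebra k R] [Coalgebra k R] [Module H R] [IsScalarTower k H R]
  [YDHopfAlgebra k H R]
  {E : Type u} [Ring E] [Algebra k E] [Module H E] [IsScalarTower k H E] [HModuleAlgebra k H E]

/-- The coaction `e ⊗ h ↦ (e₍₀₎ ⊗ e₍₁₎₍₋₁₎ h₁) ⊗ (e₍₁₎₍₀₎ ⊗ h₂)` of `R # H` on `E # H`. -/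
def bosonCoact {E : Type u} [AddCommGroup E] [Module k E] (ρ : E →ₗ[k] E ⊗[k] R) :
    Smash k H E →ₗ[k] Smash k H E ⊗[k] Smash k H R :=
  TensorProduct.map (Smash.toTensor E).symm.toLinearMap (Smash.toTensor R).symm.toLinearMap ∘ₗ
    smashCoact ρ ∘ₗ (Smash.toTensor E).toLinearMap

theorem comul_eq_bosonCoact : Coalgebra.comul (R := k) (A := Smash k H R) =
    bosonCoact (Coalgebra.comul (R := k) (A := R)) := by
  refine LinearMap.ext fun x => ?_
  change smashComul k H R x = TensorProduct.map LinearMap.id LinearMap.id (smashComul k H R x)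
  rw [TensorProduct.map_id]
  rfl

variable (k H E R) in
/-- The inclusion of the left factor of `(E # H) ⊗ (R # H)`. -/
abbrev fstHom : Smash k H E →ₐ[k] Smash k H E ⊗[k] Smash k H R :=
  Algebra.TensorProduct.includeLeft

variable (k H E R) in
/-- The inclusion of the right factor of `(E # H) ⊗ (R # H)`. -/
abbrev sndHom : Smash k H R →ₐ[k] Smash k H E ⊗[k] Smash k H R :=
  Algebra.TensorProduct.includeRight

theorem commute_fst_snd (x : Smash k H E) (y : Smash k H R) :
    Commute (fstHom k H R E x) (sndHom k H R E y) := by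
  simp [Commute, SemiconjBy]

/-- Splitting the coaction into a factor from e and a factor from h brings the calculus of covariant
pairs to bear. -/
theorem bosonCoact_apply (ρ : E →ₗ[k] E ⊗[k] R) (e : E) (h : H) :
    bosonCoact ρ (Smash.inl k H E e * Smash.inr k H E h) =
      imTensor ((fstHom k H R E).comp (Smash.inl k H E)) ((fstHom k H R E).comp (Smash.inr k H E))
        ((sndHom k H R E).comp (Smash.inl k H R)) (ρ e) *
      imComul ((fstHom k H R E).comp (Smash.inr k H E))
        ((sndHom k H R E).comp (Smash.inr k H R)) h := by
  rw [Smash.inl_mul_inr]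
  change TensorProduct.map (Smash.toTensor E).symm.toLinearMap (Smash.toTensor R).symm.toLinearMap
    (midBraid (ydCoact k H R) E H H (ρ e ⊗ₜ Coalgebra.comul (R := k) h)) = _
  rw [imComul, sweedler, LinearMap.comp_apply, LinearMap.comp_apply]
  generalize ρ e = t
  generalize Coalgebra.comul (R := k) h = u
  induction t using TensorProduct.induction_on with
  | zero => simp
  | add x y hx hy => simp only [TensorProduct.add_tmul, map_add, hx, hy, add_mul]
  | tmul e r =>
  induction u using TensorProduct.induction_on with
  | zero => simp
  | add x y hx hy => simp only [TensorProduct.tmul_add, map_add, hx, hy, mul_add]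
  | tmul a b =>
  obtain ⟨w, hw⟩ := TensorProduct.exists_finset (ydCoact k H R r)
  rw [midBraid_sum _ _ _ _ e r a b w _ _ hw, imTensor_tmul, imCoactR,
    sweedler_sum _ _ _ _ _ _ _ hw, map_sum, Finset.mul_sum, Finset.sum_mul]
  refine Finset.sum_congr rfl fun p _ => ?_
  rw [TensorProduct.map_tmul]
  change Smash.mk k H e (p.1 * a) ⊗ₜ[k] Smash.mk k H p.2 b = _
  simp only [← Smash.inl_mul_inr, map_mul, AlgHom.comp_apply, AlgHom.toLinearMap_apply,
    LinearMap.mul'_apply, TensorProduct.map_tmul, Algebra.TensorProduct.includeLeft_apply,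
    Algebra.TensorProduct.includeRight_apply, Algebra.TensorProduct.tmul_mul_tmul, mul_one, one_mul,
    mul_assoc]

/-- Only three relations matter: products in E are handled by `imTensor_mul`, products in H by
`imComul_mul`, and moving h past f by `imComul_mul_imTensor` together with H-linearity of ρ. -/
theorem bosonCoact_mul (ρ : E →ₗ[k] E ⊗[k] R)
    (hρ : ∀ (h : H) (x : E), ρ (h • x) = diagAct k H E R (h ⊗ₜ ρ x))
    (hmul : ∀ x y : E, ρ (x * y) =
      TensorProduct.map (LinearMap.mul' k E) (LinearMap.mul' k R)
        (midBraid (ydCoact k H R) E E R (ρ x ⊗ₜ ρ y)))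
    (x y : Smash k H E) : bosonCoact ρ (x * y) = bosonCoact ρ x * bosonCoact ρ y := by
  have cov := (isCovariant_smash (k := k) (H := H) (E := E)).comp (fstHom k H R E)
  have cov' := (isCovariant_smash (k := k) (H := H) (E := R)).comp (sndHom k H R E)
  induction x using Smash.induction with
  | zero => simp
  | add x y hx hy => simp only [map_add, hx, hy, add_mul]
  | mul e h =>
  induction y using Smash.induction with
  | zero => simp
  | add x y hx hy => simp only [map_add, hx, hy, mul_add]
  | mul f z =>
  have key := imComul_mul_imTensor cov cov' (fun _ _ => commute_fst_snd _ _)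
    (fun _ _ => commute_fst_snd _ _) (fun _ _ => commute_fst_snd _ _) h (ρ f)
  have imul := imTensor_mul cov (i₂ := (sndHom k H R E).comp (Smash.inl k H R))
    (fun _ _ => commute_fst_snd _ _) (fun _ _ => commute_fst_snd _ _)
  have dmul := imComul_mul (j₁ := (fstHom k H R E).comp (Smash.inr k H E))
    (j₂ := (sndHom k H R E).comp (Smash.inr k H R)) fun _ _ => commute_fst_snd _ _
  obtain ⟨w, hw⟩ := TensorProduct.exists_finset (Coalgebra.comul (R := k) h)
  rw [sweedler_sum _ _ _ _ _ _ _ hw] at key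
  have h1 : Smash.inl k H E e * Smash.inr k H E h * (Smash.inl k H E f * Smash.inr k H E z) =
      ∑ i ∈ w, Smash.inl k H E (e * (i.1 • f)) * Smash.inr k H E (i.2 * z) := by
    rw [mul_assoc, ← mul_assoc (Smash.inr k H E h), Smash.inr_mul_inl,
      sweedler_sum _ _ _ _ _ _ _ hw, Finset.sum_mul, Finset.mul_sum]
    simp [mul_assoc]
  rw [h1, map_sum, bosonCoact_apply, bosonCoact_apply, mul_assoc, ← mul_assoc (imComul _ _ h), key]
  simp only [bosonCoact_apply, hmul, imul, hρ, dmul, Finset.sum_mul, Finset.mul_sum, mul_assoc]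
  rfl

theorem bosonCoact_one (ρ : E →ₗ[k] E ⊗[k] R) (hone : ρ 1 = 1 ⊗ₜ[k] 1) :
    bosonCoact (H := H) ρ 1 = 1 := by
  have h1 := bosonCoact_apply (H := H) ρ 1 1
  rw [map_one, map_one, mul_one] at h1
  rw [h1, hone, imTensor_tmul, imComul_one, imCoactR_one]
  simp [Algebra.TensorProduct.one_def]

/-- The coaction of `R # H` on `E # H` as a morphism of algebras. -/
def bosonCoactHom (ρ : E →ₗ[k] E ⊗[k] R)
    (hρ : ∀ (h : H) (x : E), ρ (h • x) = diagAct k H E R (h ⊗ₜ ρ x))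
    (hone : ρ 1 = 1 ⊗ₜ[k] 1)
    (hmul : ∀ x y : E, ρ (x * y) =
      TensorProduct.map (LinearMap.mul' k E) (LinearMap.mul' k R)
        (midBraid (ydCoact k H R) E E R (ρ x ⊗ₜ ρ y))) :
    Smash k H E →ₐ[k] Smash k H E ⊗[k] Smash k H R :=
  AlgHom.ofLinearMap (bosonCoact ρ) (bosonCoact_one ρ hone) (bosonCoact_mul ρ hρ hmul)

theorem smash_comul_mul (x y : Smash k H R) : Coalgebra.comul (R := k) (x * y) =
    Coalgebra.comul (R := k) x * Coalgebra.comul (R := k) y := by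
  rw [comul_eq_bosonCoact]
  exact bosonCoact_mul _ YDHopfAlgebra.comul_smul YDHopfAlgebra.comul_mul x y

theorem smash_comul_one : Coalgebra.comul (R := k) (1 : Smash k H R) = 1 := by
  rw [comul_eq_bosonCoact]
  exact bosonCoact_one _ (YDHopfAlgebra.comul_one H)

theorem smash_counit_apply (r : R) (h : H) :
    Coalgebra.counit (R := k) (Smash.inl k H R r * Smash.inr k H R h) =
      Coalgebra.counit (R := k) r * Coalgebra.counit (R := k) h := by
  rw [Smash.inl_mul_inr]
  rfl

theorem smash_counit_inl (r : R) :
    Coalgebra.counit (R := k) (Smash.inl k H R r) = Coalgebra.counit (R := k) r := by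
  simpa using smash_counit_apply (k := k) (H := H) r 1

theorem smash_counit_inr (h : H) :
    Coalgebra.counit (R := k) (Smash.inr k H R h) = Coalgebra.counit (R := k) h := by
  simpa [YDHopfAlgebra.counit_one H] using smash_counit_apply (k := k) (R := R) 1 h

theorem smash_counit_mul (x y : Smash k H R) : Coalgebra.counit (R := k) (x * y) =
    Coalgebra.counit (R := k) x * Coalgebra.counit (R := k) y := by
  induction x using Smash.induction with
  | zero => simp
  | add x y hx hy => simp only [map_add, hx, hy, add_mul]
  | mul e h =>
  induction y using Smash.induction with
  | zero => simp
  | add x y hx hy => simp only [map_add, hx, hy, mul_add]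
  | mul f z =>
  obtain ⟨w, hw⟩ := TensorProduct.exists_finset (Coalgebra.comul (R := k) h)
  have h1 : Smash.inl k H R e * Smash.inr k H R h * (Smash.inl k H R f * Smash.inr k H R z) =
      ∑ i ∈ w, Smash.inl k H R (e * (i.1 • f)) * Smash.inr k H R (i.2 * z) := by
    rw [mul_assoc, ← mul_assoc (Smash.inr k H R h), Smash.inr_mul_inl,
      sweedler_sum _ _ _ _ _ _ _ hw, Finset.sum_mul, Finset.mul_sum]
    simp [mul_assoc]
  have h2 := congrArg (Coalgebra.counit (R := k) (A := H))
    (congrArg (TensorProduct.lid k H) (Coalgebra.rTensor_counit_comul (R := k) h))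
  rw [hw] at h2
  simp only [map_sum, LinearMap.rTensor_tmul, TensorProduct.lid_tmul, map_smul, one_smul,
    smul_eq_mul] at h2
  rw [h1, map_sum]
  simp only [smash_counit_apply, YDHopfAlgebra.counit_mul H, YDHopfAlgebra.counit_smul,
    Bialgebra.counit_mul]
  rw [← h2, Finset.mul_sum, Finset.sum_mul]
  exact Finset.sum_congr rfl fun _ _ => by ring

instance Smash.instBialgebra : Bialgebra k (Smash k H R) :=
  Bialgebra.mk' k _ (by rw [← map_one (Smash.inl k H R), smash_counit_inl, YDHopfAlgebra.counit_one H])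
    (fun {_ _} => smash_counit_mul _ _) smash_comul_one fun {_ _} => smash_comul_mul _ _

end
end
end BraidedCleft

/-! ### Coassociativity of the coaction on E # H. -/

namespace BraidedCleft

noncomputable section

set_option linter.unusedSectionVars false

section

variable {k : Type v} {H : Type u} [Field k] [Ring H] [HopfAlgebra k H]

variable {R : Type u} [Ring R] [Algebra k R] [Coalgebra k R] [Module H R] [IsScalarTower k H R]
  [YDHopfAlgebra k H R]
  {E : Type u} [Ring E] [Algebra k E] [Module H E] [IsScalarTower k H E] [HModuleAlgebra k H E]

theorem bosonCoact_comp_inl (ρ : E →ₗ[k] E ⊗[k] R) :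
    bosonCoact ρ ∘ₗ (Smash.inl k H E).toLinearMap =
      imTensor ((fstHom k H R E).comp (Smash.inl k H E)) ((fstHom k H R E).comp (Smash.inr k H E))
        ((sndHom k H R E).comp (Smash.inl k H R)) ∘ₗ ρ := by
  ext e
  have := bosonCoact_apply (H := H) ρ e 1
  rw [map_one, mul_one, imComul_one, mul_one] at this
  exact this

theorem bosonCoact_comp_inr (ρ : E →ₗ[k] E ⊗[k] R) (hone : ρ 1 = 1 ⊗ₜ[k] 1) :
    bosonCoact ρ ∘ₗ (Smash.inr k H E).toLinearMap =
      imComul ((fstHom k H R E).comp (Smash.inr k H E))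
        ((sndHom k H R E).comp (Smash.inr k H R)) := by
  ext h
  have := bosonCoact_apply (H := H) ρ 1 h
  rw [map_one, one_mul, hone, imTensor_tmul, imCoactR_one, map_one, one_mul, one_mul] at this
  exact this

theorem comulAlgHom_comp_inl : (Bialgebra.comulAlgHom k (Smash k H R)).toLinearMap ∘ₗ
    (Smash.inl k H R).toLinearMap =
      imTensor ((fstHom k H R R).comp (Smash.inl k H R)) ((fstHom k H R R).comp (Smash.inr k H R))
        ((sndHom k H R R).comp (Smash.inl k H R)) ∘ₗ Coalgebra.comul := by
  have := bosonCoact_comp_inl (H := H) (R := R) (Coalgebra.comul (R := k) (A := R))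
  rw [← comul_eq_bosonCoact] at this
  exact this

theorem comulAlgHom_comp_inr : (Bialgebra.comulAlgHom k (Smash k H R)).toLinearMap ∘ₗ
    (Smash.inr k H R).toLinearMap =
      imComul ((fstHom k H R R).comp (Smash.inr k H R))
        ((sndHom k H R R).comp (Smash.inr k H R)) := by
  have := bosonCoact_comp_inr (H := H) (R := R) (Coalgebra.comul (R := k) (A := R))
    (YDHopfAlgebra.comul_one H)
  rw [← comul_eq_bosonCoact] at this
  exact this

theorem Smash.algHom_ext {T : Type*} [Semiring T] [Algebra k T] {f g : Smash k H E →ₐ[k] T}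
    (h₁ : f.comp (Smash.inl k H E) = g.comp (Smash.inl k H E))
    (h₂ : f.comp (Smash.inr k H E) = g.comp (Smash.inr k H E)) : f = g := by
  have : f.toLinearMap = g.toLinearMap := Smash.hom_ext fun e z => by
    have h3 := DFunLike.congr_fun h₁ e
    have h4 := DFunLike.congr_fun h₂ z
    simp only [AlgHom.comp_apply] at h3 h4
    simp [h3, h4]
  ext x
  exact LinearMap.congr_fun this x

/-- Colinearity of the comultiplication of `R`, read off in an algebra. -/
theorem sweedler_comul_colinear {T : Type*} [Semiring T] [Algebra k T] (a : H →ₐ[k] T)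
    (b c : R →ₗ[k] T) (hc : ∀ x y, Commute (a x) (b y)) :
    sweedler (ydCoact k H R) a.toLinearMap (sweedler Coalgebra.comul b c) =
      sweedler Coalgebra.comul (sweedler (ydCoact k H R) a.toLinearMap b)
        (sweedler (ydCoact k H R) a.toLinearMap c) := by
  ext r
  have h1 := congrArg (LinearMap.mul' k T ∘ₗ TensorProduct.map a.toLinearMap
    (LinearMap.mul' k T ∘ₗ TensorProduct.map b c)) (comul_colinear' (k := k) (H := H) r)
  simp only [LinearMap.comp_apply] at h1
  refine Eq.trans ?_ (h1.trans ?_)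
  · simp only [sweedler, LinearMap.comp_apply]
    generalize YetterDrinfeld.coact (k := k) (H := H) r = t
    induction t using TensorProduct.induction_on with
    | zero => simp
    | add x y hx hy => simp only [map_add, hx, hy]
    | tmul x y => simp
  · rw [sweedler, LinearMap.comp_apply, LinearMap.comp_apply]
    generalize Coalgebra.comul (R := k) r = t
    induction t using TensorProduct.induction_on with
    | zero => simp
    | add x y hx hy => simp only [map_add, hx, hy]
    | tmul x y =>
      simp only [TensorProduct.map_tmul, sweedler, LinearMap.comp_apply, ydCoact]
      generalize YetterDrinfeld.coact (k := k) (H := H) x = u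
      generalize YetterDrinfeld.coact (k := k) (H := H) y = w
      induction u using TensorProduct.induction_on with
      | zero => simp
      | add x y hx hy =>
        simp_all only [TensorProduct.add_tmul, map_add, LinearMap.mul'_apply]
      | tmul p q =>
        induction w using TensorProduct.induction_on with
        | zero => simp
        | add x y hx hy =>
          simp_all only [TensorProduct.tmul_add, map_add, LinearMap.mul'_apply]
        | tmul p' q' =>
          simp only [TensorProduct.tensorTensorTensorComm_tmul, LinearMap.rTensor_tmul,
            LinearMap.mul'_apply, TensorProduct.map_tmul, AlgHom.toLinearMap_apply, map_mul,
            LinearMap.comp_apply, mul_assoc]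
          rw [← mul_assoc (a p'), (hc p' q).eq, mul_assoc]

/-- Both sides are algebra maps on E # H, so it is enough to compare them on E and on H. On H this
is coassociativity of H; on E it combines coassociativity of ρ, colinearity of Δ on R and
coassociativity of the left coaction of R. -/
theorem bosonCoact_coassoc (ρ : E →ₗ[k] E ⊗[k] R)
    (hρ : ∀ (h : H) (x : E), ρ (h • x) = diagAct k H E R (h ⊗ₜ ρ x))
    (hone : ρ 1 = 1 ⊗ₜ[k] 1)
    (hmul : ∀ x y : E, ρ (x * y) =
      TensorProduct.map (LinearMap.mul' k E) (LinearMap.mul' k R)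
        (midBraid (ydCoact k H R) E E R (ρ x ⊗ₜ ρ y)))
    (hassoc : (TensorProduct.assoc k E R R).toLinearMap ∘ₗ ρ.rTensor R ∘ₗ ρ =
      (Coalgebra.comul (R := k) (A := R)).lTensor E ∘ₗ ρ) :
    (TensorProduct.assoc k (Smash k H E) (Smash k H R) (Smash k H R)).toLinearMap ∘ₗ
      (bosonCoact ρ).rTensor (Smash k H R) ∘ₗ bosonCoact ρ =
    (Coalgebra.comul (R := k) (A := Smash k H R)).lTensor (Smash k H E) ∘ₗ bosonCoact ρ := by
  let F := bosonCoactHom ρ hρ hone hmul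
  let P : Smash k H E ⊗[k] Smash k H R →ₐ[k]
      Smash k H E ⊗[k] (Smash k H R ⊗[k] Smash k H R) :=
    (Algebra.TensorProduct.assoc k k k (Smash k H E) (Smash k H R) (Smash k H R)).toAlgHom.comp
      (Algebra.TensorProduct.map F (AlgHom.id k _))
  let Q : Smash k H E ⊗[k] Smash k H R →ₐ[k]
      Smash k H E ⊗[k] (Smash k H R ⊗[k] Smash k H R) :=
    Algebra.TensorProduct.map (AlgHom.id k _) (Bialgebra.comulAlgHom k (Smash k H R))
  let ι₁ : Smash k H E →ₐ[k] Smash k H E ⊗[k] (Smash k H R ⊗[k] Smash k H R) :=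
    Algebra.TensorProduct.includeLeft
  let ι₂ : Smash k H R →ₐ[k] Smash k H E ⊗[k] (Smash k H R ⊗[k] Smash k H R) :=
    Algebra.TensorProduct.includeRight.comp Algebra.TensorProduct.includeLeft
  let ι₃ : Smash k H R →ₐ[k] Smash k H E ⊗[k] (Smash k H R ⊗[k] Smash k H R) :=
    Algebra.TensorProduct.includeRight.comp Algebra.TensorProduct.includeRight
  suffices h : P.comp F = Q.comp F by
    have := congrArg AlgHom.toLinearMap h
    exact this
  let A₁₂ : Smash k H E ⊗[k] Smash k H R →ₐ[k]
      Smash k H E ⊗[k] (Smash k H R ⊗[k] Smash k H R) :=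
    Algebra.TensorProduct.map (AlgHom.id k _) Algebra.TensorProduct.includeLeft
  let A₂₃ : Smash k H R ⊗[k] Smash k H R →ₐ[k]
      Smash k H E ⊗[k] (Smash k H R ⊗[k] Smash k H R) := Algebra.TensorProduct.includeRight
  have hPl : P.comp (fstHom k H R E) = A₁₂.comp F := by
    ext x
    simp only [P, AlgHom.comp_apply, Algebra.TensorProduct.includeLeft_apply,
      Algebra.TensorProduct.map_tmul, map_one, A₁₂]
    generalize F x = t
    induction t using TensorProduct.induction_on with
    | zero => simp
    | add x y hx hy => simp only [map_add, hx, hy, TensorProduct.add_tmul]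
    | tmul x y => simp
  have hPr : P.comp (sndHom k H R E) = ι₃ := by
    ext x
    simp [P, ι₃, Algebra.TensorProduct.one_def]
  have hQl : Q.comp (fstHom k H R E) = ι₁ := by
    ext x
    simp [Q, ι₁]
  have hQr : Q.comp (sndHom k H R E) = A₂₃.comp (Bialgebra.comulAlgHom k (Smash k H R)) := by
    ext x
    simp [Q, A₂₃]
  have hA1 : A₁₂.comp (fstHom k H R E) = ι₁ := by
    ext x
    simp [A₁₂, ι₁, Algebra.TensorProduct.one_def]
  have hA2 : A₁₂.comp (sndHom k H R E) = ι₂ := by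
    ext x
    simp [A₁₂, ι₂]
  have hFr : F.toLinearMap ∘ₗ (Smash.inr k H E).toLinearMap = _ := bosonCoact_comp_inr ρ hone
  have hFl : F.toLinearMap ∘ₗ (Smash.inl k H E).toLinearMap = _ := bosonCoact_comp_inl ρ
  have hΔr := comulAlgHom_comp_inr (k := k) (H := H) (R := R)
  have hΔl := comulAlgHom_comp_inl (k := k) (H := H) (R := R)
  -- h₁ in the first and h₂ in the second of the three tensor slots.
  let d := imComul (k := k) (H := H)
    (T := Smash k H E ⊗[k] (Smash k H R ⊗[k] Smash k H R)) (ι₁.comp (Smash.inr k H E)) (ι₂.comp (Smash.inr k H R))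
  have hPj : (P.comp ((fstHom k H R E).comp (Smash.inr k H E))).toLinearMap = d := by
    rw [← AlgHom.comp_assoc, hPl, AlgHom.comp_assoc, AlgHom.comp_toLinearMap,
      AlgHom.comp_toLinearMap, hFr, comp_imComul, ← AlgHom.comp_assoc, ← AlgHom.comp_assoc, hA1,
      hA2]
  apply Smash.algHom_ext
  · have hl : (P.comp ((fstHom k H R E).comp (Smash.inl k H E))).toLinearMap =
        imTensor (ι₁.comp (Smash.inl k H E)) (ι₁.comp (Smash.inr k H E))
          (ι₂.comp (Smash.inl k H R)) ∘ₗ ρ := by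
      rw [← AlgHom.comp_assoc, hPl, AlgHom.comp_assoc, AlgHom.comp_toLinearMap,
        AlgHom.comp_toLinearMap, hFl, ← LinearMap.comp_assoc, comp_imTensor]
      simp only [← AlgHom.comp_assoc, hA1, hA2]
    -- Colinearity of Δ on R distributes r₍₋₁₎ over r₁ and r₂, with the first slot commuting with
    -- the other two; coassociativity of the left coaction then produces `d` on r₂₍₋₁₎.
    have hcop : sweedler (ydCoact k H R) (ι₁.comp (Smash.inr k H E)).toLinearMap
        (A₂₃.comp ((Bialgebra.comulAlgHom k (Smash k H R)).comp (Smash.inl k H R))).toLinearMap =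
        sweedler Coalgebra.comul (imCoactR (ι₁.comp (Smash.inr k H E)) (ι₂.comp (Smash.inl k H R)))
          (sweedler (ydCoact k H R) d (ι₃.comp (Smash.inl k H R)).toLinearMap) := by
      change sweedler (ydCoact k H R) _ (A₂₃.toLinearMap ∘ₗ
        ((Bialgebra.comulAlgHom k (Smash k H R)).toLinearMap ∘ₗ (Smash.inl k H R).toLinearMap)) = _
      rw [hΔl, ← LinearMap.comp_assoc, comp_imTensor, imTensor_comp, sweedler_comul_colinear]
      · congr 1
        exact (sweedler_assoc (YetterDrinfeld.coact_coassoc (k := k) (H := H) (V := R)) _ _ _).symm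
      · intro x y
        simp [ι₁, A₂₃, Commute, SemiconjBy]
    have hR : Q.toLinearMap ∘ₗ imCoactR ((fstHom k H R E).comp (Smash.inr k H E))
        ((sndHom k H R E).comp (Smash.inl k H R)) = _ := (comp_imCoactR Q).trans
      ((by rw [imCoactR, ← AlgHom.comp_assoc, ← AlgHom.comp_assoc, hQl, hQr, AlgHom.comp_assoc] :
        _ = _).trans hcop)
    have : (P.comp (F.comp (Smash.inl k H E))).toLinearMap =
        (Q.comp (F.comp (Smash.inl k H E))).toLinearMap := by
      change P.toLinearMap ∘ₗ (F.toLinearMap ∘ₗ (Smash.inl k H E).toLinearMap) =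
        Q.toLinearMap ∘ₗ (F.toLinearMap ∘ₗ (Smash.inl k H E).toLinearMap)
      rw [hFl, imTensor_comp, comp_sweedler, comp_sweedler, hR]
      rw [comp_imCoactR, imCoactR, hPj, ← AlgHom.comp_toLinearMap, hl,
        ← AlgHom.comp_toLinearMap, ← AlgHom.comp_assoc Q, hQl, imTensor_comp, sweedler_assoc hassoc,
        ← AlgHom.comp_assoc, hPr]
    exact AlgHom.toLinearMap_injective this
  · have : (P.comp (F.comp (Smash.inr k H E))).toLinearMap =
        (Q.comp (F.comp (Smash.inr k H E))).toLinearMap := by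
      change P.toLinearMap ∘ₗ (F.toLinearMap ∘ₗ (Smash.inr k H E).toLinearMap) =
        Q.toLinearMap ∘ₗ (F.toLinearMap ∘ₗ (Smash.inr k H E).toLinearMap)
      rw [hFr, comp_imComul, comp_imComul, imComul, imComul, hPj]
      simp only [d]
      rw [imComul, sweedler_comul_assoc]
      rw [← AlgHom.comp_assoc Q, hQl]
      congr 1
      rw [← AlgHom.comp_assoc Q, hQr, ← AlgHom.comp_assoc, hPr]
      change _ = A₂₃.toLinearMap ∘ₗ
        ((Bialgebra.comulAlgHom k (Smash k H R)).toLinearMap ∘ₗ (Smash.inr k H R).toLinearMap)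
      rw [hΔr, comp_imComul]
      rfl
    exact AlgHom.toLinearMap_injective this

end
end
end BraidedCleft

/-! ### Counit and coinvariants of E # H. -/

namespace BraidedCleft

noncomputable section

set_option linter.unusedSectionVars false

section

variable {k : Type v} {H : Type u} [Field k] [Ring H] [HopfAlgebra k H]

variable {R : Type u} [Ring R] [Algebra k R] [Coalgebra k R] [Module H R] [IsScalarTower k H R]
  [YDHopfAlgebra k H R]
  {E : Type u} [Ring E] [Algebra k E] [Module H E] [IsScalarTower k H E] [HModuleAlgebra k H E]

theorem imCoactR_counit {T : Type u} [Semiring T] [Algebra k T] (j : H →ₐ[k] T) :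
    sweedler (ydCoact k H R) j.toLinearMap (Algebra.linearMap k T ∘ₗ Coalgebra.counit) =
      Algebra.linearMap k T ∘ₗ Coalgebra.counit := by
  ext r
  have h1 := congrArg (LinearMap.mul' k T ∘ₗ TensorProduct.map j.toLinearMap
    (Algebra.linearMap k T)) (counit_colinear' (k := k) (H := H) r)
  refine Eq.trans ?_ (h1.trans ?_)
  · simp only [sweedler, LinearMap.comp_apply]
    generalize YetterDrinfeld.coact (k := k) (H := H) r = t
    induction t using TensorProduct.induction_on with
    | zero => simp
    | add x y hx hy => simp only [map_add, hx, hy]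
    | tmul x y => simp
  · simp

/-- Since ε on R # H has scalar, hence central, values, id ⊗ ε is an algebra map, and the composite
with the coaction need only be compared with the identity on E and on H. -/
theorem bosonCoact_counit (ρ : E →ₗ[k] E ⊗[k] R)
    (hρ : ∀ (h : H) (x : E), ρ (h • x) = diagAct k H E R (h ⊗ₜ ρ x))
    (hone : ρ 1 = 1 ⊗ₜ[k] 1)
    (hmul : ∀ x y : E, ρ (x * y) =
      TensorProduct.map (LinearMap.mul' k E) (LinearMap.mul' k R)
        (midBraid (ydCoact k H R) E E R (ρ x ⊗ₜ ρ y)))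
    (hcounit : (Coalgebra.counit (R := k) (A := R)).lTensor E ∘ₗ ρ =
      (TensorProduct.mk k E k).flip 1) :
    (Coalgebra.counit (R := k) (A := Smash k H R)).lTensor (Smash k H E) ∘ₗ bosonCoact ρ =
      (TensorProduct.mk k (Smash k H E) k).flip 1 := by
  let F := bosonCoactHom ρ hρ hone hmul
  let η : Smash k H R →ₐ[k] Smash k H E :=
    (Algebra.ofId k (Smash k H E)).comp (Bialgebra.counitAlgHom k (Smash k H R))
  have hη : ∀ y, η y = algebraMap k _ (Coalgebra.counit (R := k) y) := fun _ => rfl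
  have hc : ∀ x y, Commute (AlgHom.id k (Smash k H E) x) (η y) := fun x y =>
    Algebra.commute_algebraMap_right (Coalgebra.counit (R := k) y) x
  let G : Smash k H E ⊗[k] Smash k H R →ₐ[k] Smash k H E :=
    Algebra.TensorProduct.lift (AlgHom.id k _) η hc
  have hG : ∀ t, (Coalgebra.counit (R := k) (A := Smash k H R)).lTensor (Smash k H E) t =
      G t ⊗ₜ 1 := by
    intro t
    induction t using TensorProduct.induction_on with
    | zero => simp
    | add x y hx hy => simp only [map_add, hx, hy, TensorProduct.add_tmul]
    | tmul x y =>
      simp only [LinearMap.lTensor_tmul, G, Algebra.TensorProduct.lift_tmul, hη,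
        AlgHom.id_apply]
      rw [← Algebra.commutes, ← Algebra.smul_def, TensorProduct.smul_tmul, smul_eq_mul, mul_one]
  have hGl : G.comp (fstHom k H R E) = AlgHom.id k _ := by
    ext x
    simp [G]
  have hGr : G.comp (sndHom k H R E) = η := by
    ext x
    simp [G]
  suffices h : G.comp F = AlgHom.id k _ by
    ext x
    have := DFunLike.congr_fun h x
    rw [LinearMap.comp_apply, hG]
    change (G.comp F) x ⊗ₜ[k] (1 : k) = _
    rw [this]
    rfl
  have hFr : F.toLinearMap ∘ₗ (Smash.inr k H E).toLinearMap = _ := bosonCoact_comp_inr ρ hone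
  have hFl : F.toLinearMap ∘ₗ (Smash.inl k H E).toLinearMap = _ := bosonCoact_comp_inl ρ
  have hηl : (η.comp (Smash.inl k H R)).toLinearMap =
      Algebra.linearMap k (Smash k H E) ∘ₗ Coalgebra.counit := by
    ext r
    simp [η, smash_counit_inl, Algebra.ofId_apply]
  have hηr : (η.comp (Smash.inr k H R)).toLinearMap =
      Algebra.linearMap k (Smash k H E) ∘ₗ Coalgebra.counit := by
    ext r
    simp [η, smash_counit_inr, Algebra.ofId_apply]
  apply Smash.algHom_ext
  · have : G.toLinearMap ∘ₗ (F.toLinearMap ∘ₗ (Smash.inl k H E).toLinearMap) =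
        (Smash.inl k H E).toLinearMap := by
      rw [hFl, ← LinearMap.comp_assoc, comp_imTensor, imTensor_comp]
      simp only [← AlgHom.comp_assoc, hGl, hGr, AlgHom.id_comp]
      rw [imCoactR, hηl, imCoactR_counit]
      exact sweedler_counit_right hcounit _
    exact AlgHom.toLinearMap_injective this
  · have : G.toLinearMap ∘ₗ (F.toLinearMap ∘ₗ (Smash.inr k H E).toLinearMap) =
        (Smash.inr k H E).toLinearMap := by
      rw [hFr, comp_imComul, imComul]
      simp only [← AlgHom.comp_assoc, hGl, hGr, AlgHom.id_comp]
      rw [hηr]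
      exact sweedler_counit_right Coalgebra.lTensor_counit_comp_comul _
    exact AlgHom.toLinearMap_injective this

variable (k H E) in
/-- The map `e ⊗ h ↦ ε(h) e`. -/
def Smash.fst : Smash k H E →ₗ[k] E :=
  (TensorProduct.rid k E).toLinearMap ∘ₗ (Coalgebra.counit (R := k) (A := H)).lTensor E ∘ₗ
    (Smash.toTensor E).toLinearMap

variable (k H R) in
/-- The map `r ⊗ h ↦ ε(r) h`. -/
def Smash.snd : Smash k H R →ₗ[k] H :=
  (TensorProduct.lid k H).toLinearMap ∘ₗ (Coalgebra.counit (R := k) (A := R)).rTensor H ∘ₗ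
    (Smash.toTensor R).toLinearMap

theorem Smash.fst_mk (e : E) (h : H) :
    Smash.fst k H E (Smash.mk k H e h) = Coalgebra.counit (R := k) h • e := by
  simp [Smash.fst, Smash.mk]

theorem Smash.snd_mk (r : R) (h : H) :
    Smash.snd k H R (Smash.mk k H r h) = Coalgebra.counit (R := k) r • h := by
  simp [Smash.snd, Smash.mk]

theorem bosonCoact_mk (ρ : E →ₗ[k] E ⊗[k] R) (e : E) (h : H) :
    bosonCoact ρ (Smash.mk k H e h) =
      TensorProduct.map (Smash.toTensor E).symm.toLinearMap (Smash.toTensor R).symm.toLinearMap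
        (midBraid (ydCoact k H R) E H H (ρ e ⊗ₜ Coalgebra.comul (R := k) h)) := rfl

theorem map_midBraid_tmul (e : E) (r : R) (a b : H) {ι : Type*} (s : Finset ι) (x : ι → H)
    (y : ι → R) (hs : ydCoact k H R r = ∑ i ∈ s, x i ⊗ₜ[k] y i) :
    TensorProduct.map (Smash.toTensor E).symm.toLinearMap (Smash.toTensor R).symm.toLinearMap
      (midBraid (ydCoact k H R) E H H ((e ⊗ₜ r) ⊗ₜ (a ⊗ₜ b))) =
      ∑ i ∈ s, Smash.mk k H e (x i * a) ⊗ₜ Smash.mk k H (y i) b := by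
  rw [midBraid_sum _ _ _ _ _ _ _ _ _ _ _ hs, map_sum]
  rfl

theorem sum_counit_smul (r : R) {ι : Type*} (s : Finset ι) (x : ι → H)
    (y : ι → R) (hs : ydCoact k H R r = ∑ i ∈ s, x i ⊗ₜ[k] y i) :
    ∑ i ∈ s, Coalgebra.counit (R := k) (x i) • y i = r := by
  have h1 := counit_coact' (k := k) (H := H) r
  rw [show YetterDrinfeld.coact r = _ from hs] at h1
  simpa using congrArg (TensorProduct.lid k R) h1

/-- The two counits delete the middle factors e₍₁₎₍₋₁₎h₁ and e₍₁₎₍₀₎, so an element of E # H is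
recovered from its coaction. For a coinvariant x this gives that x equals the image of its E-part.
-/
theorem fst_snd_bosonCoact (ρ : E →ₗ[k] E ⊗[k] R)
    (hcounit : (Coalgebra.counit (R := k) (A := R)).lTensor E ∘ₗ ρ =
      (TensorProduct.mk k E k).flip 1) (x : Smash k H E) :
    LinearMap.mul' k (Smash k H E) (TensorProduct.map
      ((Smash.inl k H E).toLinearMap ∘ₗ Smash.fst k H E)
      ((Smash.inr k H E).toLinearMap ∘ₗ Smash.snd k H R) (bosonCoact ρ x)) = x := by
  induction x using Smash.induction with
  | zero => simp
  | add x y hx hy => simp only [map_add, hx, hy]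
  | mul e h =>
  have key : ∀ (t : E ⊗[k] R) (u : H ⊗[k] H), LinearMap.mul' k (Smash k H E) (TensorProduct.map
      ((Smash.inl k H E).toLinearMap ∘ₗ Smash.fst k H E)
      ((Smash.inr k H E).toLinearMap ∘ₗ Smash.snd k H R)
      (TensorProduct.map (Smash.toTensor E).symm.toLinearMap (Smash.toTensor R).symm.toLinearMap
        (midBraid (ydCoact k H R) E H H (t ⊗ₜ u)))) =
      Smash.inl k H E (TensorProduct.rid k E ((Coalgebra.counit (R := k) (A := R)).lTensor E t)) *
      Smash.inr k H E (TensorProduct.lid k H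
        ((Coalgebra.counit (R := k) (A := H)).rTensor H u)) := by
    intro t u
    induction t using TensorProduct.induction_on with
    | zero => simp
    | add x y hx hy => simp only [TensorProduct.add_tmul, map_add, hx, hy, add_mul]
    | tmul e r =>
    induction u using TensorProduct.induction_on with
    | zero => simp
    | add x y hx hy => simp only [TensorProduct.tmul_add, map_add, hx, hy, mul_add]
    | tmul a b =>
    obtain ⟨w, hw⟩ := TensorProduct.exists_finset (ydCoact k H R r)
    have h1 := congrArg (Coalgebra.counit (R := k)) (sum_counit_smul r w _ _ hw)
    simp only [map_sum, map_smul, smul_eq_mul] at h1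
    rw [map_midBraid_tmul _ _ _ _ w _ _ hw]
    simp only [map_sum, TensorProduct.map_tmul, LinearMap.comp_apply, Smash.fst_mk, Smash.snd_mk,
      AlgHom.toLinearMap_apply, map_smul, LinearMap.mul'_apply, LinearMap.lTensor_tmul,
      LinearMap.rTensor_tmul, TensorProduct.lid_tmul, TensorProduct.rid_tmul,
      smul_mul_assoc, mul_smul_comm, Bialgebra.counit_mul, smul_smul]
    rw [← h1, ← Finset.sum_smul, Finset.mul_sum]
    congr 1
    exact Finset.sum_congr rfl fun _ _ => by ring
  have h2 := LinearMap.congr_fun hcounit e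
  rw [LinearMap.comp_apply] at h2
  rw [Smash.inl_mul_inr, bosonCoact_mk, key, h2, Coalgebra.rTensor_counit_comul,
    ← Smash.inl_mul_inr]
  simp

/-- Applying ε to both H-components leaves the coaction of E, so the E-part of a coinvariant of E #
H is a coinvariant of E. -/
theorem map_fst_bosonCoact (ρ : E →ₗ[k] E ⊗[k] R) (x : Smash k H E) :
    TensorProduct.map (Smash.fst k H E) (Smash.fst k H R) (bosonCoact ρ x) =
      ρ (Smash.fst k H E x) := by
  induction x using Smash.induction with
  | zero => simp
  | add x y hx hy => simp only [map_add, hx, hy]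
  | mul e h =>
  have key : ∀ (t : E ⊗[k] R) (u : H ⊗[k] H),
      TensorProduct.map (Smash.fst k H E) (Smash.fst k H R)
      (TensorProduct.map (Smash.toTensor E).symm.toLinearMap (Smash.toTensor R).symm.toLinearMap
        (midBraid (ydCoact k H R) E H H (t ⊗ₜ u))) =
      Coalgebra.counit (R := k) (TensorProduct.lid k H
        ((Coalgebra.counit (R := k) (A := H)).rTensor H u)) • t := by
    intro t u
    induction t using TensorProduct.induction_on with
    | zero => simp
    | add x y hx hy => simp only [TensorProduct.add_tmul, map_add, hx, hy, smul_add]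
    | tmul e r =>
    induction u using TensorProduct.induction_on with
    | zero => simp
    | add x y hx hy => simp only [TensorProduct.tmul_add, map_add, hx, hy, add_smul]
    | tmul a b =>
    obtain ⟨w, hw⟩ := TensorProduct.exists_finset (ydCoact k H R r)
    have h1 := sum_counit_smul r w _ _ hw
    rw [map_midBraid_tmul _ _ _ _ w _ _ hw]
    simp only [map_sum, TensorProduct.map_tmul, Smash.fst_mk, Bialgebra.counit_mul,
      LinearMap.rTensor_tmul, TensorProduct.lid_tmul, map_smul]
    conv_rhs => rw [← h1]
    simp only [TensorProduct.tmul_sum, Finset.smul_sum, TensorProduct.tmul_smul,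
      TensorProduct.smul_tmul', smul_smul, smul_eq_mul]
    refine Finset.sum_congr rfl fun _ _ => ?_
    congr 2
    ring
  rw [Smash.inl_mul_inr, bosonCoact_mk, key, Coalgebra.rTensor_counit_comul, Smash.fst_mk]
  simp

theorem Smash.fst_one : Smash.fst k H E 1 = 1 := by
  have := Smash.fst_mk (k := k) (1 : E) (1 : H)
  rw [Bialgebra.counit_one, one_smul] at this
  exact this

theorem Smash.snd_one : Smash.snd k H R 1 = 1 := by
  have := Smash.snd_mk (k := k) (1 : R) (1 : H)
  rw [YDHopfAlgebra.counit_one H, one_smul] at this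
  exact this

theorem bosonCoact_coinvariants (ρ : E →ₗ[k] E ⊗[k] R)
    (hcounit : (Coalgebra.counit (R := k) (A := R)).lTensor E ∘ₗ ρ =
      (TensorProduct.mk k E k).flip 1)
    (hco : ∀ x : E, ρ x = x ⊗ₜ[k] 1 → ∃ c : k, x = c • (1 : E)) (x : Smash k H E)
    (hx : bosonCoact ρ x = x ⊗ₜ[k] 1) : ∃ c : k, x = c • (1 : Smash k H E) := by
  have h1 := fst_snd_bosonCoact ρ hcounit x
  have h2 := map_fst_bosonCoact ρ x
  rw [hx, TensorProduct.map_tmul, Smash.fst_one] at h2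
  obtain ⟨c, hc⟩ := hco _ h2.symm
  refine ⟨c, ?_⟩
  rw [← h1, hx]
  simp [hc, Smash.snd_one]

end
end
end BraidedCleft

/-! ### The section γ ⊗ id and its convolution inverse. -/

namespace BraidedCleft

noncomputable section

set_option linter.unusedSectionVars false

section

variable {k : Type v} {H : Type u} [Field k] [Ring H] [HopfAlgebra k H]

variable {R : Type u} [Ring R] [Algebra k R] [Coalgebra k R] [Module H R] [IsScalarTower k H R]
  [YDHopfAlgebra k H R]
  {E : Type u} [Ring E] [Algebra k E] [Module H E] [IsScalarTower k H E] [HModuleAlgebra k H E]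

/-- The map `r ⊗ h ↦ γ(r) ⊗ h`. -/
def smashSect (γ : R →ₗ[k] E) : Smash k H R →ₗ[k] Smash k H E :=
  (Smash.toTensor E).symm.toLinearMap ∘ₗ γ.rTensor H ∘ₗ (Smash.toTensor R).toLinearMap

theorem smashSect_mk (γ : R →ₗ[k] E) (r : R) (h : H) :
    smashSect γ (Smash.mk k H r h) = Smash.inl k H E (γ r) * Smash.inr k H E h := by
  rw [Smash.inl_mul_inr]
  rfl

/-- The map `r ↦ S(r₍₋₁₎) g(r₍₀₎)`. -/
def antipodeTwist (g : R →ₗ[k] E) : R →ₗ[k] Smash k H E :=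
  sweedler (ydCoact k H R) ((Smash.inr k H E).toLinearMap ∘ₗ HopfAlgebra.antipode k)
    ((Smash.inl k H E).toLinearMap ∘ₗ g)

/-- The map `r ⊗ h ↦ S(r₍₋₁₎ h) g(r₍₀₎)`. -/
def smashSectInv (g : R →ₗ[k] E) : Smash k H R →ₗ[k] Smash k H E :=
  LinearMap.mul' k _ ∘ₗ TensorProduct.map
    ((Smash.inr k H E).toLinearMap ∘ₗ HopfAlgebra.antipode k) (antipodeTwist g) ∘ₗ
    (TensorProduct.comm k R H).toLinearMap ∘ₗ (Smash.toTensor R).toLinearMap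

theorem smashSectInv_mk (g : R →ₗ[k] E) (r : R) (h : H) :
    smashSectInv g (Smash.mk k H r h) =
      Smash.inr k H E (HopfAlgebra.antipode k h) * antipodeTwist g r := rfl

/-- Coassociativity of the coaction turns the product into r₍₋₁₎₁ S(r₍₋₁₎₂) g(r₍₀₎), where the
antipode cancels. -/
theorem sweedler_antipodeTwist (g : R →ₗ[k] E) :
    sweedler (ydCoact k H R) (Smash.inr k H E).toLinearMap (antipodeTwist g) =
      (Smash.inl k H E).toLinearMap ∘ₗ g := by
  rw [antipodeTwist, ← sweedler_assoc (YetterDrinfeld.coact_coassoc (k := k) (H := H) (V := R))]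
  have : sweedler Coalgebra.comul (Smash.inr k H E).toLinearMap
      ((Smash.inr k H E).toLinearMap ∘ₗ HopfAlgebra.antipode k) =
      Algebra.linearMap k (Smash k H E) ∘ₗ Coalgebra.counit := by
    have h1 := comp_sweedler (Smash.inr k H E) (Coalgebra.comul (R := k) (A := H))
      LinearMap.id (HopfAlgebra.antipode k)
    rw [LinearMap.comp_id] at h1
    rw [← h1]
    ext h
    have h2 := LinearMap.congr_fun (HopfAlgebra.mul_antipode_lTensor_comul (R := k) (A := H)) h
    simp only [LinearMap.comp_apply] at h2
    rw [LinearMap.comp_apply, sweedler, LinearMap.comp_apply, LinearMap.comp_apply]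
    erw [h2]
    simp
  rw [this]
  exact sweedler_counit_left YetterDrinfeld.counit_coact _

/-- The cancellation goes from the inside out in γ(r₁) r₂₍₋₁₎h₁ · S(h₂) S(r₂₍₀₎₍₋₁₎) g(r₂₍₀₎₍₀₎):
h₁S(h₂) collapses, then `sweedler_antipodeTwist` leaves γ(r₁)g(r₂). -/
theorem conv_smashSect_inv (γ g : R →ₗ[k] E)
    (hγ : sweedler Coalgebra.comul γ g = Algebra.linearMap k E ∘ₗ Coalgebra.counit) :
    sweedler Coalgebra.comul (smashSect (H := H) γ) (smashSectInv g) =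
      Algebra.linearMap k (Smash k H E) ∘ₗ Coalgebra.counit := by
  refine Smash.hom_ext fun r h => ?_
  have key : ∀ (t : R ⊗[k] R) (u : H ⊗[k] H), LinearMap.mul' k (Smash k H E)
      (TensorProduct.map (smashSect γ) (smashSectInv g)
      (TensorProduct.map (Smash.toTensor R).symm.toLinearMap (Smash.toTensor R).symm.toLinearMap
        (midBraid (ydCoact k H R) R H H (t ⊗ₜ u)))) =
      LinearMap.mul' k _ (TensorProduct.map ((Smash.inl k H E).toLinearMap ∘ₗ γ)
        (LinearMap.mul' k _ ∘ₗ TensorProduct.map ((Smash.inr k H E).toLinearMap ∘ₗ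
          LinearMap.mulRight k (LinearMap.mul' k H ((HopfAlgebra.antipode k).lTensor H u)))
          (antipodeTwist g) ∘ₗ ydCoact k H R) t) := by
    intro t u
    induction t using TensorProduct.induction_on with
    | zero => simp
    | add x y hx hy => simp only [TensorProduct.add_tmul, map_add, hx, hy]
    | tmul e r =>
    induction u using TensorProduct.induction_on with
    | zero => simp
    | add x y hx hy =>
      simp only [TensorProduct.tmul_add, map_add, hx, hy, LinearMap.comp_apply,
        TensorProduct.map_tmul, LinearMap.mul'_apply]
      rw [← mul_add]
      congr 1
      generalize ydCoact k H R r = w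
      induction w using TensorProduct.induction_on with
      | zero => simp
      | add x y hx hy =>
        simp only [map_add, ← hx, ← hy]
        abel
      | tmul p q => simp [mul_add, add_mul]
    | tmul a b =>
    obtain ⟨w, hw⟩ := TensorProduct.exists_finset (ydCoact k H R r)
    rw [map_midBraid_tmul _ _ _ _ w _ _ hw]
    simp only [map_sum, TensorProduct.map_tmul, LinearMap.comp_apply, hw, smashSect_mk,
      smashSectInv_mk, LinearMap.mul'_apply, AlgHom.toLinearMap_apply, map_mul,
      LinearMap.lTensor_tmul, LinearMap.mulRight_apply, Finset.mul_sum, mul_assoc]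
  have h2 := LinearMap.congr_fun (HopfAlgebra.mul_antipode_lTensor_comul (R := k) (A := H)) h
  simp only [LinearMap.comp_apply] at h2
  rw [Smash.inl_mul_inr, sweedler, comul_eq_bosonCoact, LinearMap.comp_apply, LinearMap.comp_apply,
    bosonCoact_mk, key, h2]
  have h3 := LinearMap.congr_fun (sweedler_antipodeTwist (H := H) g)
  have h4 : LinearMap.mul' k _ ∘ₗ TensorProduct.map ((Smash.inr k H E).toLinearMap ∘ₗ
          LinearMap.mulRight k (Algebra.linearMap k H (Coalgebra.counit h)))
          (antipodeTwist g) ∘ₗ ydCoact k H R =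
      Coalgebra.counit (R := k) h • ((Smash.inl k H E).toLinearMap ∘ₗ g) := by
    ext r
    rw [LinearMap.smul_apply, ← h3, sweedler]
    simp only [LinearMap.comp_apply]
    generalize ydCoact k H R r = w
    induction w using TensorProduct.induction_on with
    | zero => simp
    | add x y hx hy => simp only [map_add, hx, hy, smul_add]
    | tmul p q => simp [Algebra.algebraMap_eq_smul_one]
  have h5 := LinearMap.congr_fun (congrArg ((Smash.inl k H E).toLinearMap ∘ₗ ·) hγ) r
  simp only [comp_sweedler] at h5
  rw [h4, TensorProduct.map_smul_right, LinearMap.smul_apply, map_smul]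
  refine Eq.trans (congrArg _ h5) ?_
  rw [LinearMap.comp_apply (g := Coalgebra.counit), ← Smash.inl_mul_inr, smash_counit_apply]
  simp [Algebra.algebraMap_eq_smul_one, smul_smul, mul_comm]

/-- The map `r ⊗ s ↦ S(s₍₋₁₎) S(r₍₋₁₎) g(r₍₀₎) γ(s₍₀₎)`. -/
def antipodeBracket (g γ : R →ₗ[k] E) : R ⊗[k] R →ₗ[k] Smash k H E :=
  LinearMap.mul' k _ ∘ₗ TensorProduct.map
    ((Smash.inr k H E).toLinearMap ∘ₗ HopfAlgebra.antipode k)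
    (LinearMap.mul' k _ ∘ₗ TensorProduct.map (antipodeTwist g)
      ((Smash.inl k H E).toLinearMap ∘ₗ γ)) ∘ₗ
    (TensorProduct.leftComm k R H R).toLinearMap ∘ₗ (ydCoact k H R).lTensor R

/-- Antimultiplicativity gives S(r₂₍₋₁₎)S(r₁₍₋₁₎) = S(r₁₍₋₁₎r₂₍₋₁₎), and colinearity of Δ rewrites
the whole as S(r₍₋₁₎) times (g * γ)(r₍₀₎). Since g * γ = ε, colinearity of ε finishes. -/
theorem antipodeBracket_comul (g γ : R →ₗ[k] E)
    (hγ : sweedler Coalgebra.comul g γ = Algebra.linearMap k E ∘ₗ Coalgebra.counit) (r : R) :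
    antipodeBracket (H := H) g γ (Coalgebra.comul r) =
      algebraMap k _ (Coalgebra.counit (R := k) r) := by
  have h1 := congrArg (LinearMap.mul' k (Smash k H E) ∘ₗ TensorProduct.map
    ((Smash.inr k H E).toLinearMap ∘ₗ HopfAlgebra.antipode k)
    ((Smash.inl k H E).toLinearMap ∘ₗ LinearMap.mul' k E ∘ₗ TensorProduct.map g γ))
    (comul_colinear' (k := k) (H := H) r)
  have h2 := congrArg (LinearMap.mul' k (Smash k H E) ∘ₗ TensorProduct.map
    ((Smash.inr k H E).toLinearMap ∘ₗ HopfAlgebra.antipode k)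
    (Algebra.linearMap k (Smash k H E)))
    (counit_colinear' (k := k) (H := H) r)
  refine Eq.trans ?_ (h1.symm.trans (Eq.trans ?_ (h2.trans ?_)))
  · simp only [antipodeBracket, LinearMap.comp_apply]
    generalize Coalgebra.comul (R := k) r = t
    induction t using TensorProduct.induction_on with
    | zero => simp
    | add x y hx hy => simp only [map_add, hx, hy]
    | tmul x y =>
      simp only [TensorProduct.map_tmul, LinearMap.lTensor_tmul]
      change _ = LinearMap.mul' k _ (TensorProduct.map _ _ (LinearMap.rTensor _ _
        (TensorProduct.tensorTensorTensorComm k H R H R (ydCoact k H R x ⊗ₜ ydCoact k H R y))))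
      generalize ydCoact k H R y = w
      induction w using TensorProduct.induction_on with
      | zero => simp
      | add x y hx hy => simp only [TensorProduct.tmul_add, map_add, hx, hy]
      | tmul p' q' =>
        simp only [LinearEquiv.coe_coe, TensorProduct.leftComm_tmul, TensorProduct.map_tmul,
          LinearMap.comp_apply, antipodeTwist, sweedler, LinearMap.mul'_apply]
        generalize ydCoact k H R x = w
        induction w using TensorProduct.induction_on with
        | zero => simp
        | add x y hx hy =>
          simp only [TensorProduct.add_tmul, map_add, ← hx, ← hy, add_mul, mul_add]
        | tmul p q =>
          simp [HopfAlgebra.antipode_mul_antidistrib, mul_assoc]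
  · simp only [LinearMap.comp_apply]
    generalize YetterDrinfeld.coact (k := k) (H := H) r = t
    induction t using TensorProduct.induction_on with
    | zero => simp
    | add x y hx hy => simp only [map_add, hx, hy]
    | tmul x y =>
      have h3 := LinearMap.congr_fun hγ y
      simp only [sweedler, LinearMap.comp_apply] at h3
      simp [h3]
  · simp

/-- The factor between S(h₁) and h₂ is the antipode bracket of Δ(r), which is the scalar ε(r); after
that S(h₁)h₂ collapses. -/
theorem conv_inv_smashSect (γ g : R →ₗ[k] E)
    (hγ : sweedler Coalgebra.comul g γ = Algebra.linearMap k E ∘ₗ Coalgebra.counit) :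
    sweedler Coalgebra.comul (smashSectInv g) (smashSect (H := H) γ) =
      Algebra.linearMap k (Smash k H E) ∘ₗ Coalgebra.counit := by
  refine Smash.hom_ext fun r h => ?_
  have key : ∀ (t : R ⊗[k] R) (u : H ⊗[k] H), LinearMap.mul' k (Smash k H E)
      (TensorProduct.map (smashSectInv g) (smashSect γ)
      (TensorProduct.map (Smash.toTensor R).symm.toLinearMap (Smash.toTensor R).symm.toLinearMap
        (midBraid (ydCoact k H R) R H H (t ⊗ₜ u)))) =
      LinearMap.mul' k _ (TensorProduct.map
        (LinearMap.mulRight k (antipodeBracket g γ t) ∘ₗ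
        (Smash.inr k H E).toLinearMap ∘ₗ HopfAlgebra.antipode k) (Smash.inr k H E).toLinearMap u) := by
    intro t u
    induction u using TensorProduct.induction_on with
    | zero => simp
    | add x y hx hy => simp only [TensorProduct.tmul_add, map_add, hx, hy]
    | tmul a b =>
    induction t using TensorProduct.induction_on with
    | zero => simp
    | add x y hx hy => 
      simp only [TensorProduct.add_tmul, map_add, hx, hy]
      simp [mul_add, add_mul]
    | tmul e r =>
    obtain ⟨w, hw⟩ := TensorProduct.exists_finset (ydCoact k H R r)
    rw [map_midBraid_tmul _ _ _ _ w _ _ hw]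
    simp only [map_sum, TensorProduct.map_tmul, LinearMap.comp_apply, hw, smashSect_mk,
      smashSectInv_mk, LinearMap.mul'_apply, AlgHom.toLinearMap_apply, antipodeBracket,
      LinearMap.lTensor_tmul, LinearMap.mulRight_apply, Finset.mul_sum, Finset.sum_mul,
      TensorProduct.tmul_sum, LinearEquiv.coe_coe, TensorProduct.leftComm_tmul,
      HopfAlgebra.antipode_mul_antidistrib, map_mul, mul_assoc]
  rw [Smash.inl_mul_inr, sweedler, comul_eq_bosonCoact, LinearMap.comp_apply, LinearMap.comp_apply,
    bosonCoact_mk, key, antipodeBracket_comul g γ hγ]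
  have h2 := congrArg (Smash.inr k H E)
    (LinearMap.congr_fun (HopfAlgebra.mul_antipode_rTensor_comul (R := k) (A := H)) h)
  simp only [LinearMap.comp_apply] at h2
  have h4 : ∀ u : H ⊗[k] H, LinearMap.mul' k (Smash k H E) (TensorProduct.map
        (LinearMap.mulRight k (algebraMap k _ (Coalgebra.counit (R := k) r)) ∘ₗ
        (Smash.inr k H E).toLinearMap ∘ₗ HopfAlgebra.antipode k) (Smash.inr k H E).toLinearMap u) =
      Coalgebra.counit (R := k) r • Smash.inr k H E
        (LinearMap.mul' k H ((HopfAlgebra.antipode k).rTensor H u)) := by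
    intro u
    induction u using TensorProduct.induction_on with
    | zero => simp
    | add x y hx hy => simp only [map_add, hx, hy, smul_add]
    | tmul a b => simp [Algebra.algebraMap_eq_smul_one]
  rw [h4, h2, LinearMap.comp_apply, ← Smash.inl_mul_inr, smash_counit_apply]
  simp [Algebra.algebraMap_eq_smul_one, smul_smul]

end
end
end BraidedCleft

/-! ### Smash products of cleft objects are cleft and lie in C'; the antipode of R # H. -/

namespace BraidedCleft

noncomputable section

set_option linter.unusedSectionVars false

section

variable {k : Type v} {H : Type u} [Field k] [Ring H] [HopfAlgebra k H]

variable {R : Type u} [Ring R] [Algebra k R] [Coalgebra k R] [Module H R] [IsScalarTower k H R]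
  [YDHopfAlgebra k H R]
  {E : Type u} [Ring E] [Algebra k E] [Module H E] [IsScalarTower k H E] [HModuleAlgebra k H E]

theorem linearMap_eq_toSpanSingleton (B : Type*) [Ring B] [Algebra k B] :
    Algebra.linearMap k B = LinearMap.toSpanSingleton k B 1 := by
  ext
  simp

theorem tensor_mul_eq {A B : Type*} [Ring A] [Algebra k A] [Ring B] [Algebra k B]
    (t u : A ⊗[k] B) : t * u = TensorProduct.map (LinearMap.mul' k A) (LinearMap.mul' k B)
      (TensorProduct.tensorTensorTensorComm k A B A B (t ⊗ₜ u)) := by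
  induction t using TensorProduct.induction_on with
  | zero => simp
  | add x y hx hy => simp only [TensorProduct.add_tmul, map_add, add_mul, hx, hy]
  | tmul a b =>
  induction u using TensorProduct.induction_on with
  | zero => simp
  | add x y hx hy => simp only [TensorProduct.tmul_add, map_add, mul_add, hx, hy]
  | tmul a b => simp

theorem bosonCoact_comp_smashSect (ρ : E →ₗ[k] E ⊗[k] R) (γ : R →ₗ[k] E)
    (hγ : ρ ∘ₗ γ = γ.rTensor R ∘ₗ Coalgebra.comul) :
    bosonCoact ρ ∘ₗ smashSect (H := H) γ =
      (smashSect γ).rTensor (Smash k H R) ∘ₗ Coalgebra.comul := by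
  refine LinearMap.ext fun x => ?_
  have h1 := smashCoact_map (k := k) (H := H) (R := R) γ Coalgebra.comul ρ
    (LinearMap.congr_fun hγ) (Smash.toTensor R x)
  rw [comul_eq_bosonCoact]
  change TensorProduct.map LinearMap.id LinearMap.id (smashCoact ρ (γ.rTensor H _)) =
      LinearMap.rTensor (R ⊗[k] H) (γ.rTensor H)
        (TensorProduct.map LinearMap.id LinearMap.id (smashCoact Coalgebra.comul x))
  rw [TensorProduct.map_id, TensorProduct.map_id]
  exact h1

theorem CleftPair.isCleft_smash (P : CleftPair k H R) : IsCleftObjectPair P.smash where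
  mul_assoc x y z := _root_.mul_assoc (G := Smash k H P.carrier) x y z
  one_mul x := _root_.one_mul (M := Smash k H P.carrier) x
  mul_one x := _root_.mul_one (M := Smash k H P.carrier) x
  coact_coassoc :=
    bosonCoact_coassoc P.coact P.coact_linear P.coact_one P.coact_mul P.coact_coassoc
  coact_counit := bosonCoact_counit P.coact P.coact_linear P.coact_one P.coact_mul P.coact_counit
  coact_one := bosonCoact_one P.coact P.coact_one
  coact_mul x y := by
    refine (bosonCoact_mul P.coact P.coact_linear P.coact_mul x y).trans ?_
    change _ = TensorProduct.map (LinearMap.mul' k (Smash k H P.carrier))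
      (LinearMap.mul' k (Smash k H R)) (TensorProduct.tensorTensorTensorComm k _ _ _ _
        (bosonCoact P.coact x ⊗ₜ bosonCoact P.coact y))
    exact tensor_mul_eq _ _
  one_ne_zero h := P.one_ne_zero <| by
    have := congrArg (Smash.fst k H P.carrier) h
    exact Smash.fst_one.symm.trans (this.trans (map_zero _))
  coinvariants x hx := bosonCoact_coinvariants P.coact P.coact_counit P.coinvariants x hx
  sect_one := by
    refine (smashSect_mk P.sect 1 1).trans ?_
    rw [P.sect_one, map_one, map_one, _root_.one_mul]
    rfl
  sect_colinear := bosonCoact_comp_smashSect P.coact P.sect P.sect_colinear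
  sect_invertible := by
    obtain ⟨g, -, h1, h2⟩ := P.sect_invertible
    refine ⟨smashSectInv g, ?_, ?_⟩
    · refine (conv_smashSect_inv P.sect g h1).trans ?_
      rw [linearMap_eq_toSpanSingleton]
      rfl
    · refine (conv_inv_smashSect P.sect g h2).trans ?_
      rw [linearMap_eq_toSpanSingleton]
      rfl

/-- Moving h past r acts on r, so left H-linearity of γ ⊗ id is the H-linearity of γ; right
H-linearity holds for every γ. -/
theorem smashSect_inr_mul (γ : R →ₗ[k] E) (hγ : ∀ (h : H) (r : R), γ (h • r) = h • γ r) (h : H)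
    (x : Smash k H R) :
    smashSect γ (Smash.inr k H R h * x) = Smash.inr k H E h * smashSect γ x := by
  induction x using Smash.induction with
  | zero => simp
  | add x y hx hy => simp only [map_add, mul_add, hx, hy]
  | mul r z =>
  obtain ⟨w, hw⟩ := TensorProduct.exists_finset (Coalgebra.comul (R := k) h)
  rw [← mul_assoc, Smash.inr_mul_inl, sweedler_sum _ _ _ _ _ _ _ hw, Smash.inl_mul_inr,
    smashSect_mk, ← mul_assoc, Smash.inr_mul_inl, sweedler_sum _ _ _ _ _ _ _ hw]
  simp only [Finset.sum_mul, map_sum]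
  refine Finset.sum_congr rfl fun p _ => ?_
  simp only [LinearMap.comp_apply, AlgHom.toLinearMap_apply, mul_assoc, ← map_mul,
    LinearMap.flip_apply, TensorProduct.mk_apply, act_tmul]
  rw [Smash.inl_mul_inr, smashSect_mk, hγ]

theorem smashSect_mul_inr (γ : R →ₗ[k] E) (h : H) (x : Smash k H R) :
    smashSect γ (x * Smash.inr k H R h) = smashSect γ x * Smash.inr k H E h := by
  induction x using Smash.induction with
  | zero => simp
  | add x y hx hy => simp only [map_add, add_mul, hx, hy]
  | mul r z =>
    rw [mul_assoc, ← map_mul, Smash.inl_mul_inr, Smash.inl_mul_inr, smashSect_mk, smashSect_mk,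
      mul_assoc, ← map_mul]

theorem smashSect_inr (γ : R →ₗ[k] E) (hγ : γ 1 = 1) (h : H) :
    smashSect γ (Smash.inr k H R h) = Smash.inr k H E h := by
  rw [Smash.inr_apply, smashSect_mk, hγ, map_one, one_mul]

theorem Psi_mem_CPrime (y : BraidedCleftClass k H R) : Psi k H R y ∈ CPrime k H R := by
  induction y using Quotient.inductionOn with
  | h P =>
  refine ⟨⟨P.smash, P.isCleft_smash, rfl⟩, P.smash, rfl, fun r h h' h'' => ?_⟩
  change smashSect P.sect (Smash.inr k H R h * Smash.mk k H r h' * Smash.inr k H R h'') =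
    smashSect P.sect (Smash.inr k H R h) * smashSect P.sect (Smash.mk k H r h') *
      smashSect P.sect (Smash.inr k H R h'')
  rw [smashSect_mul_inr, smashSect_inr_mul _ P.sect_linear, smashSect_inr _ P.sect_one,
    smashSect_inr _ P.sect_one]

/-- The identity of R is a section whose convolution inverse is the antipode of R, so the formula
for the inverse of γ ⊗ id with γ = id yields an antipode of R # H. -/
theorem exists_smash_antipode : ∃ S : Smash k H R →ₗ[k] Smash k H R,
    sweedler Coalgebra.comul LinearMap.id S =
      Algebra.linearMap k (Smash k H R) ∘ₗ Coalgebra.counit ∧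
    sweedler Coalgebra.comul S LinearMap.id =
      Algebra.linearMap k (Smash k H R) ∘ₗ Coalgebra.counit := by
  obtain ⟨S, -, -, h1, h2⟩ := YDHopfAlgebra.exists_antipode (k := k) (H := H) (R := R)
  have hid : smashSect (H := H) (LinearMap.id : R →ₗ[k] R) = LinearMap.id := by
    refine Smash.hom_ext fun r h => ?_
    rw [Smash.inl_mul_inr, smashSect_mk, Smash.inl_mul_inr]
    rfl
  have h3 := conv_smashSect_inv (H := H) LinearMap.id S h2
  have h4 := conv_inv_smashSect (H := H) LinearMap.id S h1
  rw [hid] at h3 h4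
  exact ⟨_, h3, h4⟩

end
end
end BraidedCleft

namespace BraidedCleft

noncomputable section

set_option linter.unusedSectionVars false

/-! ### Translations of a coalgebra by functionals. -/

section Translation

variable {k : Type*} [Field k] {C : Type*} [AddCommGroup C] [Module k C]

/-- For a comultiplication `Δ` on `C` and a functional `f`, the map `x ↦ f(x₁) x₂`. -/
def translate (Δ : C →ₗ[k] C ⊗[k] C) (f : C →ₗ[k] k) : C →ₗ[k] C :=
  (TensorProduct.lid k C).toLinearMap ∘ₗ f.rTensor C ∘ₗ Δ

theorem translate_sum {Δ : C →ₗ[k] C ⊗[k] C} (f : C →ₗ[k] k) (x : C) {ι : Type*} (s : Finset ι)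
    (a b : ι → C) (h : Δ x = ∑ i ∈ s, a i ⊗ₜ b i) : translate Δ f x = ∑ i ∈ s, f (a i) • b i := by
  simp [translate, h]

variable {Δ : C →ₗ[k] C ⊗[k] C} {e : C →ₗ[k] k}

/-- The counit recovers a functional from its translation, so identities in the convolution algebra
can be proved as identities between translations. -/
theorem comp_translate (hr : e.lTensor C ∘ₗ Δ = (TensorProduct.mk k C k).flip 1) (f : C →ₗ[k] k) :
    e ∘ₗ translate Δ f = f := by
  ext x
  obtain ⟨s, hs⟩ := TensorProduct.exists_finset (Δ x)
  have h1 := LinearMap.congr_fun hr x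
  rw [LinearMap.comp_apply, hs] at h1
  have h2 := congrArg (LinearMap.mul' k k ∘ₗ TensorProduct.map f LinearMap.id) h1
  rw [LinearMap.comp_apply, translate_sum f x s _ _ hs]
  simpa using h2

theorem translate_counit (hl : e.rTensor C ∘ₗ Δ = TensorProduct.mk k k C 1) :
    translate Δ e = LinearMap.id := by
  rw [translate, hl]
  ext x
  simp

theorem translate_comp (hΔ : (TensorProduct.assoc k C C C).toLinearMap ∘ₗ Δ.rTensor C ∘ₗ Δ =
    Δ.lTensor C ∘ₗ Δ) (f g : C →ₗ[k] k) :
    translate Δ f ∘ₗ translate Δ g = translate Δ (sweedler Δ g f) := by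
  ext x
  have h1 := congrArg ((TensorProduct.lid k C).toLinearMap ∘ₗ TensorProduct.map g
    ((TensorProduct.lid k C).toLinearMap ∘ₗ f.rTensor C)) (LinearMap.congr_fun hΔ x)
  refine Eq.trans ?_ (h1.symm.trans ?_)
  · simp only [translate, LinearMap.comp_apply]
    generalize Δ x = t
    induction t using TensorProduct.induction_on with
    | zero => simp
    | add x y hx hy => simp only [map_add, hx, hy]
    | tmul a b => simp
  · simp only [translate, LinearMap.comp_apply]
    generalize Δ x = t
    induction t using TensorProduct.induction_on with
    | zero => simp
    | add x y hx hy => simp only [map_add, hx, hy]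
    | tmul a b =>
      simp only [LinearMap.rTensor_tmul, sweedler, LinearMap.comp_apply]
      generalize Δ a = t
      induction t using TensorProduct.induction_on with
      | zero => simp
      | add x y hx hy => simp only [map_add, TensorProduct.add_tmul, hx, hy]
      | tmul a b => simp [smul_smul, mul_comm]

theorem comul_comp_translate (hΔ : (TensorProduct.assoc k C C C).toLinearMap ∘ₗ Δ.rTensor C ∘ₗ Δ =
    Δ.lTensor C ∘ₗ Δ) (f : C →ₗ[k] k) :
    Δ ∘ₗ translate Δ f = (translate Δ f).rTensor C ∘ₗ Δ := by
  ext x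
  have h1 := congrArg ((TensorProduct.lid k (C ⊗[k] C)).toLinearMap ∘ₗ f.rTensor (C ⊗[k] C))
    (LinearMap.congr_fun hΔ x)
  refine Eq.trans ?_ (h1.symm.trans ?_)
  · simp only [translate, LinearMap.comp_apply]
    generalize Δ x = t
    induction t using TensorProduct.induction_on with
    | zero => simp
    | add x y hx hy => simp only [map_add, hx, hy]
    | tmul a b => simp
  · simp only [translate, LinearMap.comp_apply]
    generalize Δ x = t
    induction t using TensorProduct.induction_on with
    | zero => simp
    | add x y hx hy => simp only [map_add, hx, hy]
    | tmul a b =>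
      simp only [LinearMap.rTensor_tmul, LinearMap.comp_apply]
      generalize Δ a = t
      induction t using TensorProduct.induction_on with
      | zero => simp
      | add x y hx hy => simp only [map_add, TensorProduct.add_tmul, hx, hy]
      | tmul a b => simp [TensorProduct.smul_tmul']

/-- A translation is an endomorphism of C as a right comodule, hence so is its inverse K; therefore
K is translation by e ∘ K, and this functional is the convolution inverse. The last clause later
serves to show that the inverse is H-linear. -/
theorem exists_conv_inverse (hΔ : (TensorProduct.assoc k C C C).toLinearMap ∘ₗ Δ.rTensor C ∘ₗ Δ =
    Δ.lTensor C ∘ₗ Δ) (hl : e.rTensor C ∘ₗ Δ = TensorProduct.mk k k C 1)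
    (hr : e.lTensor C ∘ₗ Δ = (TensorProduct.mk k C k).flip 1) (f : C →ₗ[k] k)
    (hf : Function.Bijective (translate Δ f)) :
    ∃ g : C →ₗ[k] k, sweedler Δ f g = e ∧ sweedler Δ g f = e ∧ g ∘ₗ translate Δ f = e := by
  let L := LinearEquiv.ofBijective _ hf
  let K : C →ₗ[k] C := L.symm.toLinearMap
  have hKL : K ∘ₗ translate Δ f = LinearMap.id := by
    ext x
    exact L.symm_apply_apply x
  have hLK : translate Δ f ∘ₗ K = LinearMap.id := by
    ext x
    exact L.apply_symm_apply x
  have hK : Δ ∘ₗ K = K.rTensor C ∘ₗ Δ := by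
    have h1 : K.rTensor C ∘ₗ (Δ ∘ₗ translate Δ f) ∘ₗ K = Δ ∘ₗ K := by
      rw [comul_comp_translate hΔ, LinearMap.comp_assoc, ← LinearMap.comp_assoc,
        ← LinearMap.rTensor_comp, hKL, LinearMap.rTensor_id, LinearMap.id_comp]
    rw [← h1, LinearMap.comp_assoc, hLK, LinearMap.comp_id]
  have hg : translate Δ (e ∘ₗ K) = K := by
    rw [translate, LinearMap.rTensor_comp, LinearMap.comp_assoc, ← hK,
      ← LinearMap.comp_assoc K Δ (e.rTensor C), hl]
    ext x
    simp
  refine ⟨e ∘ₗ K, ?_, ?_, by rw [LinearMap.comp_assoc, hKL, LinearMap.comp_id]⟩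
  · rw [← comp_translate hr (sweedler Δ f (e ∘ₗ K)), ← translate_comp hΔ, hg, hKL,
      LinearMap.comp_id]
  · rw [← comp_translate hr (sweedler Δ (e ∘ₗ K) f), ← translate_comp hΔ, hg, hLK,
      LinearMap.comp_id]

theorem translate_bijective (hΔ : (TensorProduct.assoc k C C C).toLinearMap ∘ₗ Δ.rTensor C ∘ₗ Δ =
    Δ.lTensor C ∘ₗ Δ) (hl : e.rTensor C ∘ₗ Δ = TensorProduct.mk k k C 1) (f g : C →ₗ[k] k)
    (h₁ : sweedler Δ f g = e) (h₂ : sweedler Δ g f = e) :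
    Function.Bijective (translate Δ f) := by
  refine Function.bijective_iff_has_inverse.2 ⟨translate Δ g, fun x => ?_, fun x => ?_⟩
  · have := LinearMap.congr_fun (translate_comp hΔ g f) x
    rwa [h₁, translate_counit hl] at this
  · have := LinearMap.congr_fun (translate_comp hΔ f g) x
    rwa [h₂, translate_counit hl] at this

end Translation

/-! ### Canonical maps x ⊗ c ↦ x f(c₁) ⊗ c₂ and convolution inverses. -/

section Canonical

variable {k : Type*} [Field k] {E C : Type*} [AddCommGroup E] [Module k E]
  [AddCommGroup C] [Module k C] [Coalgebra k C]

/-- The map `x ⊗ c ↦ x f(c₁) ⊗ c₂`. -/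
def canonicalMap (μ : E ⊗[k] E →ₗ[k] E) (f : C →ₗ[k] E) : E ⊗[k] C →ₗ[k] E ⊗[k] C :=
  (μ ∘ₗ f.lTensor E).rTensor C ∘ₗ (TensorProduct.assoc k E C C).symm.toLinearMap ∘ₗ
    (Coalgebra.comul (R := k) (A := C)).lTensor E

variable {μ : E ⊗[k] E →ₗ[k] E} {u : E}

/-- Canonical maps reverse convolution, so a convolution invertible f has a bijective canonical map.
-/
theorem canonicalMap_comp (hμ : ∀ x y z, μ (μ (x ⊗ₜ y) ⊗ₜ z) = μ (x ⊗ₜ μ (y ⊗ₜ z)))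
    (f g : C →ₗ[k] E) : canonicalMap μ f ∘ₗ canonicalMap μ g =
      canonicalMap μ (conv μ Coalgebra.comul g f) := by
  refine TensorProduct.ext' fun x c => ?_
  have h1 := congrArg ((TensorProduct.assoc k E E C).symm.toLinearMap ∘ₗ
    TensorProduct.map g (f.rTensor C)) (Coalgebra.coassoc_apply (R := k) c)
  have h2 := congrArg ((μ ∘ₗ TensorProduct.mk k E E x ∘ₗ μ).rTensor C) h1
  refine Eq.trans ?_ (h2.symm.trans ?_)
  · simp only [canonicalMap, LinearMap.comp_apply, LinearMap.lTensor_tmul]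
    generalize Coalgebra.comul (R := k) c = t
    induction t using TensorProduct.induction_on with
    | zero => simp
    | add x y hx hy => simp only [TensorProduct.tmul_add, map_add, hx, hy]
    | tmul a b =>
      simp only [LinearEquiv.coe_coe, TensorProduct.assoc_symm_tmul, LinearMap.rTensor_tmul,
        LinearMap.comp_apply, LinearMap.lTensor_tmul, TensorProduct.map_tmul]
      generalize Coalgebra.comul (R := k) b = t
      induction t using TensorProduct.induction_on with
      | zero => simp
      | add x y hx hy => simp only [TensorProduct.tmul_add, map_add, hx, hy]
      | tmul a b => simp [hμ]
  · simp only [canonicalMap, LinearMap.comp_apply, LinearMap.lTensor_tmul]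
    generalize Coalgebra.comul (R := k) c = t
    induction t using TensorProduct.induction_on with
    | zero => simp
    | add x y hx hy => simp only [TensorProduct.tmul_add, map_add, hx, hy]
    | tmul a b =>
      simp only [LinearEquiv.coe_coe, TensorProduct.assoc_symm_tmul, LinearMap.rTensor_tmul,
        LinearMap.comp_apply, LinearMap.lTensor_tmul, conv]
      generalize Coalgebra.comul (R := k) a = t
      induction t using TensorProduct.induction_on with
      | zero => simp
      | add x y hx hy => simp only [TensorProduct.tmul_add, TensorProduct.add_tmul, map_add, hx, hy]
      | tmul a b => simp

theorem canonicalMap_unit (hu : ∀ x, μ (x ⊗ₜ u) = x) :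
    canonicalMap μ (LinearMap.toSpanSingleton k E u ∘ₗ Coalgebra.counit (R := k) (A := C)) =
      LinearMap.id := by
  refine TensorProduct.ext' fun x c => ?_
  have h1 := Coalgebra.rTensor_counit_comul (R := k) c
  have h2 := congrArg (TensorProduct.map (LinearMap.toSpanSingleton k E x)
    (LinearMap.id (R := k) (M := C))) h1
  simp only [canonicalMap, LinearMap.comp_apply, LinearMap.lTensor_tmul]
  refine Eq.trans ?_ (h2.trans (by simp))
  generalize Coalgebra.comul (R := k) c = t
  induction t using TensorProduct.induction_on with
  | zero => simp
  | add x y hx hy => simp only [TensorProduct.tmul_add, map_add, hx, hy]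
  | tmul a b => simp [hu]

theorem canonicalMap_bijective (hμ : ∀ x y z, μ (μ (x ⊗ₜ y) ⊗ₜ z) = μ (x ⊗ₜ μ (y ⊗ₜ z)))
    (hu : ∀ x, μ (x ⊗ₜ u) = x) (f g : C →ₗ[k] E)
    (h₁ : conv μ Coalgebra.comul f g = LinearMap.toSpanSingleton k E u ∘ₗ Coalgebra.counit)
    (h₂ : conv μ Coalgebra.comul g f = LinearMap.toSpanSingleton k E u ∘ₗ Coalgebra.counit) :
    Function.Bijective (canonicalMap μ f) := by
  refine Function.bijective_iff_has_inverse.2 ⟨canonicalMap μ g, fun x => ?_, fun x => ?_⟩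
  · have := LinearMap.congr_fun (canonicalMap_comp hμ g f) x
    rwa [h₁, canonicalMap_unit hu] at this
  · have := LinearMap.congr_fun (canonicalMap_comp hμ f g) x
    rwa [h₂, canonicalMap_unit hu] at this

theorem counit_canonicalMap (f : C →ₗ[k] E) (t : E ⊗[k] C) :
    TensorProduct.rid k E ((Coalgebra.counit (R := k) (A := C)).lTensor E (canonicalMap μ f t)) =
      μ (f.lTensor E t) := by
  induction t using TensorProduct.induction_on with
  | zero => simp
  | add x y hx hy => simp only [map_add, hx, hy]
  | tmul x c =>
    have h1 := Coalgebra.lTensor_counit_comul (R := k) c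
    have h2 := congrArg (TensorProduct.rid k E) (congrArg (TensorProduct.map
      (μ ∘ₗ TensorProduct.mk k E E x ∘ₗ f) (LinearMap.id (R := k) (M := k))) h1)
    refine Eq.trans ?_ (h2.trans (by simp))
    simp only [canonicalMap, LinearMap.comp_apply, LinearMap.lTensor_tmul]
    generalize Coalgebra.comul (R := k) c = t
    induction t using TensorProduct.induction_on with
    | zero => simp
    | add x y hx hy => simp only [TensorProduct.tmul_add, map_add, hx, hy]
    | tmul a b => simp

theorem comul_canonicalMap (f : C →ₗ[k] E) :
    (Coalgebra.comul (R := k) (A := C)).lTensor E ∘ₗ canonicalMap μ f =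
      (TensorProduct.assoc k E C C).toLinearMap ∘ₗ (canonicalMap μ f).rTensor C ∘ₗ
        (TensorProduct.assoc k E C C).symm.toLinearMap ∘ₗ
          (Coalgebra.comul (R := k) (A := C)).lTensor E := by
  refine TensorProduct.ext' fun x c => ?_
  have h1 := congrArg ((μ ∘ₗ TensorProduct.mk k E E x ∘ₗ f).rTensor (C ⊗[k] C))
    (Coalgebra.coassoc_apply (R := k) c)
  refine Eq.trans ?_ (h1.symm.trans ?_)
  · simp only [canonicalMap, LinearMap.comp_apply, LinearMap.lTensor_tmul]
    generalize Coalgebra.comul (R := k) c = t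
    induction t using TensorProduct.induction_on with
    | zero => simp
    | add x y hx hy => simp only [TensorProduct.tmul_add, map_add, hx, hy]
    | tmul a b => simp
  · simp only [LinearMap.comp_apply, LinearMap.lTensor_tmul]
    generalize Coalgebra.comul (R := k) c = t
    induction t using TensorProduct.induction_on with
    | zero => simp
    | add x y hx hy => simp only [TensorProduct.tmul_add, map_add, hx, hy]
    | tmul a b =>
      simp only [LinearEquiv.coe_coe, TensorProduct.assoc_symm_tmul, LinearMap.rTensor_tmul,
        LinearMap.comp_apply, LinearMap.lTensor_tmul, canonicalMap]
      generalize Coalgebra.comul (R := k) a = t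
      induction t using TensorProduct.induction_on with
      | zero => simp
      | add x y hx hy => simp only [TensorProduct.tmul_add, TensorProduct.add_tmul, map_add, hx, hy]
      | tmul a b => simp

/-- The inverse K of the canonical map is colinear for the right factor C, so K(u ⊗ c) = g(c₁) ⊗ c₂
with g = (id ⊗ ε) K(u ⊗ -). Applying id ⊗ ε to the canonical map of K(u ⊗ c) gives g * f = 1. Hence
the canonical map of g is a right inverse of that of f, so it equals K, and f * g = 1 follows. The
last clause computes g from any preimage of u ⊗ c, which later gives H-linearity of g. -/
theorem exists_conv_inverse_of_canonicalMap
    (hμ : ∀ x y z, μ (μ (x ⊗ₜ y) ⊗ₜ z) = μ (x ⊗ₜ μ (y ⊗ₜ z)))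
    (hu : ∀ x, μ (x ⊗ₜ u) = x) (hu' : ∀ x, μ (u ⊗ₜ x) = x) (f : C →ₗ[k] E)
    (hf : Function.Bijective (canonicalMap μ f)) :
    ∃ g : C →ₗ[k] E,
      conv μ Coalgebra.comul f g = LinearMap.toSpanSingleton k E u ∘ₗ Coalgebra.counit ∧
      conv μ Coalgebra.comul g f = LinearMap.toSpanSingleton k E u ∘ₗ Coalgebra.counit ∧
      ∀ t c, canonicalMap μ f t = u ⊗ₜ c →
        g c = TensorProduct.rid k E ((Coalgebra.counit (R := k) (A := C)).lTensor E t) := by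
  let L := LinearEquiv.ofBijective _ hf
  let K : E ⊗[k] C →ₗ[k] E ⊗[k] C := L.symm.toLinearMap
  have hKL : K ∘ₗ canonicalMap μ f = LinearMap.id := by
    ext x
    exact L.symm_apply_apply _
  have hLK : canonicalMap μ f ∘ₗ K = LinearMap.id := by
    refine LinearMap.ext fun x => ?_
    exact L.apply_symm_apply x
  have hK : (Coalgebra.comul (R := k) (A := C)).lTensor E ∘ₗ K =
      (TensorProduct.assoc k E C C).toLinearMap ∘ₗ K.rTensor C ∘ₗ
        (TensorProduct.assoc k E C C).symm.toLinearMap ∘ₗ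
          (Coalgebra.comul (R := k) (A := C)).lTensor E := by
    have h1 := congrArg (fun F => (TensorProduct.assoc k E C C).toLinearMap ∘ₗ K.rTensor C ∘ₗ
      (TensorProduct.assoc k E C C).symm.toLinearMap ∘ₗ F ∘ₗ K) (comul_canonicalMap (μ := μ) f)
    refine LinearMap.ext fun x => ?_
    have h2 := LinearMap.congr_fun h1 x
    have h3 := LinearMap.congr_fun hLK x
    have h4 : ∀ y, K.rTensor C ((canonicalMap μ f).rTensor C y) = y := fun y => by
      rw [← LinearMap.comp_apply, ← LinearMap.rTensor_comp, hKL]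
      simp
    simp only [LinearMap.comp_apply, LinearEquiv.coe_coe, LinearEquiv.symm_apply_apply, h4,
      LinearEquiv.apply_symm_apply, LinearMap.id_apply] at h2 h3 ⊢
    rw [h3] at h2
    exact h2.symm
  let ε : E ⊗[k] C →ₗ[k] E :=
    (TensorProduct.rid k E).toLinearMap ∘ₗ (Coalgebra.counit (R := k) (A := C)).lTensor E
  let g : C →ₗ[k] E := ε ∘ₗ K ∘ₗ TensorProduct.mk k E C u
  have hU : ∀ c, K (u ⊗ₜ c) = g.rTensor C (Coalgebra.comul c) := by
    intro c
    have h1 := congrArg (ε.rTensor C ∘ₗ (TensorProduct.assoc k E C C).symm.toLinearMap)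
      (LinearMap.congr_fun hK (u ⊗ₜ c))
    refine Eq.trans ?_ (h1.trans ?_)
    · simp only [LinearMap.comp_apply]
      generalize K (u ⊗ₜ[k] c) = t
      induction t using TensorProduct.induction_on with
      | zero => simp
      | add x y hx hy => simp only [map_add, ← hx, ← hy]
      | tmul x c =>
        have h2 := congrArg (TensorProduct.map (LinearMap.toSpanSingleton k E x)
          (LinearMap.id (R := k) (M := C))) (Coalgebra.rTensor_counit_comul (R := k) c)
        simp only [TensorProduct.map_tmul, LinearMap.toSpanSingleton_apply, one_smul,
          LinearMap.id_apply] at h2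
        refine h2.symm.trans ?_
        rw [LinearMap.lTensor_tmul]
        generalize Coalgebra.comul (R := k) c = t
        induction t using TensorProduct.induction_on with
        | zero => simp
        | add x y hx hy => simp only [TensorProduct.tmul_add, map_add, hx, hy]
        | tmul a b => simp [ε]
    · simp only [LinearMap.comp_apply, LinearMap.lTensor_tmul]
      generalize Coalgebra.comul (R := k) c = t
      induction t using TensorProduct.induction_on with
      | zero => simp
      | add x y hx hy => simp only [TensorProduct.tmul_add, map_add, hx, hy]
      | tmul a b => simp [g]
  have hgf : conv μ Coalgebra.comul g f =
      LinearMap.toSpanSingleton k E u ∘ₗ Coalgebra.counit := by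
    ext c
    have h1 := counit_canonicalMap (μ := μ) f (K (u ⊗ₜ c))
    rw [show canonicalMap μ f (K (u ⊗ₜ c)) = u ⊗ₜ c from LinearMap.congr_fun hLK _, hU,
      ← LinearMap.comp_apply (LinearMap.lTensor E f), LinearMap.lTensor_comp_rTensor] at h1
    refine h1.symm.trans ?_
    simp
  refine ⟨g, ?_, hgf, fun t c ht => ?_⟩
  · have h1 : canonicalMap μ g = K := by
      have h2 := canonicalMap_comp hμ f g
      rw [hgf, canonicalMap_unit hu] at h2
      rw [← LinearMap.id_comp (canonicalMap μ g), ← hKL, LinearMap.comp_assoc, h2,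
        LinearMap.comp_id]
    have h3 := canonicalMap_comp hμ g f
    rw [h1, hKL] at h3
    ext c
    have h4 := counit_canonicalMap (μ := μ) (conv μ Coalgebra.comul f g) (u ⊗ₜ c)
    rw [← h3, LinearMap.lTensor_tmul, hu'] at h4
    refine h4.symm.trans ?_
    simp
  · have : K (canonicalMap μ f t) = t := LinearMap.congr_fun hKL t
    rw [ht] at this
    change ε (K (u ⊗ₜ c)) = _
    rw [this]
    rfl

end Canonical

end
end BraidedCleft

/-! ### Cleft objects with trivial coinvariants are twisted products. -/

namespace BraidedCleft

noncomputable section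

set_option linter.unusedSectionVars false

section CleftExtension

variable {k : Type v} [Field k] {A : Type u} [Ring A] [Bialgebra k A]
  {B : Type u} [Ring B] [Algebra k B]

/-- With p(x) = x₀ g(x₁), which is coinvariant and hence scalar, one has x = p(x₀) γ(x₁), so γ is
surjective. For injectivity, 1 ⊗ a is recovered from ρ(γ(a)) = γ(a₁) ⊗ a₂ by multiplying with g. -/
theorem sect_bijective (ρ : B →ₐ[k] B ⊗[k] A)
    (hassoc : (TensorProduct.assoc k B A A).toLinearMap ∘ₗ ρ.toLinearMap.rTensor A ∘ₗ
      ρ.toLinearMap = (Coalgebra.comul (R := k) (A := A)).lTensor B ∘ₗ ρ.toLinearMap)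
    (hcounit : (Coalgebra.counit (R := k) (A := A)).lTensor B ∘ₗ ρ.toLinearMap =
      (TensorProduct.mk k B k).flip 1)
    (hne : (1 : B) ≠ 0) (hco : ∀ x, ρ x = x ⊗ₜ[k] 1 → ∃ c : k, x = c • (1 : B))
    (γ g : A →ₗ[k] B)
    (hγ : ρ.toLinearMap ∘ₗ γ = γ.rTensor A ∘ₗ Coalgebra.comul)
    (h₁ : sweedler Coalgebra.comul γ g = Algebra.linearMap k B ∘ₗ Coalgebra.counit)
    (h₂ : sweedler Coalgebra.comul g γ = Algebra.linearMap k B ∘ₗ Coalgebra.counit) :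
    Function.Bijective γ := by
  -- A functional with ℓ(1) = 1, used to read off the scalar of a multiple of 1.
  obtain ⟨ℓ, hℓ⟩ := LinearMap.exists_leftInverse_of_injective (LinearMap.toSpanSingleton k B 1)
    (LinearMap.ker_toSpanSingleton k hne)
  have hℓ1 : ℓ 1 = 1 := by simpa using LinearMap.congr_fun hℓ 1
  let iB : B →ₐ[k] B ⊗[k] A := Algebra.TensorProduct.includeLeft
  let iA : A →ₐ[k] B ⊗[k] A := Algebra.TensorProduct.includeRight
  have hlin : ∀ F : B →ₐ[k] B ⊗[k] A, F.toLinearMap ∘ₗ Algebra.linearMap k B ∘ₗ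
      Coalgebra.counit (R := k) (A := A) =
      Algebra.linearMap k (B ⊗[k] A) ∘ₗ Coalgebra.counit := fun F => by
    ext a
    simp
  have hcl : ∀ f : A →ₗ[k] B ⊗[k] A, sweedler Coalgebra.comul
      (Algebra.linearMap k (B ⊗[k] A) ∘ₗ Coalgebra.counit) f = f :=
    sweedler_counit_left Coalgebra.rTensor_counit_comp_comul
  have hcr : ∀ f : A →ₗ[k] B ⊗[k] A, sweedler Coalgebra.comul f
      (Algebra.linearMap k (B ⊗[k] A) ∘ₗ Coalgebra.counit) = f :=
    sweedler_counit_right Coalgebra.lTensor_counit_comp_comul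
  have hργ : ρ.toLinearMap ∘ₗ γ =
      sweedler Coalgebra.comul (iB.toLinearMap ∘ₗ γ) iA.toLinearMap := by
    rw [hγ]
    ext a
    simp only [sweedler, LinearMap.comp_apply]
    generalize Coalgebra.comul (R := k) a = t
    induction t using TensorProduct.induction_on with
    | zero => simp
    | add x y hx hy => simp only [map_add, hx, hy]
    | tmul a b => simp [iA, iB]
  have hd : sweedler Coalgebra.comul (iB.toLinearMap ∘ₗ g) (ρ.toLinearMap ∘ₗ γ) =
      iA.toLinearMap := by
    rw [hργ, ← sweedler_assoc Coalgebra.coassoc, ← comp_sweedler, h₂, hlin, hcl]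
  -- A is only a bialgebra, so ρ(g(a)) is not expressed through an antipode; the relation (1 ⊗ a₁)
  -- ρ(g(a₂)) = g(a) ⊗ 1 is all that coinvariance of p requires.
  have he : sweedler Coalgebra.comul iA.toLinearMap (ρ.toLinearMap ∘ₗ g) =
      iB.toLinearMap ∘ₗ g := by
    rw [← hd, sweedler_assoc Coalgebra.coassoc, ← comp_sweedler, h₁, hlin, hcr]
  let p : B →ₗ[k] B := sweedler ρ.toLinearMap LinearMap.id g
  have hp : ρ.toLinearMap ∘ₗ p = iB.toLinearMap ∘ₗ p := by
    have h3 : sweedler ρ.toLinearMap iB.toLinearMap iA.toLinearMap = ρ.toLinearMap :=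
      sweedler_include _
    have h4 : ρ.toLinearMap ∘ₗ p = sweedler ρ.toLinearMap
        (sweedler ρ.toLinearMap iB.toLinearMap iA.toLinearMap) (ρ.toLinearMap ∘ₗ g) := by
      rw [h3, comp_sweedler, LinearMap.comp_id]
    rw [h4, sweedler_assoc hassoc, he, comp_sweedler, LinearMap.comp_id]
  have hpφ : ∀ x, p x = ℓ (p x) • (1 : B) := fun x => by
    obtain ⟨c, hc⟩ := hco _ (LinearMap.congr_fun hp x)
    rw [hc, map_smul, hℓ1, smul_eq_mul, mul_one]
  have hpγ : sweedler ρ.toLinearMap p γ = LinearMap.id := by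
    rw [sweedler_assoc hassoc, h₂]
    exact sweedler_counit_right hcounit _
  refine ⟨?_, fun x => ?_⟩
  · rw [injective_iff_map_eq_zero]
    intro a ha
    have h3 := canonicalMap_comp (μ := LinearMap.mul' k B) (fun x y z => by simp [mul_assoc]) g γ
    rw [show conv (LinearMap.mul' k B) Coalgebra.comul γ g = _ from h₁,
      show Algebra.linearMap k B = LinearMap.toSpanSingleton k B 1 from
        linearMap_eq_toSpanSingleton B, canonicalMap_unit (by simp)] at h3
    have h4 : canonicalMap (LinearMap.mul' k B) γ (1 ⊗ₜ a) =
        γ.rTensor A (Coalgebra.comul a) := by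
      rw [canonicalMap, LinearMap.comp_apply, LinearMap.comp_apply, LinearMap.lTensor_tmul]
      generalize Coalgebra.comul (R := k) a = t
      induction t using TensorProduct.induction_on with
      | zero => simp
      | add x y hx hy => simp only [TensorProduct.tmul_add, map_add, hx, hy]
      | tmul a b => simp
    have h5 := LinearMap.congr_fun h3 (1 ⊗ₜ a)
    rw [LinearMap.comp_apply, h4, ← LinearMap.comp_apply (LinearMap.rTensor A γ), ← hγ,
      LinearMap.comp_apply, ha, map_zero, map_zero] at h5
    have h6 := congrArg ((TensorProduct.lid k A).toLinearMap ∘ₗ ℓ.rTensor A) h5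
    simpa [hℓ1] using h6.symm
  · refine ⟨TensorProduct.lid k A ((ℓ ∘ₗ p).rTensor A (ρ x)), ?_⟩
    have h3 := LinearMap.congr_fun hpγ x
    refine Eq.trans ?_ h3
    simp only [sweedler, LinearMap.comp_apply, AlgHom.toLinearMap_apply]
    generalize ρ x = t
    induction t using TensorProduct.induction_on with
    | zero => simp
    | add x y hx hy => simp only [map_add, hx, hy]
    | tmul a b =>
      simp only [LinearMap.rTensor_tmul, LinearMap.comp_apply, TensorProduct.lid_tmul, map_smul,
        TensorProduct.map_tmul, LinearMap.mul'_apply]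
      rw [hpφ a]
      simp [hℓ1]

/-- The multiplication `x ⊗ y ↦ σ(x₁ ⊗ y₁) x₂ y₂` twisted by a form `σ`. -/
def crossedMul (σ : A ⊗[k] A →ₗ[k] k) : A ⊗[k] A →ₗ[k] A :=
  LinearMap.mul' k A ∘ₗ translate Coalgebra.comul σ

/-- Writing the twisted product as a translation followed by the ordinary product makes the
translation lemmas applicable to it. -/
theorem crossedPair_mul (σ : A ⊗[k] A →ₗ[k] k) : (crossedPair σ).mul = crossedMul σ := by
  have h : ∀ t : (A ⊗[k] A) ⊗[k] (A ⊗[k] A),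
      TensorProduct.lid k A (TensorProduct.map σ (LinearMap.mul' k A) t) =
      LinearMap.mul' k A (TensorProduct.lid k (A ⊗[k] A) (σ.rTensor _ t)) := by
    intro t
    induction t using TensorProduct.induction_on with
    | zero => simp
    | add x y hx hy => simp only [map_add, hx, hy]
    | tmul a b => simp
  have h' : ∀ x : A ⊗[k] A, (crossedPair σ).mul x = crossedMul σ x := fun x => h _
  exact LinearMap.ext h'

/-- The ring structure underlying a cleft object. -/
abbrev IsCleftObjectPair.ring {P : PrePair k A} (hP : IsCleftObjectPair P) : Ring P.carrier :=
  { P.addCommGroup with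
    mul := fun x y => P.mul (x ⊗ₜ y)
    one := P.one
    mul_assoc := hP.mul_assoc
    one_mul := hP.one_mul
    mul_one := hP.mul_one
    left_distrib := fun x y z => by
      change P.mul (x ⊗ₜ (y + z)) = P.mul _ + P.mul _
      rw [TensorProduct.tmul_add, map_add]
    right_distrib := fun x y z => by
      change P.mul ((x + y) ⊗ₜ z) = P.mul _ + P.mul _
      rw [TensorProduct.add_tmul, map_add]
    zero_mul := fun x => by
      change P.mul (0 ⊗ₜ x) = 0
      rw [TensorProduct.zero_tmul, map_zero]
    mul_zero := fun x => by
      change P.mul (x ⊗ₜ 0) = 0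
      rw [TensorProduct.tmul_zero, map_zero] }

/-- The algebra structure underlying a cleft object. -/
abbrev IsCleftObjectPair.algebra {P : PrePair k A} (hP : IsCleftObjectPair P) :
    letI := hP.ring
    Algebra k P.carrier :=
  letI := hP.ring
  Algebra.ofModule
    (fun c x y => by
      change P.mul ((c • x) ⊗ₜ y) = c • P.mul _
      rw [← TensorProduct.smul_tmul', map_smul])
    (fun c x y => by
      change P.mul (x ⊗ₜ (c • y)) = c • P.mul _
      rw [TensorProduct.tmul_smul, map_smul])

theorem IsCleftObjectPair.sect_bijective {P : PrePair k A} (hP : IsCleftObjectPair P) :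
    Function.Bijective P.sect := by
  let := hP.ring
  let := hP.algebra
  have hmul : LinearMap.mul' k P.carrier = P.mul := TensorProduct.ext' fun x y => rfl
  obtain ⟨g, h1, h2⟩ := hP.sect_invertible
  have hlin : Algebra.linearMap k P.carrier = LinearMap.toSpanSingleton k P.carrier P.one :=
    linearMap_eq_toSpanSingleton _
  refine BraidedCleft.sect_bijective
    (AlgHom.ofLinearMap P.coact hP.coact_one fun x y => ?_) hP.coact_coassoc hP.coact_counit
    hP.one_ne_zero hP.coinvariants P.sect g hP.sect_colinear ?_ ?_
  · rw [tensor_mul_eq, hmul]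
    exact hP.coact_mul x y
  · rw [hlin, sweedler, hmul]
    exact h1
  · rw [hlin, sweedler, hmul]
    exact h2

/-- Transport along the bijection γ turns the coaction into Δ, the section into id, and the product
into some M with Δ ∘ M = (M ⊗ μ) ∘ Δ. Applying ε to the first leg gives M(x ⊗ y) = ε(M(x₁ ⊗ y₁))
x₂y₂, whence σ = ε ∘ M. -/
theorem IsCleftObjectPair.exists_crossed {P : PrePair k A} (hP : IsCleftObjectPair P) :
    ∃ σ : A ⊗[k] A →ₗ[k] k, (crossedPair σ).IsIso P ∧
      (∀ x y z, crossedMul σ (crossedMul σ (x ⊗ₜ y) ⊗ₜ z) =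
        crossedMul σ (x ⊗ₜ crossedMul σ (y ⊗ₜ z))) ∧
      (∀ x, crossedMul σ (1 ⊗ₜ x) = x) ∧ (∀ x, crossedMul σ (x ⊗ₜ 1) = x) ∧
      ∃ g : A →ₗ[k] A, conv (crossedMul σ) Coalgebra.comul LinearMap.id g =
        LinearMap.toSpanSingleton k A 1 ∘ₗ Coalgebra.counit ∧
        conv (crossedMul σ) Coalgebra.comul g LinearMap.id =
        LinearMap.toSpanSingleton k A 1 ∘ₗ Coalgebra.counit := by
  let f : A ≃ₗ[k] P.carrier := LinearEquiv.ofBijective P.sect hP.sect_bijective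
  have hf : ∀ a, f a = P.sect a := fun _ => rfl
  let K : P.carrier →ₗ[k] A := f.symm.toLinearMap
  have hKf : ∀ a, K (P.sect a) = a := fun a => f.symm_apply_apply a
  have hfK : ∀ x, P.sect (K x) = x := fun x => f.apply_symm_apply x
  have hK : ∀ x, Coalgebra.comul (K x) = K.rTensor A (P.coact x) := fun x => by
    have h1 := LinearMap.congr_fun hP.sect_colinear (K x)
    rw [LinearMap.comp_apply, hfK] at h1
    rw [h1, LinearMap.comp_apply, ← LinearMap.comp_apply (LinearMap.rTensor A K),
      ← LinearMap.rTensor_comp, show K ∘ₗ P.sect = LinearMap.id from LinearMap.ext hKf]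
    simp
  let M : A ⊗[k] A →ₗ[k] A := K ∘ₗ P.mul ∘ₗ TensorProduct.map P.sect P.sect
  have hM : ∀ w, Coalgebra.comul (M w) =
      TensorProduct.map M (LinearMap.mul' k A) (Coalgebra.comul w) := by
    intro w
    induction w using TensorProduct.induction_on with
    | zero => simp
    | add x y hx hy => simp only [map_add, hx, hy]
    | tmul x y =>
      have h1 := LinearMap.congr_fun hP.sect_colinear x
      have h2 := LinearMap.congr_fun hP.sect_colinear y
      rw [LinearMap.comp_apply, LinearMap.comp_apply] at h1 h2
      simp only [M, LinearMap.comp_apply, TensorProduct.map_tmul]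
      rw [hK, hP.coact_mul, h1, h2, TensorProduct.comul_tmul]
      generalize Coalgebra.comul (R := k) x = t
      generalize Coalgebra.comul (R := k) y = u
      induction t using TensorProduct.induction_on with
      | zero => simp
      | add x y hx hy => simp only [TensorProduct.add_tmul, map_add, hx, hy]
      | tmul a b =>
      induction u using TensorProduct.induction_on with
      | zero => simp
      | add x y hx hy => simp only [TensorProduct.tmul_add, map_add, hx, hy]
      | tmul a b => simp
  have hMσ : crossedMul (Coalgebra.counit (R := k) (A := A) ∘ₗ M) = M := by
    ext1
    ext x y
    have h1 := congrArg (TensorProduct.lid k A) (Coalgebra.rTensor_counit_comul (R := k)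
      (M (x ⊗ₜ y)))
    rw [hM, TensorProduct.lid_tmul, one_smul] at h1
    refine Eq.trans ?_ h1
    simp only [crossedMul, translate, LinearMap.comp_apply,
      TensorProduct.AlgebraTensorModule.curry_apply,
      LinearMap.restrictScalars_self, TensorProduct.curry_apply]
    generalize Coalgebra.comul (R := k) (x ⊗ₜ[k] y) = t
    induction t using TensorProduct.induction_on with
    | zero => simp
    | add x y hx hy => simp only [map_add, hx, hy]
    | tmul a b => simp
  have hMt : ∀ x y, M (x ⊗ₜ y) = K (P.mul (P.sect x ⊗ₜ P.sect y)) := fun _ _ => rfl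
  have hone : K P.one = 1 := by rw [← hP.sect_one, hKf]
  refine ⟨Coalgebra.counit ∘ₗ M, ⟨f, fun x y => ?_, hP.sect_one, fun x => ?_, fun a => rfl⟩, ?_⟩
  · rw [crossedPair_mul]
    refine (congrArg f (LinearMap.congr_fun hMσ _)).trans ?_
    exact hfK _
  · exact LinearMap.congr_fun hP.sect_colinear x
  · rw [hMσ]
    refine ⟨fun x y z => ?_, fun x => ?_, fun x => ?_, ?_⟩
    · rw [hMt, hMt x y, hMt x, hMt y z, hfK, hfK, hP.mul_assoc]
    · rw [hMt, hP.sect_one, hP.one_mul, hKf]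
    · rw [hMt, hP.sect_one, hP.mul_one, hKf]
    · obtain ⟨g, h1, h2⟩ := hP.sect_invertible
      have h3 : LinearMap.toSpanSingleton k A 1 ∘ₗ Coalgebra.counit (R := k) (A := A) =
          K ∘ₗ LinearMap.toSpanSingleton k P.carrier P.one ∘ₗ Coalgebra.counit := by
        ext a
        simp [hone]
      refine ⟨K ∘ₗ g, ?_, ?_⟩
      · rw [h3, ← h1]
        ext a
        simp only [conv, LinearMap.comp_apply]
        generalize Coalgebra.comul (R := k) a = t
        induction t using TensorProduct.induction_on with
        | zero => simp
        | add x y hx hy => simp only [map_add, hx, hy]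
        | tmul a b => simp [hMt, hfK]
      · rw [h3, ← h2]
        ext a
        simp only [conv, LinearMap.comp_apply]
        generalize Coalgebra.comul (R := k) a = t
        induction t using TensorProduct.induction_on with
        | zero => simp
        | add x y hx hy => simp only [map_add, hx, hy]
        | tmul a b => simp [hMt, hfK]

end CleftExtension

end
end BraidedCleft

/-! ### Maps on (R # H) ⊗ (R # H) that are balanced over H. -/

namespace BraidedCleft

noncomputable section

set_option linter.unusedSectionVars false

section ModuleCoalgebra

variable {k : Type*} [Field k] {C B M N : Type*} [AddCommGroup C] [Module k C] [Coalgebra k C]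
  [Ring B] [Bialgebra k B] [AddCommGroup M] [Module k M] [AddCommGroup N] [Module k N]
  {j j' : C →ₗ[k] B}
  {F : B →ₗ[k] M} {G : B →ₗ[k] N}

theorem comul_mul_image
    (hj : Coalgebra.comul ∘ₗ j = TensorProduct.map j j ∘ₗ Coalgebra.comul)
    {ι ι' : Type*} {b : B} {c : C} {s : Finset ι} {x y : ι → B}
    {s' : Finset ι'} {x' y' : ι' → C} (h : Coalgebra.comul (R := k) b = ∑ i ∈ s, x i ⊗ₜ y i)
    (h' : Coalgebra.comul (R := k) c = ∑ i ∈ s', x' i ⊗ₜ y' i) :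
    Coalgebra.comul (R := k) (b * j c) =
      ∑ i ∈ s, ∑ l ∈ s', (x i * j (x' l)) ⊗ₜ (y i * j (y' l)) := by
  have h1 := LinearMap.congr_fun hj c
  rw [LinearMap.comp_apply, LinearMap.comp_apply, h'] at h1
  rw [Bialgebra.comul_mul, h1, h, Finset.sum_comm]
  simp [Finset.sum_mul, Finset.mul_sum]

theorem comul_image_mul
    (hj : Coalgebra.comul ∘ₗ j = TensorProduct.map j j ∘ₗ Coalgebra.comul)
    {ι ι' : Type*} {b : B} {c : C} {s : Finset ι} {x y : ι → B}
    {s' : Finset ι'} {x' y' : ι' → C} (h : Coalgebra.comul (R := k) b = ∑ i ∈ s, x i ⊗ₜ y i)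
    (h' : Coalgebra.comul (R := k) c = ∑ i ∈ s', x' i ⊗ₜ y' i) :
    Coalgebra.comul (R := k) (j c * b) =
      ∑ i ∈ s, ∑ l ∈ s', (j (x' l) * x i) ⊗ₜ (j (y' l) * y i) := by
  have h1 := LinearMap.congr_fun hj c
  rw [LinearMap.comp_apply, LinearMap.comp_apply, h'] at h1
  rw [Bialgebra.comul_mul, h1, h]
  simp [Finset.sum_mul, Finset.mul_sum]

theorem sum_counit_smul_eq {c : C} {ι : Type*} {s : Finset ι} {x y : ι → C}
    (h : Coalgebra.comul (R := k) c = ∑ i ∈ s, x i ⊗ₜ y i) :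
    ∑ i ∈ s, Coalgebra.counit (R := k) (x i) • y i = c := by
  have h1 := congrArg (TensorProduct.lid k C) (Coalgebra.rTensor_counit_comul (R := k) c)
  rw [h] at h1
  simpa using h1

/-- As `j` and `j'` are coalgebra maps, Δ carries c₁ and c₂ to the two legs, and the balancing rule
applies in each leg separately. -/
theorem map_comul_balanced
    (hj : Coalgebra.comul ∘ₗ j = TensorProduct.map j j ∘ₗ Coalgebra.comul)
    (hj' : Coalgebra.comul ∘ₗ j' = TensorProduct.map j' j' ∘ₗ Coalgebra.comul)
    (hF : ∀ b c, F (b * j c) = F (j' c * b))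
    (hG : ∀ b c, G (b * j c) = G (j' c * b)) (b : B) (c : C) :
    TensorProduct.map F G (Coalgebra.comul (b * j c)) =
      TensorProduct.map F G (Coalgebra.comul (j' c * b)) := by
  obtain ⟨s, hs⟩ := TensorProduct.exists_finset (Coalgebra.comul (R := k) b)
  obtain ⟨t, ht⟩ := TensorProduct.exists_finset (Coalgebra.comul (R := k) c)
  rw [comul_mul_image hj hs ht, comul_image_mul hj' hs ht]
  simp [hF, hG]

/-- The first leg absorbs c₁ into ε(c₁), so all of c acts on the second leg. -/
theorem map_comul_mul_image
    (hj : Coalgebra.comul ∘ₗ j = TensorProduct.map j j ∘ₗ Coalgebra.comul)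
    (θ : C →ₗ[k] N →ₗ[k] N)
    (hF : ∀ b c, F (b * j c) = Coalgebra.counit (R := k) c • F b)
    (hG : ∀ b c, G (b * j c) = θ c (G b)) (b : B) (c : C) :
    TensorProduct.map F G (Coalgebra.comul (b * j c)) =
      (θ c).lTensor M (TensorProduct.map F G (Coalgebra.comul b)) := by
  obtain ⟨s, hs⟩ := TensorProduct.exists_finset (Coalgebra.comul (R := k) b)
  obtain ⟨t, ht⟩ := TensorProduct.exists_finset (Coalgebra.comul (R := k) c)
  rw [comul_mul_image hj hs ht, hs]
  conv_rhs => rw [← sum_counit_smul_eq ht]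
  simp [hF, hG, TensorProduct.smul_tmul, TensorProduct.tmul_sum]

theorem map_comul_image_mul
    (hj : Coalgebra.comul ∘ₗ j = TensorProduct.map j j ∘ₗ Coalgebra.comul)
    (θ : C →ₗ[k] N →ₗ[k] N)
    (hF : ∀ b c, F (j c * b) = Coalgebra.counit (R := k) c • F b)
    (hG : ∀ b c, G (j c * b) = θ c (G b)) (b : B) (c : C) :
    TensorProduct.map F G (Coalgebra.comul (j c * b)) =
      (θ c).lTensor M (TensorProduct.map F G (Coalgebra.comul b)) := by
  obtain ⟨s, hs⟩ := TensorProduct.exists_finset (Coalgebra.comul (R := k) b)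
  obtain ⟨t, ht⟩ := TensorProduct.exists_finset (Coalgebra.comul (R := k) c)
  rw [comul_image_mul hj hs ht, hs]
  conv_rhs => rw [← sum_counit_smul_eq ht]
  simp [hF, hG, TensorProduct.smul_tmul, TensorProduct.tmul_sum]

theorem comul_tmul_one (hj : Coalgebra.comul ∘ₗ j = TensorProduct.map j j ∘ₗ Coalgebra.comul) :
    Coalgebra.comul ∘ₗ (TensorProduct.mk k B B).flip 1 ∘ₗ j =
      TensorProduct.map ((TensorProduct.mk k B B).flip 1 ∘ₗ j)
        ((TensorProduct.mk k B B).flip 1 ∘ₗ j) ∘ₗ Coalgebra.comul := by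
  ext c
  have h1 := LinearMap.congr_fun hj c
  simp only [LinearMap.comp_apply, LinearMap.flip_apply, TensorProduct.mk_apply] at h1 ⊢
  rw [TensorProduct.comul_tmul, h1, Bialgebra.comul_one, Algebra.TensorProduct.one_def]
  generalize Coalgebra.comul (R := k) c = t
  induction t using TensorProduct.induction_on with
  | zero => simp
  | add x y hx hy => simp only [TensorProduct.add_tmul, map_add, hx, hy]
  | tmul a b => simp

theorem comul_one_tmul (hj : Coalgebra.comul ∘ₗ j = TensorProduct.map j j ∘ₗ Coalgebra.comul) :
    Coalgebra.comul ∘ₗ TensorProduct.mk k B B 1 ∘ₗ j =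
      TensorProduct.map (TensorProduct.mk k B B 1 ∘ₗ j)
        (TensorProduct.mk k B B 1 ∘ₗ j) ∘ₗ Coalgebra.comul := by
  ext c
  have h1 := LinearMap.congr_fun hj c
  simp only [LinearMap.comp_apply, TensorProduct.mk_apply] at h1 ⊢
  rw [TensorProduct.comul_tmul, h1, Bialgebra.comul_one, Algebra.TensorProduct.one_def]
  generalize Coalgebra.comul (R := k) c = t
  induction t using TensorProduct.induction_on with
  | zero => simp
  | add x y hx hy => simp only [TensorProduct.tmul_add, map_add, hx, hy]
  | tmul a b => simp

end ModuleCoalgebra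

section

variable {k : Type v} {H : Type u} [Field k] [Ring H] [HopfAlgebra k H]
  {R : Type u} [Ring R] [Algebra k R] [Coalgebra k R] [Module H R] [IsScalarTower k H R]
  [YDHopfAlgebra k H R]

theorem comul_smash_inr (h : H) : Coalgebra.comul (R := k) (Smash.inr k H R h) =
    TensorProduct.map (Smash.inr k H R).toLinearMap (Smash.inr k H R).toLinearMap
      (Coalgebra.comul (R := k) h) := by
  refine (LinearMap.congr_fun (comulAlgHom_comp_inr (k := k) (H := H) (R := R)) h).trans ?_
  rw [imComul, sweedler, LinearMap.comp_apply, LinearMap.comp_apply]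
  generalize Coalgebra.comul (R := k) h = t
  induction t using TensorProduct.induction_on with
  | zero => simp
  | add x y hx hy => simp only [map_add, hx, hy]
  | tmul a b => simp

variable (k H R) in
/-- The map `h ↦ (1 # h) ⊗ 1`. -/
def inrLeft : H →ₗ[k] Smash k H R ⊗[k] Smash k H R :=
  (TensorProduct.mk k _ _).flip 1 ∘ₗ (Smash.inr k H R).toLinearMap

variable (k H R) in
/-- The map `h ↦ 1 ⊗ (1 # h)`. -/
def inrRight : H →ₗ[k] Smash k H R ⊗[k] Smash k H R :=
  TensorProduct.mk k _ _ 1 ∘ₗ (Smash.inr k H R).toLinearMap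

theorem inrLeft_apply (h : H) : inrLeft k H R h = Smash.inr k H R h ⊗ₜ 1 := rfl
theorem inrRight_apply (h : H) : inrRight k H R h = 1 ⊗ₜ Smash.inr k H R h := rfl

theorem comul_inrLeft : Coalgebra.comul ∘ₗ inrLeft k H R =
    TensorProduct.map (inrLeft k H R) (inrLeft k H R) ∘ₗ Coalgebra.comul :=
  comul_tmul_one (LinearMap.ext comul_smash_inr)

theorem comul_inrRight : Coalgebra.comul ∘ₗ inrRight k H R =
    TensorProduct.map (inrRight k H R) (inrRight k H R) ∘ₗ Coalgebra.comul :=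
  comul_one_tmul (LinearMap.ext comul_smash_inr)

variable (k H R) in
/-- The map `ι ⊗ ι : R ⊗ R → (R # H) ⊗ (R # H)`. -/
def inlTensor : R ⊗[k] R →ₗ[k] Smash k H R ⊗[k] Smash k H R :=
  TensorProduct.map (Smash.inl k H R).toLinearMap (Smash.inl k H R).toLinearMap

variable (k H R) in
/-- The projection `(r ⊗ h) ⊗ (s ⊗ h') ↦ r ⊗ h • s ε(h')`. -/
def balance : Smash k H R ⊗[k] Smash k H R →ₗ[k] R ⊗[k] R :=
  ((TensorProduct.rid k R).toLinearMap ∘ₗ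
      TensorProduct.map (act k H R) (Coalgebra.counit (R := k) (A := H)) ∘ₗ
        (TensorProduct.assoc k H R H).symm.toLinearMap).lTensor R ∘ₗ
    (TensorProduct.assoc k R H (R ⊗[k] H)).toLinearMap ∘ₗ
      TensorProduct.map (Smash.toTensor R).toLinearMap (Smash.toTensor R).toLinearMap

theorem Phi_eq (π : R ⊗[k] R →ₗ[k] k) : Phi (H := H) π = π ∘ₗ balance k H R := rfl

theorem balance_apply (r s : R) (h z : H) :
    balance k H R ((Smash.inl k H R r * Smash.inr k H R h) ⊗ₜ
      (Smash.inl k H R s * Smash.inr k H R z)) =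
      Coalgebra.counit (R := k) z • (r ⊗ₜ (h • s)) := by
  rw [Smash.inl_mul_inr, Smash.inl_mul_inr]
  simp [balance, Smash.mk]

theorem balance_inlTensor : balance k H R ∘ₗ inlTensor k H R = LinearMap.id := by
  ext r s
  have := balance_apply (k := k) (H := H) r s 1 1
  simpa [inlTensor] using this

theorem balance_surjective : Function.Surjective (balance k H R) := fun x =>
  ⟨inlTensor k H R x, LinearMap.congr_fun balance_inlTensor x⟩

variable (H) in
/-- The maps `F` on `(R # H) ⊗ (R # H)` with `F(x h ⊗ y) = F(x ⊗ h y)` and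
`F(x ⊗ y h) = ε(h) F(x ⊗ y)`. -/
structure IsBalanced {M : Type*} [AddCommGroup M] [Module k M]
    (F : Smash k H R ⊗[k] Smash k H R →ₗ[k] M) : Prop where
  middle : ∀ t h, F (t * inrLeft k H R h) = F (inrRight k H R h * t)
  right : ∀ t h, F (t * inrRight k H R h) = Coalgebra.counit (R := k) h • F t

/-- The two rules reduce rh ⊗ sz to ε(z) r ⊗ hs, then to ε(z) r ⊗ (h₁ • s)h₂, then to ε(z) r ⊗ h •
s. Thus `balance` is the universal balanced map, with `inlTensor` as a linear section, and balanced
maps are determined on R ⊗ R. -/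
theorem IsBalanced.comp_inlTensor_comp_balance {M : Type*} [AddCommGroup M] [Module k M]
    {F : Smash k H R ⊗[k] Smash k H R →ₗ[k] M} (hF : IsBalanced H F) :
    F ∘ₗ inlTensor k H R ∘ₗ balance k H R = F := by
  refine TensorProduct.ext' fun x y => ?_
  induction x using Smash.induction with
  | zero => simp
  | add x y hx hy => simp only [TensorProduct.add_tmul, map_add, hx, hy]
  | mul r h =>
  induction y using Smash.induction with
  | zero => simp
  | add x y hx hy => simp only [TensorProduct.tmul_add, map_add, hx, hy]
  | mul s z =>
  have h1 := hF.right ((Smash.inl k H R r * Smash.inr k H R h) ⊗ₜ Smash.inl k H R s) z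
  have h2 := hF.middle (Smash.inl k H R r ⊗ₜ Smash.inl k H R s) h
  rw [inrLeft_apply, inrRight_apply, Algebra.TensorProduct.tmul_mul_tmul,
    Algebra.TensorProduct.tmul_mul_tmul, mul_one, one_mul] at h2
  rw [inrRight_apply, Algebra.TensorProduct.tmul_mul_tmul, mul_one] at h1
  rw [LinearMap.comp_apply, LinearMap.comp_apply, balance_apply, h1, h2, map_smul, map_smul]
  congr 1
  obtain ⟨w, hw⟩ := TensorProduct.exists_finset (Coalgebra.comul (R := k) h)
  have h3 := fun p : H × H => hF.right (Smash.inl k H R r ⊗ₜ Smash.inl k H R (p.1 • s)) p.2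
  simp only [inrRight_apply, Algebra.TensorProduct.tmul_mul_tmul, mul_one] at h3
  have h4 := congrArg (TensorProduct.rid k H) (Coalgebra.lTensor_counit_comul (R := k) h)
  rw [hw] at h4
  rw [Smash.inr_mul_inl, sweedler_sum _ _ _ _ _ _ _ hw, TensorProduct.tmul_sum, map_sum]
  refine Eq.trans ?_ (Finset.sum_congr rfl fun p _ => (h3 p).symm)
  simp only [map_sum, LinearMap.lTensor_tmul, TensorProduct.rid_tmul, one_smul] at h4
  conv_lhs => rw [← h4]
  simp [inlTensor, Finset.sum_smul, TensorProduct.tmul_sum]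

theorem IsBalanced.ext {M : Type*} [AddCommGroup M] [Module k M]
    {F G : Smash k H R ⊗[k] Smash k H R →ₗ[k] M} (hF : IsBalanced H F) (hG : IsBalanced H G)
    (h : F ∘ₗ inlTensor k H R = G ∘ₗ inlTensor k H R) : F = G := by
  rw [← hF.comp_inlTensor_comp_balance, ← hG.comp_inlTensor_comp_balance,
    ← LinearMap.comp_assoc, h, LinearMap.comp_assoc]

theorem IsBalanced.comp {M N : Type*} [AddCommGroup M] [Module k M] [AddCommGroup N] [Module k N]
    {F : Smash k H R ⊗[k] Smash k H R →ₗ[k] M} (hF : IsBalanced H F) (f : M →ₗ[k] N) :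
    IsBalanced H (f ∘ₗ F) :=
  ⟨fun t h => congrArg f (hF.middle t h), fun t h => by
    rw [LinearMap.comp_apply, hF.right, map_smul, LinearMap.comp_apply]⟩

theorem IsBalanced.map_comul {M N : Type*} [AddCommGroup M] [Module k M] [AddCommGroup N]
    [Module k N] {F : Smash k H R ⊗[k] Smash k H R →ₗ[k] M}
    {G : Smash k H R ⊗[k] Smash k H R →ₗ[k] N} (hF : IsBalanced H F) (hG : IsBalanced H G) :
    IsBalanced H (TensorProduct.map F G ∘ₗ Coalgebra.comul) :=
  ⟨map_comul_balanced comul_inrLeft comul_inrRight hF.middle hG.middle, fun t h => by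
    have := map_comul_mul_image comul_inrRight
      (LinearMap.toSpanSingleton k _ LinearMap.id ∘ₗ Coalgebra.counit) hF.right
      (fun b c => by simpa using hG.right b c) t h
    refine this.trans ?_
    simp⟩

theorem isBalanced_balance : IsBalanced H (balance k H R) where
  middle t h := by
    induction t using TensorProduct.induction_on with
    | zero => simp
    | add x y hx hy => simp only [add_mul, mul_add, map_add, hx, hy]
    | tmul x y =>
    rw [inrLeft_apply, inrRight_apply, Algebra.TensorProduct.tmul_mul_tmul,
      Algebra.TensorProduct.tmul_mul_tmul, mul_one, one_mul]
    induction x using Smash.induction with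
    | zero => simp
    | add x y hx hy => simp only [TensorProduct.add_tmul, add_mul, map_add, hx, hy]
    | mul r z =>
    induction y using Smash.induction with
    | zero => simp
    | add x y hx hy => simp only [TensorProduct.tmul_add, mul_add, map_add, hx, hy]
    | mul s a =>
    obtain ⟨w, hw⟩ := TensorProduct.exists_finset (Coalgebra.comul (R := k) h)
    have h4 := congrArg (TensorProduct.rid k H) (Coalgebra.lTensor_counit_comul (R := k) h)
    rw [hw] at h4
    simp only [map_sum, LinearMap.lTensor_tmul, TensorProduct.rid_tmul, one_smul] at h4
    rw [← mul_assoc (Smash.inr k H R h), Smash.inr_mul_inl, sweedler_sum _ _ _ _ _ _ _ hw,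
      mul_assoc, ← map_mul, balance_apply]
    conv_lhs => rw [← h4]
    simp only [Finset.sum_mul, Finset.mul_sum, Finset.sum_smul, TensorProduct.tmul_sum, map_sum,
      Finset.smul_sum]
    refine Finset.sum_congr rfl fun p _ => ?_
    rw [AlgHom.toLinearMap_apply, mul_assoc, ← map_mul]
    refine Eq.trans ?_ (balance_apply _ _ _ _).symm
    simp [smul_smul, mul_comm]
  right t h := by
    induction t using TensorProduct.induction_on with
    | zero => simp
    | add x y hx hy => simp only [add_mul, smul_add, map_add, hx, hy]
    | tmul x y =>
    rw [inrRight_apply, Algebra.TensorProduct.tmul_mul_tmul, mul_one]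
    induction x using Smash.induction with
    | zero => simp
    | add x y hx hy => simp only [TensorProduct.add_tmul, smul_add, map_add, hx, hy]
    | mul r z =>
    induction y using Smash.induction with
    | zero => simp
    | add x y hx hy => simp only [TensorProduct.tmul_add, add_mul, smul_add, map_add, hx, hy]
    | mul s a =>
    rw [mul_assoc, ← map_mul, balance_apply, balance_apply, Bialgebra.counit_mul, smul_smul,
      mul_comm]

/-- Through this rule, H-linearity of π is the same as ε-invariance of Φ(π) under left
multiplication by H. -/
theorem balance_inrLeft_mul (h : H) (t : Smash k H R ⊗[k] Smash k H R) :
    balance k H R (inrLeft k H R h * t) = diagAct k H R R (h ⊗ₜ balance k H R t) := by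
  induction t using TensorProduct.induction_on with
  | zero => simp
  | add x y hx hy => simp only [mul_add, TensorProduct.tmul_add, map_add, hx, hy]
  | tmul x y =>
  rw [inrLeft_apply, Algebra.TensorProduct.tmul_mul_tmul, one_mul]
  induction x using Smash.induction with
  | zero => simp
  | add x y hx hy => simp only [TensorProduct.add_tmul, mul_add, TensorProduct.tmul_add, map_add,
      hx, hy]
  | mul r z =>
  induction y using Smash.induction with
  | zero => simp
  | add x y hx hy => simp only [TensorProduct.tmul_add, map_add, hx, hy]
  | mul s a =>
  obtain ⟨w, hw⟩ := TensorProduct.exists_finset (Coalgebra.comul (R := k) h)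
  rw [balance_apply, TensorProduct.tmul_smul, map_smul, diagAct_comul, hw, ← mul_assoc,
    Smash.inr_mul_inl, sweedler_sum _ _ _ _ _ _ _ hw]
  simp only [Finset.sum_mul, TensorProduct.sum_tmul, map_sum, Finset.smul_sum]
  refine Finset.sum_congr rfl fun p _ => ?_
  rw [AlgHom.toLinearMap_apply, mul_assoc, ← map_mul]
  refine (balance_apply _ _ _ _).trans ?_
  simp [mul_smul]

end

end
end BraidedCleft

/-! ### The braided coalgebra R ⊗ R as a quotient of (R # H) ⊗ (R # H). -/

namespace BraidedCleft

noncomputable section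

set_option linter.unusedSectionVars false

section

variable {k : Type v} {H : Type u} [Field k] [Ring H] [HopfAlgebra k H]
  {R : Type u} [Ring R] [Algebra k R] [Coalgebra k R] [Module H R] [IsScalarTower k H R]
  [YDHopfAlgebra k H R]

variable (k H R) in
/-- The map `r ⊗ s ↦ (r # s₍₋₁₎) ⊗ (s₍₀₎ # 1)`. -/
def spread : R ⊗[k] R →ₗ[k] Smash k H R ⊗[k] Smash k H R :=
  TensorProduct.map (Smash.toTensor R).symm.toLinearMap (Smash.inl k H R).toLinearMap ∘ₗ
    (TensorProduct.assoc k R H R).symm.toLinearMap ∘ₗ (ydCoact k H R).lTensor R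

theorem spread_tmul (r s : R) {ι : Type*} (w : Finset ι) (x : ι → H) (y : ι → R)
    (h : ydCoact k H R s = ∑ i ∈ w, x i ⊗ₜ y i) :
    spread k H R (r ⊗ₜ s) = ∑ i ∈ w,
      (Smash.inl k H R r * Smash.inr k H R (x i)) ⊗ₜ Smash.inl k H R (y i) := by
  simp only [spread, LinearMap.comp_apply, LinearMap.lTensor_tmul, h, TensorProduct.tmul_sum,
    map_sum, Smash.inl_mul_inr]
  rfl

theorem comul_smash_inl (r : R) : Coalgebra.comul (R := k) (Smash.inl k H R r) =
    spread k H R (Coalgebra.comul r) := by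
  rw [comul_eq_bosonCoact, Smash.inl_apply, bosonCoact_mk, Bialgebra.comul_one]
  generalize Coalgebra.comul (R := k) r = t
  induction t using TensorProduct.induction_on with
  | zero => simp
  | add x y hx hy => simp only [TensorProduct.add_tmul, map_add, hx, hy]
  | tmul r s =>
    obtain ⟨w, hw⟩ := TensorProduct.exists_finset (ydCoact k H R s)
    rw [spread_tmul _ _ w _ _ hw, Algebra.TensorProduct.one_def, map_midBraid_tmul _ _ _ _ w _ _ hw]
    simp only [Smash.inl_mul_inr]
    simp [Smash.inl_apply]

/-- Under `balance` the factor r₂₍₋₁₎ acts on s₁, which is the braiding, and the H-part of Δ(s) is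
deleted by ε. Only the first leg is projected, because the second already lies in R ⊗ R; this
sharper form is what makes translation by Φ(π) preserve R ⊗ R. -/
theorem balance_rTensor_comul_inlTensor (t : R ⊗[k] R) :
    (balance k H R).rTensor (Smash k H R ⊗[k] Smash k H R)
      (Coalgebra.comul (inlTensor k H R t)) =
      (inlTensor k H R).lTensor (R ⊗[k] R) (braidedComul k H R t) := by
  induction t using TensorProduct.induction_on with
  | zero => simp
  | add x y hx hy => simp only [map_add, hx, hy]
  | tmul r s =>
  rw [inlTensor, TensorProduct.map_tmul, AlgHom.toLinearMap_apply, AlgHom.toLinearMap_apply,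
    TensorProduct.comul_tmul, comul_smash_inl, comul_smash_inl]
  refine LinearMap.congr_fun (?_ : (balance k H R).rTensor _ ∘ₗ
    (TensorProduct.AlgebraTensorModule.tensorTensorTensorComm k k k k _ _ _ _).toLinearMap ∘ₗ
      TensorProduct.map (spread k H R) (spread k H R) = (inlTensor k H R).lTensor _ ∘ₗ
        midBraid (ydCoact k H R) R R R) (Coalgebra.comul r ⊗ₜ Coalgebra.comul s)
  refine TensorProduct.ext_fourfold' fun r r' s s' => ?_
  simp only [LinearMap.comp_apply, TensorProduct.map_tmul]
  obtain ⟨w, hw⟩ := TensorProduct.exists_finset (ydCoact k H R r')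
  obtain ⟨w', hw'⟩ := TensorProduct.exists_finset (ydCoact k H R s')
  rw [spread_tmul _ _ w _ _ hw, spread_tmul _ _ w' _ _ hw', midBraid_sum _ _ _ _ r r' s s' w _ _ hw]
  simp only [TensorProduct.sum_tmul, TensorProduct.tmul_sum, map_sum, LinearEquiv.coe_coe,
    TensorProduct.AlgebraTensorModule.tensorTensorTensorComm_tmul, LinearMap.rTensor_tmul,
    balance_apply, LinearMap.lTensor_tmul]
  rw [Finset.sum_comm]
  refine Finset.sum_congr rfl fun p _ => ?_
  conv_rhs => rw [← sum_counit_smul s' w' _ _ hw']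
  simp only [map_sum, map_smul, TensorProduct.tmul_sum, TensorProduct.tmul_smul,
    TensorProduct.smul_tmul]
  rfl

/-- Both sides are balanced, so they need only be compared on R ⊗ R. As `balance` is onto,
coassociativity and the counit laws of the braided comultiplication are inherited from R # H. -/
theorem map_balance_comul : TensorProduct.map (balance k H R) (balance k H R) ∘ₗ
    Coalgebra.comul = braidedComul k H R ∘ₗ balance k H R := by
  refine (isBalanced_balance.map_comul isBalanced_balance).ext (isBalanced_balance.comp _) ?_
  refine LinearMap.ext fun t => ?_
  have h1 := balance_rTensor_comul_inlTensor (H := H) t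
  rw [LinearMap.comp_apply, LinearMap.comp_apply, LinearMap.comp_apply, LinearMap.comp_apply,
    ← LinearMap.lTensor_comp_rTensor, LinearMap.comp_apply, h1, ← LinearMap.comp_apply
      (LinearMap.lTensor _ (balance k H R)), ← LinearMap.lTensor_comp,
    ← LinearMap.comp_apply (balance k H R), balance_inlTensor]
  simp

variable (k R) in
/-- The counit `ε ⊗ ε` of `R ⊗ R`. -/
def tensorCounit : R ⊗[k] R →ₗ[k] k :=
  LinearMap.mul' k k ∘ₗ TensorProduct.map Coalgebra.counit Coalgebra.counit

theorem tensorCounit_balance : tensorCounit k R ∘ₗ balance k H R = Coalgebra.counit := by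
  refine TensorProduct.ext' fun x y => ?_
  rw [LinearMap.comp_apply, TensorProduct.counit_tmul]
  induction x using Smash.induction with
  | zero => simp
  | add x y hx hy => simp only [TensorProduct.add_tmul, map_add, hx, hy, smul_add]
  | mul r z =>
  induction y using Smash.induction with
  | zero => simp
  | add x y hx hy => simp only [TensorProduct.tmul_add, map_add, hx, hy, add_smul]
  | mul s a =>
  rw [balance_apply, smash_counit_apply, smash_counit_apply]
  simp [tensorCounit, YDHopfAlgebra.counit_smul]
  ring

theorem braidedComul_coassoc : (TensorProduct.assoc k (R ⊗[k] R) (R ⊗[k] R) (R ⊗[k] R)).toLinearMap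
    ∘ₗ (braidedComul k H R).rTensor (R ⊗[k] R) ∘ₗ braidedComul k H R =
      (braidedComul k H R).lTensor (R ⊗[k] R) ∘ₗ braidedComul k H R := by
  rw [← LinearMap.cancel_right (balance_surjective (k := k) (H := H) (R := R))]
  have h1 := congrArg (TensorProduct.map (balance k H R)
    (TensorProduct.map (balance k H R) (balance k H R)) ∘ₗ ·)
    (Coalgebra.coassoc (R := k) (A := Smash k H R ⊗[k] Smash k H R))
  have h2 : TensorProduct.map (TensorProduct.map (balance k H R) (balance k H R) ∘ₗ Coalgebra.comul)
      (balance k H R) ∘ₗ Coalgebra.comul = (braidedComul k H R).rTensor (R ⊗[k] R) ∘ₗ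
        braidedComul k H R ∘ₗ balance k H R := by
    rw [← map_balance_comul, ← LinearMap.comp_assoc, LinearMap.rTensor_comp_map, map_balance_comul]
  have h3 : TensorProduct.map (balance k H R)
      (TensorProduct.map (balance k H R) (balance k H R) ∘ₗ Coalgebra.comul)
       ∘ₗ Coalgebra.comul = (braidedComul k H R).lTensor (R ⊗[k] R) ∘ₗ
        braidedComul k H R ∘ₗ balance k H R := by
    rw [← map_balance_comul, ← LinearMap.comp_assoc, LinearMap.lTensor_comp_map, map_balance_comul]
  rw [LinearMap.comp_assoc, LinearMap.comp_assoc, LinearMap.comp_assoc, ← h2, ← h3]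
  rw [← LinearMap.comp_assoc _ (LinearMap.lTensor _ _), LinearMap.map_comp_lTensor] at h1
  refine Eq.trans ?_ h1
  refine LinearMap.ext fun x => ?_
  simp only [LinearMap.comp_apply]
  generalize Coalgebra.comul (R := k) x = t
  induction t using TensorProduct.induction_on with
  | zero => simp only [map_zero]
  | add x y hx hy => simp only [map_add, hx, hy]
  | tmul x y =>
  simp only [TensorProduct.map_tmul, LinearMap.comp_apply, LinearMap.rTensor_tmul]
  generalize Coalgebra.comul (R := k) x = t
  induction t using TensorProduct.induction_on with
  | zero => simp only [TensorProduct.zero_tmul, map_zero]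
  | add x y hx hy => simp only [TensorProduct.add_tmul, map_add, hx, hy]
  | tmul x y => rfl

theorem tensorCounit_rTensor_braidedComul : (tensorCounit k R).rTensor (R ⊗[k] R) ∘ₗ
    braidedComul k H R = TensorProduct.mk k k (R ⊗[k] R) 1 := by
  rw [← LinearMap.cancel_right (balance_surjective (k := k) (H := H) (R := R)),
    LinearMap.comp_assoc, ← map_balance_comul, ← LinearMap.comp_assoc, LinearMap.rTensor_comp_map,
    tensorCounit_balance]
  have h1 := congrArg ((balance k H R).lTensor k ∘ₗ ·)
    (Coalgebra.rTensor_counit_comp_comul (R := k) (A := Smash k H R ⊗[k] Smash k H R))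
  rw [← LinearMap.comp_assoc, LinearMap.lTensor_comp_rTensor] at h1
  exact h1

theorem tensorCounit_lTensor_braidedComul : (tensorCounit k R).lTensor (R ⊗[k] R) ∘ₗ
    braidedComul k H R = (TensorProduct.mk k (R ⊗[k] R) k).flip 1 := by
  rw [← LinearMap.cancel_right (balance_surjective (k := k) (H := H) (R := R)),
    LinearMap.comp_assoc, ← map_balance_comul, ← LinearMap.comp_assoc, LinearMap.lTensor_comp_map,
    tensorCounit_balance]
  have h1 := congrArg ((balance k H R).rTensor k ∘ₗ ·)
    (Coalgebra.lTensor_counit_comp_comul (R := k) (A := Smash k H R ⊗[k] Smash k H R))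
  rw [← LinearMap.comp_assoc, LinearMap.rTensor_comp_lTensor] at h1
  exact h1

theorem hat_eq (π : R ⊗[k] R →ₗ[k] k) :
    hat k H π = LinearMap.mul' k R ∘ₗ translate (braidedComul k H R) π := by
  refine LinearMap.ext fun x => ?_
  simp only [hat, translate, LinearMap.comp_apply]
  generalize braidedComul k H R x = t
  induction t using TensorProduct.induction_on with
  | zero => simp
  | add x y hx hy => simp only [map_add, hx, hy]
  | tmul a b => simp

theorem isBalanced_Phi (π : R ⊗[k] R →ₗ[k] k) : IsBalanced H (Phi (H := H) π) :=
  isBalanced_balance.comp π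

theorem translate_braidedComul_comp_balance (π : R ⊗[k] R →ₗ[k] k) :
    translate (braidedComul k H R) π ∘ₗ balance k H R =
      balance k H R ∘ₗ translate Coalgebra.comul (Phi (H := H) π) := by
  rw [translate, LinearMap.comp_assoc, LinearMap.comp_assoc, ← map_balance_comul]
  refine LinearMap.ext fun x => ?_
  simp only [translate, LinearMap.comp_apply, Phi_eq]
  generalize Coalgebra.comul (R := k) x = t
  induction t using TensorProduct.induction_on with
  | zero => simp only [map_zero]
  | add x y hx hy => simp only [map_add, hx, hy]
  | tmul a b => simp

/-- Translation by π is thus the restriction of translation by Φ(π) to R ⊗ R, besides being its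
quotient along `balance`. -/
theorem translate_Phi_comp_inlTensor (π : R ⊗[k] R →ₗ[k] k) :
    translate Coalgebra.comul (Phi (H := H) π) ∘ₗ inlTensor k H R =
      inlTensor k H R ∘ₗ translate (braidedComul k H R) π := by
  refine LinearMap.ext fun x => ?_
  have h1 := congrArg ((TensorProduct.lid k _).toLinearMap ∘ₗ π.rTensor _)
    (balance_rTensor_comul_inlTensor (H := H) x)
  refine Eq.trans ?_ (h1.trans ?_)
  · simp only [translate, LinearMap.comp_apply, Phi_eq, LinearMap.rTensor_comp]
  · simp only [translate, LinearMap.comp_apply]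
    generalize braidedComul k H R x = t
    induction t using TensorProduct.induction_on with
    | zero => simp only [map_zero]
    | add x y hx hy => simp only [map_add, hx, hy]
    | tmul a b => simp

/-- This makes R with product `hat k H π` a subalgebra of the twisted product, from which it
inherits associativity. -/
theorem crossedMul_Phi_comp_inlTensor (π : R ⊗[k] R →ₗ[k] k) :
    crossedMul (Phi (H := H) π) ∘ₗ inlTensor k H R =
      (Smash.inl k H R).toLinearMap ∘ₗ hat k H π := by
  rw [crossedMul, LinearMap.comp_assoc, translate_Phi_comp_inlTensor, hat_eq]
  refine LinearMap.ext fun x => ?_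
  simp only [LinearMap.comp_apply]
  generalize translate (braidedComul k H R) π x = t
  induction t using TensorProduct.induction_on with
  | zero => simp only [map_zero]
  | add x y hx hy => simp only [map_add, hx, hy]
  | tmul a b => simp [inlTensor]

theorem Phi_comp_inlTensor (π : R ⊗[k] R →ₗ[k] k) :
    Phi (H := H) π ∘ₗ inlTensor k H R = π := by
  rw [Phi_eq, LinearMap.comp_assoc, balance_inlTensor, LinearMap.comp_id]

end

end
end BraidedCleft

/-! ### From a class in C' to a two-cocycle on R. -/

namespace BraidedCleft

noncomputable section

set_option linter.unusedSectionVars false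

section Colinear

variable {k : Type*} [Field k] {C D : Type*} [AddCommGroup C] [Module k C]
  [AddCommGroup D] [Module k D]

/-- A coaction commuting with the comultiplication commutes with translations. -/
theorem comp_translate_of_colinear {Δ : C →ₗ[k] C ⊗[k] C} {κ : C →ₗ[k] C ⊗[k] D}
    (h : (TensorProduct.assoc k C C D).toLinearMap ∘ₗ Δ.rTensor D ∘ₗ κ = κ.lTensor C ∘ₗ Δ)
    (f : C →ₗ[k] k) : κ ∘ₗ translate Δ f = (translate Δ f).rTensor D ∘ₗ κ := by
  ext x
  have h1 := congrArg ((TensorProduct.lid k (C ⊗[k] D)).toLinearMap ∘ₗ f.rTensor (C ⊗[k] D))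
    (LinearMap.congr_fun h x)
  refine Eq.trans ?_ (h1.symm.trans ?_)
  · simp only [translate, LinearMap.comp_apply]
    generalize Δ x = t
    induction t using TensorProduct.induction_on with
    | zero => simp
    | add x y hx hy => simp only [map_add, hx, hy]
    | tmul a b => simp
  · simp only [translate, LinearMap.comp_apply]
    generalize κ x = t
    induction t using TensorProduct.induction_on with
    | zero => simp
    | add x y hx hy => simp only [map_add, hx, hy]
    | tmul a b =>
      simp only [LinearMap.rTensor_tmul, LinearMap.comp_apply]
      generalize Δ a = t
      induction t using TensorProduct.induction_on with
      | zero => simp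
      | add x y hx hy => simp only [map_add, TensorProduct.add_tmul, hx, hy]
      | tmul a b => simp [TensorProduct.smul_tmul']

variable (k C) in
/-- The map `x ⊗ c ↦ (x ⊗ c₁) ⊗ c₂`. -/
def splitRight (E : Type*) [AddCommGroup E] [Module k E] [Coalgebra k C] :
    E ⊗[k] C →ₗ[k] (E ⊗[k] C) ⊗[k] C :=
  (TensorProduct.assoc k E C C).symm.toLinearMap ∘ₗ
    (Coalgebra.comul (R := k) (A := C)).lTensor E

theorem canonicalMap_id [Coalgebra k C] (μ : C ⊗[k] C →ₗ[k] C) :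
    canonicalMap μ (LinearMap.id (M := C)) = μ.rTensor C ∘ₗ splitRight k C C := by
  rw [canonicalMap, LinearMap.lTensor_id, LinearMap.comp_id, splitRight]

/-- Splitting off the last factor c₂ commutes with translation from the left, so twisting a product
by f precomposes its canonical map with translation by f. Invertibility of f can then be read off
from the two canonical maps. -/
theorem canonicalMap_comp_translate [Coalgebra k C] {Δ : C ⊗[k] C →ₗ[k] (C ⊗[k] C) ⊗[k] (C ⊗[k] C)}
    (h : (TensorProduct.assoc k _ _ C).toLinearMap ∘ₗ Δ.rTensor C ∘ₗ splitRight k C C =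
      (splitRight k C C).lTensor _ ∘ₗ Δ) (μ : C ⊗[k] C →ₗ[k] C) (f : C ⊗[k] C →ₗ[k] k) :
    canonicalMap (μ ∘ₗ translate Δ f) (LinearMap.id (M := C)) =
      canonicalMap μ (LinearMap.id (M := C)) ∘ₗ translate Δ f := by
  rw [canonicalMap_id, canonicalMap_id, LinearMap.rTensor_comp, LinearMap.comp_assoc,
    LinearMap.comp_assoc, comp_translate_of_colinear h]

theorem splitRight_comul [Coalgebra k C] :
    (TensorProduct.assoc k _ _ C).toLinearMap ∘ₗ
      (Coalgebra.comul (R := k) (A := C ⊗[k] C)).rTensor C ∘ₗ splitRight k C C =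
      (splitRight k C C).lTensor _ ∘ₗ Coalgebra.comul (R := k) (A := C ⊗[k] C) := by
  refine TensorProduct.ext' fun x y => ?_
  -- Once Δ(x) is carried along as a parameter, the claim is coassociativity at y.
  let Λ : C ⊗[k] C →ₗ[k] C ⊗[k] (C ⊗[k] C) →ₗ[k] (C ⊗[k] C) ⊗[k] ((C ⊗[k] C) ⊗[k] C) :=
    TensorProduct.curry ((TensorProduct.assoc k C C C).symm.toLinearMap.lTensor (C ⊗[k] C) ∘ₗ
      (TensorProduct.tensorTensorTensorComm k C C C (C ⊗[k] C)).toLinearMap)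
  have h1 := congrArg (Λ (Coalgebra.comul x)) (Coalgebra.coassoc_apply (R := k) y)
  refine Eq.trans ?_ (h1.trans ?_)
  · simp only [LinearMap.comp_apply, splitRight, LinearMap.lTensor_tmul]
    generalize Coalgebra.comul (R := k) y = u
    induction u using TensorProduct.induction_on with
    | zero => simp
    | add x y hx hy => simp only [map_add, TensorProduct.tmul_add, hx, hy]
    | tmul y z =>
    simp only [LinearEquiv.coe_coe, TensorProduct.assoc_symm_tmul, LinearMap.rTensor_tmul,
      TensorProduct.comul_tmul]
    generalize Coalgebra.comul (R := k) x = t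
    generalize Coalgebra.comul (R := k) y = u
    induction t using TensorProduct.induction_on with
    | zero => simp
    | add x y hx hy => simp only [map_add, TensorProduct.add_tmul, LinearMap.add_apply, hx, hy]
    | tmul a b =>
    induction u using TensorProduct.induction_on with
    | zero => simp
    | add x y hx hy => simp only [map_add, TensorProduct.tmul_add, TensorProduct.add_tmul, hx, hy]
    | tmul c d => simp [Λ]
  · simp only [LinearMap.comp_apply, splitRight, TensorProduct.comul_tmul]
    generalize Coalgebra.comul (R := k) x = t
    generalize Coalgebra.comul (R := k) y = u
    induction t using TensorProduct.induction_on with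
    | zero => simp
    | add x y hx hy => simp only [map_add, TensorProduct.add_tmul, LinearMap.add_apply, hx, hy]
    | tmul a b =>
    induction u using TensorProduct.induction_on with
    | zero => simp
    | add x y hx hy => simp only [map_add, TensorProduct.tmul_add, hx, hy]
    | tmul c d => simp [Λ]

end Colinear

section Bialgebra

variable {k : Type v} [Field k] {A : Type u} [Ring A] [Bialgebra k A]

theorem crossedMul_apply (σ : A ⊗[k] A →ₗ[k] k) (t : A ⊗[k] A) : crossedMul σ t =
    TensorProduct.lid k A (TensorProduct.map σ (LinearMap.mul' k A) (Coalgebra.comul t)) :=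
  (LinearMap.congr_fun (crossedPair_mul σ) t).symm

/-- Since the counit recovers σ, identities for the twisted product turn into identities for σ. -/
theorem counit_comp_crossedMul (σ : A ⊗[k] A →ₗ[k] k) :
    Coalgebra.counit ∘ₗ crossedMul σ = σ := by
  have h1 : Coalgebra.counit (R := k) (A := A) ∘ₗ LinearMap.mul' k A = Coalgebra.counit :=
    TensorProduct.ext' fun x y => by simp [mul_comm]
  rw [crossedMul, ← LinearMap.comp_assoc, h1]
  exact comp_translate Coalgebra.lTensor_counit_comp_comul σ

end Bialgebra

section

variable {k : Type v} {H : Type u} [Field k] [Ring H] [HopfAlgebra k H]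
  {R : Type u} [Ring R] [Algebra k R] [Coalgebra k R] [Module H R] [IsScalarTower k H R]
  [YDHopfAlgebra k H R]

theorem Phi_inrLeft_mul {π : R ⊗[k] R →ₗ[k] k}
    (hπ : ∀ (h : H) x, π (diagAct k H R R (h ⊗ₜ x)) = Coalgebra.counit (R := k) h * π x)
    (t : Smash k H R ⊗[k] Smash k H R) (h : H) :
    Phi π (inrLeft k H R h * t) = Coalgebra.counit (R := k) h • Phi π t := by
  rw [Phi_eq, LinearMap.comp_apply, balance_inrLeft_mul, hπ]
  rfl

theorem translate_inrLeft_mul {σ : Smash k H R ⊗[k] Smash k H R →ₗ[k] k}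
    (hσ : ∀ t h, σ (inrLeft k H R h * t) = Coalgebra.counit (R := k) h • σ t)
    (t : Smash k H R ⊗[k] Smash k H R) (h : H) :
    translate Coalgebra.comul σ (inrLeft k H R h * t) =
      inrLeft k H R h * translate Coalgebra.comul σ t := by
  have h1 := congrArg (TensorProduct.lid k _) (map_comul_image_mul (F := σ) (G := LinearMap.id)
    (comul_inrLeft (k := k) (H := H) (R := R)) (LinearMap.mul k _ ∘ₗ inrLeft k H R) hσ
      (fun b c => rfl) t h)
  refine h1.trans ?_
  simp only [translate, LinearMap.comp_apply, LinearMap.rTensor]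
  generalize TensorProduct.map σ LinearMap.id (Coalgebra.comul (R := k) t) = w
  induction w using TensorProduct.induction_on with
  | zero => simp only [map_zero, mul_zero]
  | add x y hx hy => simp only [map_add, hx, hy, mul_add]
  | tmul a b =>
    simp only [LinearMap.lTensor_tmul, TensorProduct.lid_tmul,
      LinearMap.mul_apply_apply]
    exact (mul_smul_comm a _ b).symm

/-- Proved on (R # H) ⊗ (R # H), where H acts by left multiplication on the first factor, and then
pushed down along `balance`. -/
theorem translate_diagAct {π : R ⊗[k] R →ₗ[k] k}
    (hπ : ∀ (h : H) x, π (diagAct k H R R (h ⊗ₜ x)) = Coalgebra.counit (R := k) h * π x)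
    (h : H) (x : R ⊗[k] R) : translate (braidedComul k H R) π (diagAct k H R R (h ⊗ₜ x)) =
      diagAct k H R R (h ⊗ₜ translate (braidedComul k H R) π x) := by
  obtain ⟨t, rfl⟩ := balance_surjective (k := k) (H := H) x
  have h1 := LinearMap.congr_fun (translate_braidedComul_comp_balance (H := H) π)
  simp only [LinearMap.comp_apply] at h1
  rw [← balance_inrLeft_mul, h1, h1, translate_inrLeft_mul (Phi_inrLeft_mul hπ),
    balance_inrLeft_mul]

theorem tensorCounit_diagAct (h : H) (x : R ⊗[k] R) :
    tensorCounit k R (diagAct k H R R (h ⊗ₜ x)) =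
      Coalgebra.counit (R := k) h * tensorCounit k R x := by
  induction x using TensorProduct.induction_on with
  | zero => simp
  | add x y hx hy => simp only [TensorProduct.tmul_add, map_add, hx, hy, mul_add]
  | tmul r s =>
  obtain ⟨w, hw⟩ := TensorProduct.exists_finset (Coalgebra.comul (R := k) h)
  have h1 := congrArg (Coalgebra.counit (R := k)) (sum_counit_smul_eq hw)
  simp only [map_sum, map_smul, smul_eq_mul] at h1
  rw [diagAct_comul, hw, ← h1, Finset.sum_mul]
  simp only [map_sum]
  refine Finset.sum_congr rfl fun p _ => ?_
  simp [tensorCounit, YDHopfAlgebra.counit_smul]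
  ring

/-- Injectivity passes to a restriction and surjectivity to a quotient; translation by π is both. -/
theorem translate_bijective_of_Phi {π : R ⊗[k] R →ₗ[k] k}
    (h : Function.Bijective (translate Coalgebra.comul (Phi (H := H) π))) :
    Function.Bijective (translate (braidedComul k H R) π) := by
  constructor
  · have h1 := translate_Phi_comp_inlTensor (H := H) π
    have h2 : Function.Injective (inlTensor k H R) :=
      Function.LeftInverse.injective (g := balance k H R)
        (LinearMap.congr_fun balance_inlTensor)
    refine Function.Injective.of_comp (f := inlTensor k H R) ?_
    rw [← LinearMap.coe_comp, ← h1, LinearMap.coe_comp]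
    exact h.1.comp h2
  · refine Function.Surjective.of_comp (g := balance k H R) ?_
    rw [← LinearMap.coe_comp, translate_braidedComul_comp_balance, LinearMap.coe_comp]
    exact balance_surjective.comp h.2

/-- Writing · for the twisted product, (xh)·y = (x·h)·y = x·(h·y) = x·(hy), and ε of this is the
middle balancing rule; the right rule and left invariance come out in the same way. Hence σ = Φ(π)
with π H-linear, and the cocycle identity is ε of associativity on R. -/
theorem exists_isTwoCocycle {σ : Smash k H R ⊗[k] Smash k H R →ₗ[k] k}
    (hassoc : ∀ x y z, crossedMul σ (crossedMul σ (x ⊗ₜ y) ⊗ₜ z) =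
        crossedMul σ (x ⊗ₜ crossedMul σ (y ⊗ₜ z)))
    (hone : ∀ x, crossedMul σ (x ⊗ₜ 1) = x)
    (hinv : ∃ g, conv (crossedMul σ) Coalgebra.comul LinearMap.id g =
        LinearMap.toSpanSingleton k _ 1 ∘ₗ Coalgebra.counit ∧
        conv (crossedMul σ) Coalgebra.comul g LinearMap.id =
        LinearMap.toSpanSingleton k _ 1 ∘ₗ Coalgebra.counit)
    (hl : ∀ h x, crossedMul σ (Smash.inr k H R h ⊗ₜ x) = Smash.inr k H R h * x)
    (hr : ∀ x h, crossedMul σ (x ⊗ₜ Smash.inr k H R h) = x * Smash.inr k H R h) :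
    ∃ π, IsTwoCocycle k H π ∧ σ = Phi π := by
  have hσ : ∀ t, σ t = Coalgebra.counit (R := k) (crossedMul σ t) := fun t =>
    (LinearMap.congr_fun (counit_comp_crossedMul σ) t).symm
  have hbal : IsBalanced H σ := by
    refine ⟨fun t h => ?_, fun t h => ?_⟩
    · induction t using TensorProduct.induction_on with
      | zero => simp
      | add x y hx hy => simp only [add_mul, mul_add, map_add, hx, hy]
      | tmul x y =>
      rw [inrLeft_apply, inrRight_apply, Algebra.TensorProduct.tmul_mul_tmul,
        Algebra.TensorProduct.tmul_mul_tmul, mul_one, one_mul, hσ, hσ, ← hl, ← hassoc, hr]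
    · induction t using TensorProduct.induction_on with
      | zero => simp
      | add x y hx hy => simp only [add_mul, smul_add, map_add, hx, hy]
      | tmul x y =>
      rw [inrRight_apply, Algebra.TensorProduct.tmul_mul_tmul, mul_one, hσ, hσ, ← hr, ← hassoc, hr,
        Bialgebra.counit_mul, smash_counit_inr, mul_comm, smul_eq_mul]
  have hleft : ∀ t h, σ (inrLeft k H R h * t) = Coalgebra.counit (R := k) h • σ t := by
    intro t h
    induction t using TensorProduct.induction_on with
    | zero => simp
    | add x y hx hy => simp only [mul_add, smul_add, map_add, hx, hy]
    | tmul x y =>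
    rw [inrLeft_apply, Algebra.TensorProduct.tmul_mul_tmul, one_mul, hσ, hσ, ← hl, hassoc, hl,
      Bialgebra.counit_mul, smash_counit_inr, smul_eq_mul]
  obtain ⟨π, rfl⟩ : ∃ π, σ = Phi (H := H) π :=
    ⟨σ ∘ₗ inlTensor k H R, hbal.comp_inlTensor_comp_balance.symm⟩
  have hlin : ∀ (h : H) x, π (diagAct k H R R (h ⊗ₜ x)) = Coalgebra.counit (R := k) h * π x := by
    intro h x
    obtain ⟨t, rfl⟩ := balance_surjective (k := k) (H := H) x
    rw [← balance_inrLeft_mul]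
    exact hleft t h
  have hπ : ∀ r s, π (r ⊗ₜ s) = Coalgebra.counit (R := k)
      (crossedMul (Phi π) (Smash.inl k H R r ⊗ₜ Smash.inl k H R s)) := fun r s =>
    (LinearMap.congr_fun (Phi_comp_inlTensor (H := H) π) (r ⊗ₜ s)).symm.trans (hσ _)
  have hm : ∀ r s, crossedMul (Phi π) (Smash.inl k H R r ⊗ₜ Smash.inl k H R s) =
      Smash.inl k H R (hat k H π (r ⊗ₜ s)) := fun r s =>
    LinearMap.congr_fun (crossedMul_Phi_comp_inlTensor (H := H) π) (r ⊗ₜ s)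
  refine ⟨π, ⟨hlin, ?_, ?_, ?_⟩, rfl⟩
  -- The canonical map of the twisted product is bijective by the inverse g of the section, that of
  -- R # H by the antipode; they differ by translation by Φ(π), which is therefore bijective.
  · obtain ⟨g, hg1, hg2⟩ := hinv
    obtain ⟨S, hS1, hS2⟩ := exists_smash_antipode (k := k) (H := H) (R := R)
    rw [linearMap_eq_toSpanSingleton] at hS1 hS2
    have h1 := canonicalMap_bijective hassoc hone _ g hg1 hg2
    have h2 := canonicalMap_bijective (μ := LinearMap.mul' k (Smash k H R))
      (fun x y z => by simp [mul_assoc]) (u := 1) (fun x => by simp) _ S hS1 hS2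
    rw [crossedMul, canonicalMap_comp_translate splitRight_comul, LinearMap.coe_comp,
      Function.Bijective.of_comp_iff' h2] at h1
    have h3 := translate_bijective_of_Phi h1
    obtain ⟨π', h4, h5, h6⟩ := exists_conv_inverse braidedComul_coassoc
      tensorCounit_rTensor_braidedComul tensorCounit_lTensor_braidedComul π h3
    refine ⟨π', fun h x => ?_, h4, h5⟩
    -- Every element is a translate by π; there π' is ε ⊗ ε, and translation by π commutes with H,
    -- so π' is H-linear.
    obtain ⟨y, rfl⟩ := h3.2 x
    have h7 := LinearMap.congr_fun h6
    simp only [LinearMap.comp_apply] at h7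
    rw [← translate_diagAct hlin, h7, h7, tensorCounit_diagAct]
  · refine TensorProduct.ext_threefold fun r s t => ?_
    simp only [LinearMap.comp_apply, LinearMap.rTensor_tmul, LinearEquiv.coe_coe,
      TensorProduct.assoc_tmul, LinearMap.lTensor_tmul]
    rw [hπ, hπ, ← hm, ← hm, hassoc]
  · rw [hπ, map_one, hone, Bialgebra.counit_one]

theorem CPrime.exists_isTwoCocycle {x : PairClass k (Smash k H R)} (hx : x ∈ CPrime k H R) :
    ∃ π : R ⊗[k] R →ₗ[k] k, IsTwoCocycle k H π ∧ x = ⟦crossedPair (Phi π)⟧ := by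
  obtain ⟨⟨P, hP, hxP⟩, Q, hxQ, hQ⟩ := hx
  obtain ⟨σ, hiso, hassoc, hone', hone, hinv⟩ := hP.exists_crossed
  have hx : x = ⟦crossedPair σ⟧ := hxP.trans (Quotient.sound hiso).symm
  -- The representative Q with the multiplicative section may differ from the cleft representative
  -- P; the common class carries the condition over to the twisted product, whose section is the
  -- identity.
  obtain ⟨f, hmul, -, -, hsect⟩ : (crossedPair σ).IsIso Q := Quotient.exact (hx.symm.trans hxQ)
  have hf : ∀ a : Smash k H R, Q.sect a = f a := fun a => (hsect a).symm
  have hm : ∀ a b : Smash k H R, Q.mul (f a ⊗ₜ f b) = f (crossedMul σ (a ⊗ₜ b)) := fun a b => by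
    rw [← crossedPair_mul]
    exact (hmul a b).symm
  have key : ∀ (h : H) (a : Smash k H R) (h' : H),
      Smash.inr k H R h * a * Smash.inr k H R h' =
        crossedMul σ (crossedMul σ (Smash.inr k H R h ⊗ₜ a) ⊗ₜ Smash.inr k H R h') := by
    intro h a h'
    induction a using Smash.induction with
    | zero => simp
    | add x y hx hy => simp only [mul_add, add_mul, TensorProduct.add_tmul, TensorProduct.tmul_add,
        map_add, hx, hy]
    | mul r z =>
    refine f.injective ?_
    have h1 := hQ r h z h'
    rw [← Smash.inr_apply, ← Smash.inr_apply, ← Smash.inl_mul_inr] at h1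
    simp only [hf, hm] at h1
    exact h1
  -- Putting 1 for the right or the left element of H separates the two one-sided conditions.
  obtain ⟨π, hπ, rfl⟩ := BraidedCleft.exists_isTwoCocycle hassoc hone hinv
    (fun h a => by simpa [hone] using (key h a 1).symm)
    (fun a h => by simpa [hone'] using (key 1 a h).symm)
  exact ⟨π, hπ, hx⟩

end

end
end BraidedCleft

/-! ### The product `hat k H π` on R: unit laws, associativity, H-linearity. -/

namespace BraidedCleft

noncomputable section

set_option linter.unusedSectionVars false

section Translation

variable {k : Type*} [Field k] {C : Type*} [AddCommGroup C] [Module k C]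
  {Δ : C →ₗ[k] C ⊗[k] C} {e : C →ₗ[k] k}

theorem comp_translate_self (hΔ : (TensorProduct.assoc k C C C).toLinearMap ∘ₗ Δ.rTensor C ∘ₗ Δ =
    Δ.lTensor C ∘ₗ Δ) (hr : e.lTensor C ∘ₗ Δ = (TensorProduct.mk k C k).flip 1) (f : C →ₗ[k] k) :
    f ∘ₗ translate Δ f = sweedler Δ f f := by
  rw [← comp_translate hr (sweedler Δ f f), ← translate_comp hΔ, ← LinearMap.comp_assoc,
    comp_translate hr]

/-- A form that is idempotent and acts injectively is the counit. -/
theorem translate_eq_id (hΔ : (TensorProduct.assoc k C C C).toLinearMap ∘ₗ Δ.rTensor C ∘ₗ Δ =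
    Δ.lTensor C ∘ₗ Δ) (hr : e.lTensor C ∘ₗ Δ = (TensorProduct.mk k C k).flip 1) {f : C →ₗ[k] k}
    (hf : Function.Injective (translate Δ f)) (h : f ∘ₗ translate Δ f = f) :
    translate Δ f = LinearMap.id := by
  ext x
  refine hf ?_
  have := LinearMap.congr_fun (translate_comp hΔ f f) x
  rwa [← comp_translate_self hΔ hr, h] at this

end Translation

section Bialgebra

variable {k : Type v} [Field k] {A : Type u} [Ring A] [Bialgebra k A]

theorem crossedMul_sum (σ : A ⊗[k] A →ₗ[k] k) (x y : A) {ι ι' : Type*} (s : Finset ι)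
    (s' : Finset ι') (a b : ι → A) (c d : ι' → A)
    (hx : Coalgebra.comul (R := k) x = ∑ i ∈ s, a i ⊗ₜ b i)
    (hy : Coalgebra.comul (R := k) y = ∑ i ∈ s', c i ⊗ₜ d i) :
    crossedMul σ (x ⊗ₜ y) = ∑ i ∈ s, ∑ l ∈ s', σ (a i ⊗ₜ c l) • (b i * d l) := by
  rw [crossedMul_apply, TensorProduct.comul_tmul, hx, hy]
  simp only [TensorProduct.sum_tmul, TensorProduct.tmul_sum, map_sum,
    TensorProduct.AlgebraTensorModule.tensorTensorTensorComm_tmul, TensorProduct.map_tmul,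
    TensorProduct.lid_tmul, LinearMap.mul'_apply]
  rw [Finset.sum_comm]

theorem comul_crossedMul (σ : A ⊗[k] A →ₗ[k] k) : Coalgebra.comul ∘ₗ crossedMul σ =
    TensorProduct.map (crossedMul σ) (LinearMap.mul' k A) ∘ₗ Coalgebra.comul := by
  have h1 : Coalgebra.comul (R := k) (A := A) ∘ₗ LinearMap.mul' k A =
      TensorProduct.map (LinearMap.mul' k A) (LinearMap.mul' k A) ∘ₗ Coalgebra.comul :=
    TensorProduct.ext' fun x y => by
      simp only [LinearMap.comp_apply, LinearMap.mul'_apply, Bialgebra.comul_mul,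
        TensorProduct.comul_tmul]
      exact tensor_mul_eq _ _
  rw [crossedMul, ← LinearMap.comp_assoc, h1, LinearMap.comp_assoc,
    comul_comp_translate Coalgebra.coassoc, ← LinearMap.comp_assoc, LinearMap.map_comp_rTensor]

theorem comul_crossedMul_sum (σ : A ⊗[k] A →ₗ[k] k) (x y : A) {ι ι' : Type*} (s : Finset ι)
    (s' : Finset ι') (a b : ι → A) (c d : ι' → A)
    (hx : Coalgebra.comul (R := k) x = ∑ i ∈ s, a i ⊗ₜ b i)
    (hy : Coalgebra.comul (R := k) y = ∑ i ∈ s', c i ⊗ₜ d i) :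
    Coalgebra.comul (R := k) (crossedMul σ (x ⊗ₜ y)) =
      ∑ p ∈ s ×ˢ s', crossedMul σ (a p.1 ⊗ₜ c p.2) ⊗ₜ (b p.1 * d p.2) := by
  refine (LinearMap.congr_fun (comul_crossedMul σ) (x ⊗ₜ y)).trans ?_
  rw [LinearMap.comp_apply, TensorProduct.comul_tmul, hx, hy, Finset.sum_product]
  simp only [TensorProduct.sum_tmul, TensorProduct.tmul_sum, map_sum,
    TensorProduct.AlgebraTensorModule.tensorTensorTensorComm_tmul, TensorProduct.map_tmul,
    LinearMap.mul'_apply]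
  rw [Finset.sum_comm]

/-- By colinearity of the twisted product, both sides expand into a scalar depending on x₁, y₁, z₁
times x₂y₂z₂, and `h` equates the scalars. -/
theorem crossedMul_assoc {σ : A ⊗[k] A →ₗ[k] k}
    (h : ∀ x y z, σ (crossedMul σ (x ⊗ₜ y) ⊗ₜ z) = σ (x ⊗ₜ crossedMul σ (y ⊗ₜ z))) (x y z : A) :
    crossedMul σ (crossedMul σ (x ⊗ₜ y) ⊗ₜ z) = crossedMul σ (x ⊗ₜ crossedMul σ (y ⊗ₜ z)) := by
  obtain ⟨s, hs⟩ := TensorProduct.exists_finset (Coalgebra.comul (R := k) x)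
  obtain ⟨t, ht⟩ := TensorProduct.exists_finset (Coalgebra.comul (R := k) y)
  obtain ⟨w, hw⟩ := TensorProduct.exists_finset (Coalgebra.comul (R := k) z)
  rw [crossedMul_sum σ _ z _ _ _ _ _ _ (comul_crossedMul_sum σ x y _ _ _ _ _ _ hs ht) hw,
    crossedMul_sum σ x _ _ _ _ _ _ _ hs (comul_crossedMul_sum σ y z _ _ _ _ _ _ ht hw)]
  simp only [Finset.sum_product, h, mul_assoc]

end Bialgebra

section

variable {k : Type v} {H : Type u} [Field k] [Ring H] [HopfAlgebra k H]
  {R : Type u} [Ring R] [Algebra k R] [Coalgebra k R] [Module H R] [IsScalarTower k H R]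
  [YDHopfAlgebra k H R]

/-- The coaction of 1 is trivial, so on 1 ⊗ R the braiding disappears and translation by π becomes a
translation of R by π(1 ⊗ -). -/
theorem translate_one_tmul (π : R ⊗[k] R →ₗ[k] k) (s : R) :
    translate (braidedComul k H R) π (1 ⊗ₜ s) =
      1 ⊗ₜ translate Coalgebra.comul (π ∘ₗ TensorProduct.mk k R R 1) s := by
  rw [translate, translate, LinearMap.comp_apply, LinearMap.comp_apply, braidedComul,
    LinearMap.comp_apply, TensorProduct.map_tmul, YDHopfAlgebra.comul_one H, LinearMap.comp_apply,
    LinearMap.comp_apply]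
  generalize Coalgebra.comul (R := k) s = t
  induction t using TensorProduct.induction_on with
  | zero => simp
  | add x y hx hy => simp only [map_add, TensorProduct.tmul_add, hx, hy]
  | tmul a b =>
    have h1 : ydCoact k H R 1 = ∑ _i ∈ ({()} : Finset Unit), (1 : H) ⊗ₜ (1 : R) := by
      simp [ydCoact, YDHopfAlgebra.coact_one]
    rw [midBraid_sum _ _ _ _ 1 1 a b _ _ _ h1]
    simp

theorem translate_tmul_one (π : R ⊗[k] R →ₗ[k] k) (r : R) :
    translate (braidedComul k H R) π (r ⊗ₜ 1) =
      translate Coalgebra.comul (π ∘ₗ (TensorProduct.mk k R R).flip 1) r ⊗ₜ 1 := by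
  rw [translate, translate, LinearMap.comp_apply, LinearMap.comp_apply, braidedComul,
    LinearMap.comp_apply, TensorProduct.map_tmul, YDHopfAlgebra.comul_one H, LinearMap.comp_apply,
    LinearMap.comp_apply]
  generalize Coalgebra.comul (R := k) r = t
  induction t using TensorProduct.induction_on with
  | zero => simp
  | add x y hx hy => simp only [map_add, TensorProduct.add_tmul, hx, hy]
  | tmul a b =>
    obtain ⟨w, hw⟩ := TensorProduct.exists_finset (ydCoact k H R b)
    rw [midBraid_sum _ _ _ _ a b 1 1 _ _ _ hw]
    have h2 : ∀ p : H × R, (a ⊗ₜ[k] (p.1 • (1 : R))) ⊗ₜ[k] (p.2 ⊗ₜ[k] (1 : R)) =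
        (a ⊗ₜ 1) ⊗ₜ ((Coalgebra.counit (R := k) p.1 • p.2) ⊗ₜ 1) := fun p => by
      rw [HModuleAlgebra.smul_one (k := k), TensorProduct.tmul_smul, TensorProduct.smul_tmul,
        TensorProduct.smul_tmul']
    simp only [h2]
    rw [← TensorProduct.tmul_sum, ← TensorProduct.sum_tmul, sum_counit_smul b w _ _ hw]
    simp [TensorProduct.smul_tmul']

theorem IsTwoCocycle.translate_bijective {π : R ⊗[k] R →ₗ[k] k} (hπ : IsTwoCocycle k H π) :
    Function.Bijective (translate (braidedComul k H R) π) := by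
  obtain ⟨π', -, h1, h2⟩ := hπ.invertible
  exact BraidedCleft.translate_bijective (e := tensorCounit k R) braidedComul_coassoc
    tensorCounit_rTensor_braidedComul π π' h1 h2

theorem IsTwoCocycle.cocycle_apply {π : R ⊗[k] R →ₗ[k] k} (hπ : IsTwoCocycle k H π) (r s t : R) :
    π (hat k H π (r ⊗ₜ s) ⊗ₜ t) = π (r ⊗ₜ hat k H π (s ⊗ₜ t)) :=
  LinearMap.congr_fun hπ.cocycle ((r ⊗ₜ s) ⊗ₜ t)

theorem hat_one_tmul_eq (π : R ⊗[k] R →ₗ[k] k) (s : R) : hat k H π (1 ⊗ₜ s) =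
    translate Coalgebra.comul (π ∘ₗ TensorProduct.mk k R R 1) s := by
  rw [hat_eq, LinearMap.comp_apply, translate_one_tmul, LinearMap.mul'_apply, one_mul]

theorem hat_tmul_one_eq (π : R ⊗[k] R →ₗ[k] k) (r : R) : hat k H π (r ⊗ₜ 1) =
    translate Coalgebra.comul (π ∘ₗ (TensorProduct.mk k R R).flip 1) r := by
  rw [hat_eq, LinearMap.comp_apply, translate_tmul_one, LinearMap.mul'_apply, mul_one]

theorem IsTwoCocycle.hat_one_one {π : R ⊗[k] R →ₗ[k] k} (hπ : IsTwoCocycle k H π) :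
    hat k H π (1 ⊗ₜ 1) = 1 := by
  rw [hat_one_tmul_eq, translate, LinearMap.comp_apply, LinearMap.comp_apply,
    YDHopfAlgebra.comul_one H]
  simp [hπ.normalized]

theorem tmul_one_injective {k R : Type*} [Field k] [Ring R] [Algebra k R] [Coalgebra k R]
    (h1 : Coalgebra.counit (R := k) (1 : R) = 1) : Function.Injective fun s : R => s ⊗ₜ[k] (1 : R) := fun x y h => by
  have := congrArg (TensorProduct.rid k R ∘ (Coalgebra.counit (R := k) (A := R)).lTensor R) h
  simpa [h1] using this

theorem one_tmul_injective {k R : Type*} [Field k] [Ring R] [Algebra k R] [Coalgebra k R]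
    (h1 : Coalgebra.counit (R := k) (1 : R) = 1) : Function.Injective fun s : R => (1 : R) ⊗ₜ[k] s := fun x y h => by
  have := congrArg (TensorProduct.lid k R ∘ (Coalgebra.counit (R := k) (A := R)).rTensor R) h
  simpa [h1] using this

/-- Only π(1 ⊗ 1) = 1 is assumed. For f = π(1 ⊗ -), the cocycle identity at (1, 1, t) says that f is
unchanged by its own translation, and that translation is injective because π is invertible, so
`translate_eq_id` applies. -/
theorem IsTwoCocycle.hat_one_tmul {π : R ⊗[k] R →ₗ[k] k} (hπ : IsTwoCocycle k H π) (s : R) :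
    hat k H π (1 ⊗ₜ s) = s := by
  have h1 : translate Coalgebra.comul (π ∘ₗ TensorProduct.mk k R R 1) = LinearMap.id := by
    refine translate_eq_id Coalgebra.coassoc Coalgebra.lTensor_counit_comp_comul
      (fun x y h => ?_) ?_
    · refine one_tmul_injective (YDHopfAlgebra.counit_one (k := k) H) (hπ.translate_bijective.1 ?_)
      simp only [translate_one_tmul, h]
    · ext t
      have h2 := hπ.cocycle_apply 1 1 t
      rw [hπ.hat_one_one, hat_one_tmul_eq] at h2
      exact h2.symm
  rw [hat_one_tmul_eq, h1]
  rfl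

theorem IsTwoCocycle.hat_tmul_one {π : R ⊗[k] R →ₗ[k] k} (hπ : IsTwoCocycle k H π) (r : R) :
    hat k H π (r ⊗ₜ 1) = r := by
  have h1 : translate Coalgebra.comul (π ∘ₗ (TensorProduct.mk k R R).flip 1) = LinearMap.id := by
    refine translate_eq_id Coalgebra.coassoc Coalgebra.lTensor_counit_comp_comul
      (fun x y h => ?_) ?_
    · refine tmul_one_injective (YDHopfAlgebra.counit_one (k := k) H) (hπ.translate_bijective.1 ?_)
      simp only [translate_tmul_one, h]
    · ext t
      have h2 := hπ.cocycle_apply t 1 1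
      rw [hπ.hat_one_one, hat_tmul_one_eq] at h2
      exact h2
  rw [hat_tmul_one_eq, h1]
  rfl

/-- With its right and left companions this moves every factor from H to the outside of a twisted
product. The middle and right rules hold for any π; the left one needs H-linearity. -/
theorem crossedMul_Phi_middle (π : R ⊗[k] R →ₗ[k] k) (x y : Smash k H R) (h : H) :
    crossedMul (Phi π) ((x * Smash.inr k H R h) ⊗ₜ y) =
      crossedMul (Phi π) (x ⊗ₜ (Smash.inr k H R h * y)) := by
  have h1 := map_comul_balanced comul_inrLeft comul_inrRight (isBalanced_Phi π).middle
    (G := LinearMap.mul' k (Smash k H R)) (fun t h => by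
      induction t using TensorProduct.induction_on with
      | zero => simp
      | add x y hx hy => simp only [add_mul, mul_add, map_add, hx, hy]
      | tmul x y => simp [inrLeft_apply, inrRight_apply, mul_assoc]) (x ⊗ₜ y) h
  rw [inrLeft_apply, inrRight_apply, Algebra.TensorProduct.tmul_mul_tmul,
    Algebra.TensorProduct.tmul_mul_tmul, mul_one, one_mul] at h1
  rw [crossedMul_apply, crossedMul_apply, h1]

theorem crossedMul_Phi_right (π : R ⊗[k] R →ₗ[k] k) (x y : Smash k H R) (h : H) :
    crossedMul (Phi π) (x ⊗ₜ (y * Smash.inr k H R h)) =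
      crossedMul (Phi π) (x ⊗ₜ y) * Smash.inr k H R h := by
  have h1 := map_comul_mul_image comul_inrRight (F := Phi π)
    ((LinearMap.mul k (Smash k H R)).flip ∘ₗ (Smash.inr k H R).toLinearMap)
    (isBalanced_Phi π).right
    (G := LinearMap.mul' k (Smash k H R)) (fun t h => by
      induction t using TensorProduct.induction_on with
      | zero => simp
      | add x y hx hy => simp only [add_mul, map_add, hx, hy]
      | tmul x y => simp [inrRight_apply, mul_assoc]) (x ⊗ₜ y) h
  rw [inrRight_apply, Algebra.TensorProduct.tmul_mul_tmul, mul_one] at h1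
  rw [crossedMul_apply, crossedMul_apply, h1]
  generalize TensorProduct.map (Phi π) (LinearMap.mul' k (Smash k H R))
    (Coalgebra.comul (R := k) (x ⊗ₜ[k] y)) = w
  induction w using TensorProduct.induction_on with
  | zero => simp
  | add x y hx hy => simp only [map_add, add_mul, hx, hy]
  | tmul a b => simp

theorem crossedMul_Phi_left {π : R ⊗[k] R →ₗ[k] k} (hπ : IsTwoCocycle k H π)
    (x y : Smash k H R) (h : H) : crossedMul (Phi π) ((Smash.inr k H R h * x) ⊗ₜ y) =
      Smash.inr k H R h * crossedMul (Phi π) (x ⊗ₜ y) := by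
  have h1 := translate_inrLeft_mul (Phi_inrLeft_mul hπ.linear) (x ⊗ₜ y) h
  rw [inrLeft_apply, Algebra.TensorProduct.tmul_mul_tmul, one_mul] at h1
  rw [crossedMul, LinearMap.comp_apply, h1, LinearMap.comp_apply]
  generalize translate Coalgebra.comul (Phi π) (x ⊗ₜ[k] y) = w
  induction w using TensorProduct.induction_on with
  | zero => simp
  | add x y hx hy => simp only [map_add, mul_add, hx, hy]
  | tmul a b => simp [mul_assoc]

theorem crossedMul_Phi_inl (π : R ⊗[k] R →ₗ[k] k) (r s : R) :
    crossedMul (Phi π) (Smash.inl k H R r ⊗ₜ Smash.inl k H R s) =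
      Smash.inl k H R (hat k H π (r ⊗ₜ s)) :=
  LinearMap.congr_fun (crossedMul_Phi_comp_inlTensor (H := H) π) (r ⊗ₜ s)

theorem Phi_middle (π : R ⊗[k] R →ₗ[k] k) (x y : Smash k H R) (h : H) :
    Phi π ((x * Smash.inr k H R h) ⊗ₜ y) = Phi π (x ⊗ₜ (Smash.inr k H R h * y)) := by
  have := (isBalanced_Phi π).middle (x ⊗ₜ y) h
  rwa [inrLeft_apply, inrRight_apply, Algebra.TensorProduct.tmul_mul_tmul,
    Algebra.TensorProduct.tmul_mul_tmul, mul_one, one_mul] at this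

theorem Phi_right (π : R ⊗[k] R →ₗ[k] k) (x y : Smash k H R) (h : H) :
    Phi π (x ⊗ₜ (y * Smash.inr k H R h)) = Coalgebra.counit (R := k) h • Phi π (x ⊗ₜ y) := by
  have := (isBalanced_Phi π).right (x ⊗ₜ y) h
  rwa [inrRight_apply, Algebra.TensorProduct.tmul_mul_tmul, mul_one] at this

/-- The factors from H are stripped from z, then from y, then from x, until only the cocycle
identity of π on R remains. -/
theorem IsTwoCocycle.Phi_cocycle {π : R ⊗[k] R →ₗ[k] k} (hπ : IsTwoCocycle k H π)
    (x y z : Smash k H R) :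
    Phi (H := H) π (crossedMul (Phi (H := H) π) (x ⊗ₜ y) ⊗ₜ z) =
      Phi (H := H) π (x ⊗ₜ crossedMul (Phi (H := H) π) (y ⊗ₜ z)) := by
  have h1 : ∀ (r s : R) (z : Smash k H R), Phi (H := H) π
      (crossedMul (Phi (H := H) π) (Smash.inl k H R r ⊗ₜ Smash.inl k H R s) ⊗ₜ z) =
      Phi (H := H) π (Smash.inl k H R r ⊗ₜ
        crossedMul (Phi (H := H) π) (Smash.inl k H R s ⊗ₜ z)) := by
    intro r s z
    induction z using Smash.induction with
    | zero => simp
    | add x y hx hy => simp only [map_add, TensorProduct.tmul_add, hx, hy]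
    | mul t h =>
      rw [Phi_right, crossedMul_Phi_right, Phi_right, crossedMul_Phi_inl, crossedMul_Phi_inl]
      congr 1
      have h2 : ∀ a b, Phi (H := H) π (Smash.inl k H R a ⊗ₜ Smash.inl k H R b) = π (a ⊗ₜ b) :=
        fun a b => LinearMap.congr_fun (Phi_comp_inlTensor (H := H) π) (a ⊗ₜ b)
      rw [h2, h2, hπ.cocycle_apply]
  have h2 : ∀ (r : R) (y z : Smash k H R), Phi (H := H) π
      (crossedMul (Phi (H := H) π) (Smash.inl k H R r ⊗ₜ y) ⊗ₜ z) =
      Phi (H := H) π (Smash.inl k H R r ⊗ₜ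
        crossedMul (Phi (H := H) π) (y ⊗ₜ z)) := by
    intro r y z
    induction y using Smash.induction with
    | zero => simp
    | add x y hx hy => simp only [map_add, TensorProduct.tmul_add, TensorProduct.add_tmul, hx, hy]
    | mul s h => rw [crossedMul_Phi_right, Phi_middle, h1, crossedMul_Phi_middle]
  induction x using Smash.induction with
  | zero => simp
  | add x y hx hy => simp only [map_add, TensorProduct.add_tmul, hx, hy]
  | mul r h => rw [crossedMul_Phi_middle, h2, crossedMul_Phi_left hπ, Phi_middle]

theorem Smash.inl_injective : Function.Injective (Smash.inl k H R) := fun x y h => by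
  have h1 := congrArg (Smash.fst k H R) h
  simpa [Smash.inl_apply, Smash.fst_mk] using h1

/-- R embeds multiplicatively in the twisted product on R # H, which is associative; this replaces a
computation with the braiding. -/
theorem IsTwoCocycle.hat_assoc {π : R ⊗[k] R →ₗ[k] k} (hπ : IsTwoCocycle k H π) (r s t : R) :
    hat k H π (hat k H π (r ⊗ₜ s) ⊗ₜ t) = hat k H π (r ⊗ₜ hat k H π (s ⊗ₜ t)) := by
  refine Smash.inl_injective (k := k) (H := H) ?_
  rw [← crossedMul_Phi_inl, ← crossedMul_Phi_inl, ← crossedMul_Phi_inl, ← crossedMul_Phi_inl]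
  exact crossedMul_assoc hπ.Phi_cocycle _ _ _

theorem IsTwoCocycle.hat_diagAct {π : R ⊗[k] R →ₗ[k] k} (hπ : IsTwoCocycle k H π) (h : H)
    (x : R ⊗[k] R) : hat k H π (diagAct k H R R (h ⊗ₜ x)) = h • hat k H π x := by
  rw [hat_eq, LinearMap.comp_apply, translate_diagAct hπ.linear, LinearMap.comp_apply]
  generalize translate (braidedComul k H R) π x = w
  induction w using TensorProduct.induction_on with
  | zero => simp
  | add x y hx hy => simp only [map_add, TensorProduct.tmul_add, smul_add, hx, hy]
  | tmul a b => exact (HModuleAlgebra.smul_mul h a b).symm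

theorem comul_hat (π : R ⊗[k] R →ₗ[k] k) : Coalgebra.comul ∘ₗ hat k H π =
    TensorProduct.map (hat k H π) (LinearMap.mul' k R) ∘ₗ braidedComul k H R := by
  have h1 : Coalgebra.comul (R := k) (A := R) ∘ₗ LinearMap.mul' k R =
      TensorProduct.map (LinearMap.mul' k R) (LinearMap.mul' k R) ∘ₗ braidedComul k H R :=
    TensorProduct.ext' fun x y => YDHopfAlgebra.comul_mul x y
  rw [hat_eq, ← LinearMap.comp_assoc, h1, LinearMap.comp_assoc,
    comul_comp_translate braidedComul_coassoc, ← LinearMap.comp_assoc, LinearMap.map_comp_rTensor]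

/-- The braiding moves r₂ only past the first part of the second argument, so this is again
coassociativity there, with the comultiplied first argument as a parameter. -/
theorem splitRight_braidedComul :
    (TensorProduct.assoc k _ _ R).toLinearMap ∘ₗ
      (braidedComul k H R).rTensor R ∘ₗ splitRight k R R =
      (splitRight k R R).lTensor _ ∘ₗ braidedComul k H R := by
  refine TensorProduct.ext' fun x y => ?_
  let Λ : R ⊗[k] R →ₗ[k] R ⊗[k] (R ⊗[k] R) →ₗ[k] (R ⊗[k] R) ⊗[k] ((R ⊗[k] R) ⊗[k] R) :=
    TensorProduct.curry ((TensorProduct.assoc k R R R).symm.toLinearMap.lTensor (R ⊗[k] R) ∘ₗ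
      midBraid (ydCoact k H R) R R (R ⊗[k] R))
  have h1 := congrArg (Λ (Coalgebra.comul x)) (Coalgebra.coassoc_apply (R := k) y)
  refine Eq.trans ?_ (h1.trans ?_)
  · simp only [LinearMap.comp_apply, splitRight, LinearMap.lTensor_tmul]
    generalize Coalgebra.comul (R := k) y = u
    induction u using TensorProduct.induction_on with
    | zero => simp
    | add x y hx hy => simp only [map_add, TensorProduct.tmul_add, hx, hy]
    | tmul y z =>
    simp only [LinearEquiv.coe_coe, TensorProduct.assoc_symm_tmul, LinearMap.rTensor_tmul,
      braidedComul, LinearMap.comp_apply, TensorProduct.map_tmul]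
    generalize Coalgebra.comul (R := k) x = t
    generalize Coalgebra.comul (R := k) y = u
    induction t using TensorProduct.induction_on with
    | zero => simp
    | add x y hx hy => simp only [map_add, TensorProduct.add_tmul, LinearMap.add_apply, hx, hy]
    | tmul a b =>
    induction u using TensorProduct.induction_on with
    | zero => simp
    | add x y hx hy => simp only [map_add, TensorProduct.tmul_add, TensorProduct.add_tmul, hx, hy]
    | tmul c d =>
      obtain ⟨w, hw⟩ := TensorProduct.exists_finset (ydCoact k H R b)
      rw [midBraid_sum _ _ _ _ a b c d _ _ _ hw]
      simp only [Λ, TensorProduct.curry_apply, TensorProduct.assoc_tmul, LinearMap.comp_apply]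
      rw [midBraid_sum _ _ _ _ a b c (d ⊗ₜ z) _ _ _ hw]
      simp [TensorProduct.sum_tmul]
  · simp only [LinearMap.comp_apply, splitRight, braidedComul, TensorProduct.map_tmul]
    generalize Coalgebra.comul (R := k) x = t
    generalize Coalgebra.comul (R := k) y = u
    induction t using TensorProduct.induction_on with
    | zero => simp
    | add x y hx hy => simp only [map_add, TensorProduct.add_tmul, LinearMap.add_apply, hx, hy]
    | tmul a b =>
    induction u using TensorProduct.induction_on with
    | zero => simp
    | add x y hx hy => simp only [map_add, TensorProduct.tmul_add, hx, hy]
    | tmul c d =>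
      obtain ⟨w, hw⟩ := TensorProduct.exists_finset (ydCoact k H R b)
      rw [midBraid_sum _ _ _ _ a b c d _ _ _ hw]
      simp only [Λ, TensorProduct.curry_apply, LinearMap.lTensor_tmul, LinearMap.comp_apply]
      rw [midBraid_sum _ _ _ _ a b c _ _ _ _ hw]
      simp

/-- Equivariance rests on H-linearity of Δ on R and coassociativity of H; it is what makes the
inverse of the section H-linear. -/
theorem canonicalMap_diagAct {μ : R ⊗[k] R →ₗ[k] R}
    (hμ : ∀ (h : H) x, μ (diagAct k H R R (h ⊗ₜ x)) = h • μ x) (h : H) (x : R ⊗[k] R) :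
    canonicalMap μ LinearMap.id (diagAct k H R R (h ⊗ₜ x)) =
      diagAct k H R R (h ⊗ₜ canonicalMap μ LinearMap.id x) := by
  induction x using TensorProduct.induction_on with
  | zero => simp
  | add x y hx hy => simp only [map_add, TensorProduct.tmul_add, hx, hy]
  | tmul r c =>
  simp only [canonicalMap_id, LinearMap.comp_apply, splitRight, LinearMap.lTensor_tmul]
  have h1 : (Coalgebra.comul (R := k) (A := R)).lTensor R (diagAct k H R R (h ⊗ₜ (r ⊗ₜ c))) =
      TensorProduct.map (orbit k H r) (diagAct k H R R ∘ₗ (TensorProduct.mk k _ _).flip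
        (Coalgebra.comul (R := k) c)) (Coalgebra.comul (R := k) h) := by
    rw [diagAct_comul]
    generalize Coalgebra.comul (R := k) h = t
    induction t using TensorProduct.induction_on with
    | zero => simp
    | add x y hx hy => simp only [map_add, hx, hy]
    | tmul a b => simp [YDHopfAlgebra.comul_smul]
  rw [h1]
  generalize Coalgebra.comul (R := k) c = w
  induction w using TensorProduct.induction_on with
  | zero => simp
  | add x y hx hy =>
    simp only [map_add, TensorProduct.tmul_add, LinearMap.comp_add, TensorProduct.map_add_right,
      LinearMap.add_apply, hx, hy]
  | tmul a b =>
  have h2 := congrArg (TensorProduct.map (μ ∘ₗ TensorProduct.map (orbit k H r) (orbit k H a))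
    (orbit k H b) ∘ₗ (TensorProduct.assoc k H H H).symm.toLinearMap)
    (Coalgebra.coassoc_apply (R := k) h)
  refine Eq.trans ?_ (h2.symm.trans ?_)
  · generalize Coalgebra.comul (R := k) h = t
    induction t using TensorProduct.induction_on with
    | zero => simp
    | add x y hx hy => simp only [map_add, hx, hy]
    | tmul p q =>
    simp only [TensorProduct.map_tmul, LinearMap.comp_apply, LinearMap.flip_apply,
      TensorProduct.mk_apply, diagAct_comul, LinearMap.lTensor_tmul]
    generalize Coalgebra.comul (R := k) q = t
    induction t using TensorProduct.induction_on with
    | zero => simp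
    | add x y hx hy => simp only [map_add, TensorProduct.tmul_add, hx, hy]
    | tmul p q => simp
  · simp only [LinearEquiv.coe_coe, TensorProduct.assoc_symm_tmul, LinearMap.rTensor_tmul]
    rw [diagAct_comul]
    generalize Coalgebra.comul (R := k) h = t
    induction t using TensorProduct.induction_on with
    | zero => simp
    | add x y hx hy => simp only [map_add, hx, hy]
    | tmul p q =>
    have h3 := hμ p (r ⊗ₜ a)
    rw [diagAct_comul] at h3
    simp [h3]

end

end
end BraidedCleft

/-! ### The cleft object on R defined by π, and its smash product. -/

namespace BraidedCleft

noncomputable section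

set_option linter.unusedSectionVars false

section

variable {k : Type v} {H : Type u} [Field k] [Ring H] [HopfAlgebra k H]
  {R : Type u} [Ring R] [Algebra k R] [Coalgebra k R] [Module H R] [IsScalarTower k H R]
  [YDHopfAlgebra k H R]

/-- The space `R`, to be equipped with the multiplication `hat π`. -/
def Twisted {π : R ⊗[k] R →ₗ[k] k} (_ : IsTwoCocycle k H π) : Type u := R

namespace Twisted

variable {π : R ⊗[k] R →ₗ[k] k} (hπ : IsTwoCocycle k H π)

instance : AddCommGroup (Twisted hπ) := inferInstanceAs (AddCommGroup R)
instance : Module k (Twisted hπ) := inferInstanceAs (Module k R)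

/-- The multiplication `hat π`. -/
def mul : Twisted hπ ⊗[k] Twisted hπ →ₗ[k] Twisted hπ := hat (R := R) k H π

instance : Ring (Twisted hπ) where
  mul x y := mul hπ (x ⊗ₜ y)
  one := (1 : R)
  mul_assoc := hπ.hat_assoc
  one_mul := hπ.hat_one_tmul
  mul_one := hπ.hat_tmul_one
  left_distrib x y z := by
    change mul hπ (x ⊗ₜ (y + z)) = mul hπ _ + mul hπ _
    rw [TensorProduct.tmul_add, map_add]
  right_distrib x y z := by
    change mul hπ ((x + y) ⊗ₜ z) = mul hπ _ + mul hπ _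
    rw [TensorProduct.add_tmul, map_add]
  zero_mul x := by
    change mul hπ (0 ⊗ₜ x) = 0
    rw [TensorProduct.zero_tmul, map_zero]
  mul_zero x := by
    change mul hπ (x ⊗ₜ 0) = 0
    rw [TensorProduct.tmul_zero, map_zero]

instance : Algebra k (Twisted hπ) :=
  Algebra.ofModule
    (fun c x y => by
      change mul hπ ((c • x) ⊗ₜ y) = c • mul hπ _
      rw [← TensorProduct.smul_tmul', map_smul])
    (fun c x y => by
      change mul hπ (x ⊗ₜ (c • y)) = c • mul hπ _
      rw [TensorProduct.tmul_smul, map_smul])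

instance : Module H (Twisted hπ) := inferInstanceAs (Module H R)
instance : IsScalarTower k H (Twisted hπ) := inferInstanceAs (IsScalarTower k H R)

theorem mul'_eq : LinearMap.mul' k (Twisted hπ) = mul hπ := TensorProduct.ext' fun _ _ => rfl

instance : HModuleAlgebra k H (Twisted hπ) where
  smul_one := HModuleAlgebra.smul_one (k := k) (H := H) (E := R)
  smul_mul h x y := by
    rw [mul'_eq]
    exact (hπ.hat_diagAct h _).symm

end Twisted

/-- It is translation by π, bijective since π is invertible, followed by the canonical map of R,
bijective by the antipode of R. -/
theorem IsTwoCocycle.canonicalMap_bijective {π : R ⊗[k] R →ₗ[k] k} (hπ : IsTwoCocycle k H π) :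
    Function.Bijective (canonicalMap (hat k H π) (LinearMap.id (M := R))) := by
  obtain ⟨S, -, -, h1, h2⟩ := YDHopfAlgebra.exists_antipode (k := k) (H := H) (R := R)
  rw [linearMap_eq_toSpanSingleton] at h1 h2
  have h4 := canonicalMap_comp_translate (splitRight_braidedComul (k := k) (H := H) (R := R))
    (LinearMap.mul' k R) π
  rw [hat_eq, h4, LinearMap.coe_comp]
  have h3 := BraidedCleft.canonicalMap_bijective (μ := LinearMap.mul' k R) (u := 1)
    (fun x y z => by simp [mul_assoc]) (fun x => by simp) (LinearMap.id (M := R)) S h2 h1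
  exact h3.comp hπ.translate_bijective

theorem IsTwoCocycle.exists_sect_inverse {π : R ⊗[k] R →ₗ[k] k} (hπ : IsTwoCocycle k H π) :
    ∃ g : R →ₗ[k] R, (∀ (h : H) r, g (h • r) = h • g r) ∧
      conv (hat k H π) Coalgebra.comul LinearMap.id g =
        LinearMap.toSpanSingleton k R 1 ∘ₗ Coalgebra.counit ∧
      conv (hat k H π) Coalgebra.comul g LinearMap.id =
        LinearMap.toSpanSingleton k R 1 ∘ₗ Coalgebra.counit := by
  obtain ⟨g, h1, h2, h3⟩ := exists_conv_inverse_of_canonicalMap hπ.hat_assoc hπ.hat_tmul_one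
    hπ.hat_one_tmul LinearMap.id hπ.canonicalMap_bijective
  refine ⟨g, fun h r => ?_, h1, h2⟩
  -- The value g(r) is id ⊗ ε of the preimage t of 1 ⊗ r. As h acts on 1 ⊗ r through r alone and the
  -- canonical map is equivariant, h applied to t is the preimage of 1 ⊗ h • r.
  obtain ⟨t, ht⟩ := hπ.canonicalMap_bijective.2 (1 ⊗ₜ r)
  have h4 : canonicalMap (hat k H π) LinearMap.id (diagAct k H R R (h ⊗ₜ t)) = 1 ⊗ₜ (h • r) := by
    rw [canonicalMap_diagAct hπ.hat_diagAct, ht, diagAct_comul]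
    obtain ⟨w, hw⟩ := TensorProduct.exists_finset (Coalgebra.comul (R := k) h)
    conv_rhs => rw [← sum_counit_smul_eq hw]
    rw [hw]
    simp [HModuleAlgebra.smul_one (k := k), TensorProduct.smul_tmul, Finset.sum_smul,
      TensorProduct.tmul_sum]
  rw [h3 _ _ h4, h3 _ _ ht]
  generalize t = t
  induction t using TensorProduct.induction_on with
  | zero => simp
  | add x y hx hy => simp only [map_add, TensorProduct.tmul_add, smul_add, hx, hy]
  | tmul a b =>
    have h5 := congrArg (TensorProduct.rid k H) (Coalgebra.lTensor_counit_comul (R := k) h)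
    rw [diagAct_comul]
    simp only [TensorProduct.rid_tmul, one_smul, LinearMap.lTensor_tmul] at h5 ⊢
    rw [smul_comm]
    conv_rhs => rw [← h5]
    generalize Coalgebra.comul (R := k) h = w
    induction w using TensorProduct.induction_on with
    | zero => simp
    | add x y hx hy => simp only [map_add, add_smul, smul_add, hx, hy]
    | tmul p q => simp [YDHopfAlgebra.counit_smul, smul_smul, mul_comm]

theorem eq_counit_smul_one {k R : Type*} [Field k] [Ring R] [Algebra k R] [Coalgebra k R] {x : R}
    (hx : Coalgebra.comul (R := k) x = x ⊗ₜ 1) : x = Coalgebra.counit (R := k) x • 1 := by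
  have h1 := congrArg (TensorProduct.lid k R) (Coalgebra.rTensor_counit_comul (R := k) x)
  rw [hx] at h1
  simpa using h1.symm

/-- The pair `(k #_π R, id)`. -/
def IsTwoCocycle.cleftPair {π : R ⊗[k] R →ₗ[k] k} (hπ : IsTwoCocycle k H π) :
    CleftPair k H R where
  carrier := Twisted hπ
  coact := Coalgebra.comul (R := k) (A := R)
  coact_linear := YDHopfAlgebra.comul_smul (k := k) (H := H) (R := R)
  coact_coassoc := Coalgebra.coassoc (R := k) (A := R)
  coact_counit := Coalgebra.lTensor_counit_comp_comul (R := k) (A := R)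
  coact_one := YDHopfAlgebra.comul_one (k := k) (R := R) H
  coact_mul x y := by
    rw [Twisted.mul'_eq]
    exact LinearMap.congr_fun (comul_hat (H := H) π) (x ⊗ₜ[k] y)
  one_ne_zero h := by
    have h1 := YDHopfAlgebra.counit_one (k := k) (R := R) H
    rw [show (1 : R) = 0 from h, map_zero] at h1
    exact zero_ne_one h1
  coinvariants x hx := ⟨_, eq_counit_smul_one (R := R) hx⟩
  sect := LinearMap.id (R := k) (M := R)
  sect_linear _ _ := rfl
  sect_one := rfl
  sect_colinear := by
    refine (LinearMap.comp_id _).trans ?_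
    refine ((congrArg (· ∘ₗ Coalgebra.comul (R := k) (A := R)) (LinearMap.rTensor_id R R)).trans
      (LinearMap.id_comp _)).symm
  sect_invertible := by
    obtain ⟨g, h1, h2, h3⟩ := hπ.exists_sect_inverse
    refine ⟨g, h1, ?_, ?_⟩
    · rw [linearMap_eq_toSpanSingleton, Twisted.mul'_eq]
      exact h2
    · rw [linearMap_eq_toSpanSingleton, Twisted.mul'_eq]
      exact h3

/-- Factors from H move out on both sides by the rules for Φ(π) and by H-bilinearity of γ ⊗ id,
leaving multiplicativity of γ on R. -/
theorem smashSect_crossedMul {E : Type u} [Ring E] [Algebra k E] [Module H E] [IsScalarTower k H E]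
    [HModuleAlgebra k H E] (π : R ⊗[k] R →ₗ[k] k) (γ : R →ₗ[k] E)
    (hγ : ∀ (h : H) (r : R), γ (h • r) = h • γ r)
    (hmul : ∀ r s, γ (hat k H π (r ⊗ₜ s)) = γ r * γ s) (x y : Smash k H R) :
    smashSect γ (crossedMul (Phi (H := H) π) (x ⊗ₜ y)) = smashSect γ x * smashSect γ y := by
  have hinl : ∀ r, smashSect γ (Smash.inl k H R r) = Smash.inl k H E (γ r) := fun r => by
    rw [Smash.inl_apply, smashSect_mk, map_one, mul_one]
  have h1 : ∀ (r : R) (y : Smash k H R), smashSect γ (crossedMul (Phi (H := H) π)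
      (Smash.inl k H R r ⊗ₜ y)) = Smash.inl k H E (γ r) * smashSect γ y := by
    intro r y
    induction y using Smash.induction with
    | zero => simp
    | add x y hx hy => simp only [TensorProduct.tmul_add, map_add, mul_add, hx, hy]
    | mul s z =>
      rw [crossedMul_Phi_right, crossedMul_Phi_inl, smashSect_mul_inr, smashSect_mul_inr, hinl,
        hinl, hmul, map_mul, mul_assoc]
  induction x using Smash.induction with
  | zero => simp
  | add x y hx hy => simp only [TensorProduct.add_tmul, map_add, add_mul, hx, hy]
  | mul r h =>
    rw [crossedMul_Phi_middle, h1, smashSect_inr_mul γ hγ, smashSect_mul_inr, hinl, mul_assoc]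

/-- The section of any cleft object is bijective, colinear and unital, so it is the isomorphism as
soon as it is multiplicative for the twisted product. -/
theorem IsTwoCocycle.crossedPair_isIso {π : R ⊗[k] R →ₗ[k] k} (hπ : IsTwoCocycle k H π) :
    (crossedPair (Phi (H := H) π)).IsIso hπ.cleftPair.smash := by
  have hP := hπ.cleftPair.isCleft_smash
  refine ⟨LinearEquiv.ofBijective hπ.cleftPair.smash.sect hP.sect_bijective, fun x y => ?_,
    hP.sect_one, LinearMap.congr_fun hP.sect_colinear, fun a => rfl⟩
  rw [crossedPair_mul]
  exact smashSect_crossedMul π hπ.cleftPair.sect hπ.cleftPair.sect_linear (fun r s => rfl) x y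

theorem exists_Psi_eq {π : R ⊗[k] R →ₗ[k] k} (hπ : IsTwoCocycle k H π) :
    ∃ y : BraidedCleftClass k H R, (⟦crossedPair (Phi π)⟧ : PairClass k (Smash k H R)) =
      Psi k H R y :=
  ⟨⟦hπ.cleftPair⟧, Quotient.sound hπ.crossedPair_isIso⟩

end

end
end BraidedCleft

theorem mainTheorem7 {k : Type v} {H R : Type u} [Field k] [Ring H] [HopfAlgebra k H]
    [Ring R] [Algebra k R] [Coalgebra k R] [Module H R] [IsScalarTower k H R]
    [YDHopfAlgebra k H R] :
    CPrime k H R = {x | ∃ y : BraidedCleftClass k H R, x = Psi k H R y} ∧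
    CPrime k H R = {x | ∃ π : R ⊗[k] R →ₗ[k] k, IsTwoCocycle k H π ∧
      x = ⟦crossedPair (Phi π)⟧} := by
  have h1 : ∀ x ∈ CPrime k H R, ∃ π : R ⊗[k] R →ₗ[k] k, IsTwoCocycle k H π ∧
      x = ⟦crossedPair (Phi π)⟧ := fun x hx =>
    CPrime.exists_isTwoCocycle hx
  have h2 : ∀ π : R ⊗[k] R →ₗ[k] k, IsTwoCocycle k H π →
      ∃ y : BraidedCleftClass k H R, ⟦crossedPair (Phi π)⟧ = Psi k H R y :=
    fun π hπ => exists_Psi_eq hπ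
  -- Each equality uses two sides of the cycle C' ⊆ twisted products ⊆ smash products ⊆ C'.
  constructor <;> refine Set.Subset.antisymm (fun x hx => ?_) ?_
  · obtain ⟨π, hπ, rfl⟩ := h1 x hx
    exact h2 π hπ
  · rintro x ⟨y, rfl⟩
    exact Psi_mem_CPrime y
  · exact h1 x hx
  · rintro x ⟨π, hπ, rfl⟩
    obtain ⟨y, hy⟩ := h2 π hπ
    rw [hy]
    exact Psi_mem_CPrime y
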